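/- Let $N$ be a smooth 7-dimensional manifold. A quaternionic contact structure on $N$ is an oriented distribution $H\subset TN$ of codimension $3$ such that the 2-forms $d\eta|_{H}$, where $\eta$ runs over the 1-forms vanishing on $H$, make up a bundle $\Lambda^2_+H^*$ of rank $3$ on which the exterior product $\Lambda^2H^*\otimes\Lambda^2H^*\to\Lambda^4H^*\simeq\mathbb R$ is positive definite. A compatible metric is a smooth metric $g$ on $H$ for which $\Lambda^2_+H^*$ is the bundle of self-dual 2-forms. Let $g$ be a compatible metric. An admissible frame on an open set $U$ consists of 1-forms $(\eta_1,\eta_2,\eta_3)$ on $U$ vanishing on $H$ such that $(\frac1{\sqrt2}d\eta_i|_H)$ is an oriented orthonormal basis of $\Lambda^2_+H^*$, that is, $d\eta_i|_H=g(I_i\cdot,\cdot)$ with $I_i^2=-1$ and $I_1I_2=-I_2I_1=I_3$. The structure $H$ is called integrable (with respect to $g$) if near every point there are an admissible frame $(\eta_i)$ and vector fields $(R_i)$ with $\eta_j(R_i)=\delta_{ij}$ and $i_{R_i}d\eta_j|_H=-i_{R_j}d\eta_i|_H$ for all $i,j$. For a distribution $W$ complementary to $H$, with the metric $\sum_i\eta_i^2|_W$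 (where $(\eta_i)$ is any admissible frame), an adapted connection is a connection $\nabla$ on $TN$ that preserves $H$, $W$ and their metrics, and whose torsion $T$ (with subscripts $H$, $W$ denoting the projections along the splitting $TN=H\oplus W$) satisfies $(T_{X,Y})_H=0$ and $(T_{R,R'})_W=0$, with $R\mapsto (T_{X,R})_W$ in $\mathfrak{so}(W)^\perp$ and $X\mapsto (T_{R,X})_H$ in $\mathfrak{so}(H)^\perp$, for all $X,Y\in H$ and $R,R'\in W$. Its vertical torsion is $T^W\in\Gamma(H^*\otimes\mathrm{End}(W))$, $T^W_X(R)=(T_{X,R})_W$. Through $W\simeq\Lambda^2_+H^*$, $R_i\mapsto d\eta_i|_H$ (where $R_i\in W$, $\eta_j(R_i)=\delta_{ij}$), $H^*\simeq H$ and $d\eta_i|_H\leftrightarrow I_i$, the tensor $T^W$ is viewed as $\sum_{i,j} a_{ij}\otimes I_i\otimes I_j$ with $a_{ij}(X)=\eta_j(T^W_X(R_i))$. Use the decomposition $H\otimes \mathrm{Sym}^2(\Lambda^2_+)=S^{5,1}\oplus S^{3,1}\oplus S^{1,1}$, where $$S^{5,1}=\Big\{\sum_{i,j} a_{ij}\otimes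 I_i\otimes I_j:\ a_{ij}=a_{ji},\ \sum_i I_ia_{ij}=0\ \forall j\Big\},\qquad S^{1,1}=\Big\{\sum_i r\otimes I_i\otimes I_i\Big\},$$ $$S^{3,1}=\Big\{\sum_{i,j}(I_ir_j+I_jr_i)\otimes I_i\otimes I_j:\ \sum_iI_ir_i=0\Big\}.$$ Let $H$ be a quaternionic contact structure on $N$. Then integrability of $H$ does not depend on the choice of the compatible metric. Moreover, for every compatible metric $g$: each complement $W$ has an adapted connection, and $T^W$ is uniquely determined by $g$ and $W$; there is a unique complement $W^g$ such that $T^{W^g}$ is a section of $S^{5,1}$; and the following conditions are equivalent: 1. $H$ is integrable. 2. $T^{W^g}=0$. 3. For every complement $W$ of $H$, the $S^{5,1}$ part of $T^W$ vanishes. 4. For every admissible frame $(\eta_i)$ on an open set and all vector fields $(R_1,R_2,R_3)$ with $\eta_j(R_i)=\delta_{ij}$, the $S^{5,1}$ part of $(i_{R_i}d\eta_j|_H+i_{R_j}d\eta_i|_H)_{i,j}$ vanishes. -/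

import Mathlib

open scoped Manifold ContDiff

namespace QC

/-! ### Vector fields, one-forms and distributions on a manifold of dimension 7 -/

/-- The model space of the manifold. -/
abbrev E7 : Type := EuclideanSpace ℝ (Fin 7)

section Manifold

variable {N : Type*} [TopologicalSpace N] [ChartedSpace E7 N] [IsManifold (𝓡 7) ∞ N]

/-- Smoothness on `U` of a (not necessarily smooth elsewhere) vector field. -/
def SmoothFieldOn (U : Set N) (X : ∀ x : N, TangentSpace (𝓡 7) x) : Prop :=
  ContMDiffOn (𝓡 7) (𝓡 7).tangent ∞ (fun x => (⟨x, X x⟩ : TangentBundle (𝓡 7) N)) U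

/-- Differentiability at `x` of a vector field. -/
def DiffFieldAt (X : ∀ x : N, TangentSpace (𝓡 7) x) (x : N) : Prop :=
  MDifferentiableAt (𝓡 7) (𝓡 7).tangent (fun y => (⟨y, X y⟩ : TangentBundle (𝓡 7) N)) x

/-- Smoothness on `U` of a one-form, as a section of the cotangent bundle. -/
def SmoothFormOn (U : Set N)
    (η : ∀ x : N, TangentSpace (𝓡 7) x →L[ℝ] ℝ) : Prop :=
  ContMDiffOn (𝓡 7) ((𝓡 7).prod 𝓘(ℝ, E7 →L[ℝ] ℝ)) ∞
    (fun x => Bundle.TotalSpace.mk' (E7 →L[ℝ] ℝ)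
      (E := fun x : N => TangentSpace (𝓡 7) x →L[ℝ] Bundle.Trivial N ℝ x) x (η x)) U

/-- The one-form `η` read in the chart at `x₀`: the pullback of `η` by the inverse chart. -/
noncomputable def formInChart (η : ∀ x : N, TangentSpace (𝓡 7) x →L[ℝ] ℝ) (x₀ : N) :
    E7 → (E7 →L[ℝ] ℝ) :=
  fun y => (η ((extChartAt (𝓡 7) x₀).symm y)).comp
    (mfderiv 𝓘(ℝ, E7) (𝓡 7) (extChartAt (𝓡 7) x₀).symm y)

/-- The exterior derivative of a one-form, `dη(X, Y) = X η(Y) - Y η(X) - η([X, Y])`: the exterior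
derivative on `ℝ⁷` of `η` read in the chart at `x`, pulled back to `N`. -/
noncomputable def extD (η : ∀ x : N, TangentSpace (𝓡 7) x →L[ℝ] ℝ) (x : N)
    (u v : TangentSpace (𝓡 7) x) : ℝ :=
  extDeriv (fun y => ContinuousAlternatingMap.ofSubsingleton ℝ E7 ℝ (0 : Fin 1)
      (formInChart η x y)) (extChartAt (𝓡 7) x x)
    ![mfderiv (𝓡 7) 𝓘(ℝ, E7) (extChartAt (𝓡 7) x) x u,
      mfderiv (𝓡 7) 𝓘(ℝ, E7) (extChartAt (𝓡 7) x) x v]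

/-- `D` is a smooth distribution of rank `k`: locally it has a smooth frame. -/
def IsDistribution (k : ℕ) (D : ∀ x : N, Submodule ℝ (TangentSpace (𝓡 7) x)) : Prop :=
  ∀ x₀ : N, ∃ (U : Set N) (X : Fin k → ∀ x : N, D x), IsOpen U ∧ x₀ ∈ U ∧
    (∀ i, SmoothFieldOn U (fun x => (X i x : TangentSpace (𝓡 7) x))) ∧
    ∀ x ∈ U, ∃ b : Module.Basis (Fin k) ℝ (D x), ∀ i, b i = X i x

/-- `D` is a smooth distribution of rank `k` and `o` is an orientation of it: locally there is a
smooth frame which is positively oriented. -/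
def IsOrientedDistribution (k : ℕ) (D : ∀ x : N, Submodule ℝ (TangentSpace (𝓡 7) x))
    (o : ∀ x : N, Orientation ℝ (D x) (Fin k)) : Prop :=
  ∀ x₀ : N, ∃ (U : Set N) (X : Fin k → ∀ x : N, D x), IsOpen U ∧ x₀ ∈ U ∧
    (∀ i, SmoothFieldOn U (fun x => (X i x : TangentSpace (𝓡 7) x))) ∧
    ∀ x ∈ U, ∃ b : Module.Basis (Fin k) ℝ (D x), (∀ i, b i = X i x) ∧ b.orientation = o x

/-- The set `{dη|_{H_x}}`, where `η` runs over the one-forms vanishing on `H` (smooth one-forms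
defined near `x` suffice, since `dη|_{H_x}` depends only on the germ of `η`). -/
def leviForms (H : ∀ x : N, Submodule ℝ (TangentSpace (𝓡 7) x)) (x : N) :
    Set (LinearMap.BilinForm ℝ (H x)) :=
  {w | ∃ (U : Set N) (η : ∀ y : N, TangentSpace (𝓡 7) y →L[ℝ] ℝ), IsOpen U ∧ x ∈ U ∧
    SmoothFormOn U η ∧ (∀ y ∈ U, ∀ X ∈ H y, η y X = 0) ∧
    ∀ X Y : H x, w X Y = extD η x (X : TangentSpace (𝓡 7) x) (Y : TangentSpace (𝓡 7) x)}

end Manifold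

/-! ### Linear algebra on an oriented Euclidean space of dimension 4 -/

section Linear

variable {V : Type*} [AddCommGroup V] [Module ℝ V]

/-- The value of the 4-form `w ∧ w'` on `(e 0, e 1, e 2, e 3)`, for 2-forms `w` and `w'`. -/
def wedge (w w' : LinearMap.BilinForm ℝ V) (e : Fin 4 → V) : ℝ :=
  w (e 0) (e 1) * w' (e 2) (e 3) - w (e 0) (e 2) * w' (e 1) (e 3)
    + w (e 0) (e 3) * w' (e 1) (e 2) + w (e 1) (e 2) * w' (e 0) (e 3)
    - w (e 1) (e 3) * w' (e 0) (e 2) + w (e 2) (e 3) * w' (e 0) (e 1)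

/-- `w` is a self-dual 2-form for the inner product `g` and the orientation `o`. -/
def IsSelfDual (g : LinearMap.BilinForm ℝ V) (o : Orientation ℝ V (Fin 4))
    (w : LinearMap.BilinForm ℝ V) : Prop :=
  w.IsAlt ∧ ∀ e : Module.Basis (Fin 4) ℝ V, e.orientation = o →
    (∀ i j, g (e i) (e j) = if i = j then 1 else 0) →
    w (e 0) (e 1) = w (e 2) (e 3) ∧ w (e 0) (e 2) = - w (e 1) (e 3) ∧
      w (e 0) (e 3) = w (e 1) (e 2)

/-- A quaternionic structure: three complex structures with `I₁ I₂ = - I₂ I₁ = I₃`. -/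
def IsQuaternionic (I : Fin 3 → (V →ₗ[ℝ] V)) : Prop :=
  (∀ i, I i ∘ₗ I i = - LinearMap.id) ∧ I 0 ∘ₗ I 1 = I 2 ∧ I 1 ∘ₗ I 0 = - I 2

/-- The action of a (skew-symmetric) endomorphism on covectors. Under the identification of `V*`
with `V` by a metric for which `J` is skew-symmetric, this is the action of `J` on vectors. -/
def act (J : V →ₗ[ℝ] V) : (V →ₗ[ℝ] ℝ) →ₗ[ℝ] (V →ₗ[ℝ] ℝ) where
  toFun a := - (a ∘ₗ J)
  map_add' a b := by ext v; simp; ring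
  map_smul' c a := by ext v; simp

/-- The elements `∑ a i j ⊗ I i ⊗ I j` with `a` symmetric and `∑ i, I i (a i j) = 0` for all `j`:
the component `S^{5,1}` of `V* ⊗ Sym²(Λ²₊)`. -/
def S51 (I : Fin 3 → (V →ₗ[ℝ] V)) : Submodule ℝ (Fin 3 → Fin 3 → (V →ₗ[ℝ] ℝ)) where
  carrier := {a | (∀ i j, a i j = a j i) ∧ ∀ j, ∑ i, act (I i) (a i j) = 0}
  add_mem' {a b} ha hb := by
    refine ⟨fun i j => ?_, fun j => ?_⟩
    · simp only [Pi.add_apply]; rw [ha.1, hb.1]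
    · simp only [Pi.add_apply, map_add, Finset.sum_add_distrib]; rw [ha.2, hb.2, add_zero]
  zero_mem' := by simp
  smul_mem' c a ha := by
    refine ⟨fun i j => ?_, fun j => ?_⟩
    · simp only [Pi.smul_apply]; rw [ha.1]
    · simp only [Pi.smul_apply, map_smul, ← Finset.smul_sum]; rw [ha.2, smul_zero]

/-- The elements `∑ (I i (r j) + I j (r i)) ⊗ I i ⊗ I j` with `∑ i, I i (r i) = 0`:
the component `S^{3,1}` of `V* ⊗ Sym²(Λ²₊)`. -/
def S31 (I : Fin 3 → (V →ₗ[ℝ] V)) : Submodule ℝ (Fin 3 → Fin 3 → (V →ₗ[ℝ] ℝ)) where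
  carrier := {a | ∃ r : Fin 3 → (V →ₗ[ℝ] ℝ), ∑ i, act (I i) (r i) = 0 ∧
    ∀ i j, a i j = act (I i) (r j) + act (I j) (r i)}
  add_mem' {a b} := by
    rintro ⟨r, hr, har⟩ ⟨s, hs, hbs⟩
    refine ⟨r + s, ?_, fun i j => ?_⟩
    · simp only [Pi.add_apply, map_add, Finset.sum_add_distrib]; rw [hr, hs, add_zero]
    · simp only [Pi.add_apply, map_add, har, hbs]; abel
  zero_mem' := ⟨0, by simp, by simp⟩
  smul_mem' c a := by
    rintro ⟨r, hr, har⟩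
    refine ⟨c • r, ?_, fun i j => ?_⟩
    · simp only [Pi.smul_apply, map_smul, ← Finset.smul_sum]; rw [hr, smul_zero]
    · simp only [Pi.smul_apply, map_smul, har, smul_add]

/-- The elements `∑ i, r ⊗ I i ⊗ I i`: the component `S^{1,1}` of `V* ⊗ Sym²(Λ²₊)`. -/
def S11 (V : Type*) [AddCommGroup V] [Module ℝ V] :
    Submodule ℝ (Fin 3 → Fin 3 → (V →ₗ[ℝ] ℝ)) where
  carrier := {a | ∃ r : V →ₗ[ℝ] ℝ, ∀ i j, a i j = if i = j then r else 0}
  add_mem' {a b} := by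
    rintro ⟨r, har⟩ ⟨s, hbs⟩
    refine ⟨r + s, fun i j => ?_⟩
    simp only [Pi.add_apply, har, hbs]; split_ifs <;> simp
  zero_mem' := ⟨0, by simp⟩
  smul_mem' c a := by
    rintro ⟨r, har⟩
    refine ⟨c • r, fun i j => ?_⟩
    simp only [Pi.smul_apply, har]; split_ifs <;> simp

/-- `s` is the `S^{5,1}` part of `a`, in the decomposition
`V* ⊗ Sym²(Λ²₊) = S^{5,1} ⊕ S^{3,1} ⊕ S^{1,1}`. -/
def IsS51Part (I : Fin 3 → (V →ₗ[ℝ] V)) (a s : Fin 3 → Fin 3 → (V →ₗ[ℝ] ℝ)) : Prop :=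
  s ∈ S51 I ∧ a - s ∈ S31 I ⊔ S11 V

end Linear

/-! ### Quaternionic contact structures in dimension 7 -/

section QuaternionicContact

variable (N : Type*) [TopologicalSpace N] [ChartedSpace E7 N] [IsManifold (𝓡 7) ∞ N]

/-- A quaternionic contact structure on a 7-manifold: an oriented distribution `H` of codimension 3
such that the forms `dη|_H`, where `η` vanishes on `H`, make up a bundle `Λ²₊H*` of rank 3 on which
the exterior product `Λ²H* ⊗ Λ²H* → Λ⁴H* ≃ ℝ` is positive definite. -/
structure QCStructure where
  /-- the distribution -/
  H : ∀ x : N, Submodule ℝ (TangentSpace (𝓡 7) x)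
  /-- its orientation -/
  orient : ∀ x : N, Orientation ℝ (H x) (Fin 4)
  oriented : IsOrientedDistribution 4 H orient
  rank_three : ∀ x : N, Module.finrank ℝ (Submodule.span ℝ (leviForms H x)) = 3
  pos_def : ∀ x : N, ∀ w ∈ Submodule.span ℝ (leviForms H x), w ≠ 0 →
    ∀ e : Module.Basis (Fin 4) ℝ (H x), e.orientation = orient x → 0 < wedge w w e

variable {N}

/-- A compatible metric: a smooth metric on `H` for which the 2-forms `dη|_H`, where `η` vanishes on
`H`, are exactly the self-dual 2-forms on `H`. -/
structure CompatibleMetric (Q : QCStructure N) where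
  /-- the metric -/
  inner : ∀ x : N, LinearMap.BilinForm ℝ (Q.H x)
  symm : ∀ x X Y, inner x X Y = inner x Y X
  pos : ∀ x X, X ≠ 0 → 0 < inner x X X
  smooth : ∀ (U : Set N) (X Y : ∀ x : N, Q.H x), IsOpen U →
    SmoothFieldOn U (fun x => (X x : TangentSpace (𝓡 7) x)) →
    SmoothFieldOn U (fun x => (Y x : TangentSpace (𝓡 7) x)) →
    ContMDiffOn (𝓡 7) 𝓘(ℝ, ℝ) ∞ (fun x => inner x (X x) (Y x)) U
  selfDual : ∀ (x : N) (w : LinearMap.BilinForm ℝ (Q.H x)),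
    w ∈ leviForms Q.H x ↔ IsSelfDual (inner x) (Q.orient x) w

variable {Q : QCStructure N}

/-- Local contact forms `(η₁, η₂, η₃)` on `U` such that `((1/√2) dη_i|_H)` is an oriented
orthonormal basis of `Λ²₊H*` for the metric `g`, that is, `dη_i|_H = g(I_i ·, ·)` for a
quaternionic structure `(I₁, I₂, I₃)` on `H`. -/
structure AdmissibleFrame (g : CompatibleMetric Q) (U : Set N) where
  /-- the contact forms -/
  η : Fin 3 → ∀ x : N, TangentSpace (𝓡 7) x →L[ℝ] ℝ
  /-- the quaternionic structure -/
  I : Fin 3 → ∀ x : N, (Q.H x →ₗ[ℝ] Q.H x)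
  smooth : ∀ i, SmoothFormOn U (η i)
  vanish : ∀ i, ∀ x ∈ U, ∀ X ∈ Q.H x, η i x X = 0
  quaternionic : ∀ x ∈ U, IsQuaternionic (fun i => I i x)
  d_eq : ∀ i, ∀ x ∈ U, ∀ X Y : Q.H x,
    extD (η i) x (X : TangentSpace (𝓡 7) x) (Y : TangentSpace (𝓡 7) x) = g.inner x (I i x X) Y

/-- `(R₁, R₂, R₃)` are smooth vector fields on `U` with `η_j(R_i) = δ_ij`. -/
def IsDualFrame {g : CompatibleMetric Q} {U : Set N} (θ : AdmissibleFrame g U)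
    (R : Fin 3 → ∀ x : N, TangentSpace (𝓡 7) x) : Prop :=
  (∀ i, SmoothFieldOn U (R i)) ∧ ∀ x ∈ U, ∀ i j, θ.η j x (R i x) = if i = j then 1 else 0

/-- Integrability, with respect to the compatible metric `g`: locally there are an admissible frame
`(η_i)` and vector fields `(R_i)` with `i_{R_i} η_j = δ_ij` and
`i_{R_i} dη_j|_H = - i_{R_j} dη_i|_H`. -/
def Integrable (g : CompatibleMetric Q) : Prop :=
  ∀ x₀ : N, ∃ (U : Set N) (θ : AdmissibleFrame g U)
    (R : Fin 3 → ∀ x : N, TangentSpace (𝓡 7) x), IsOpen U ∧ x₀ ∈ U ∧ IsDualFrame θ R ∧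
    ∀ x ∈ U, ∀ (i j : Fin 3) (X : Q.H x),
      extD (θ.η j) x (R i x) (X : TangentSpace (𝓡 7) x)
        = - extD (θ.η i) x (R j x) (X : TangentSpace (𝓡 7) x)

variable (Q) in
/-- A distribution complementary to `H`. -/
structure Complement where
  /-- the distribution -/
  W : ∀ x : N, Submodule ℝ (TangentSpace (𝓡 7) x)
  distribution : IsDistribution 3 W
  isCompl : ∀ x, IsCompl (Q.H x) (W x)

/-- The projection `TN → H` in the direction of `W`. -/
noncomputable def Complement.projH (W : Complement Q) (x : N) :
    TangentSpace (𝓡 7) x →ₗ[ℝ] Q.H x :=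
  (Q.H x).projectionOnto (W.W x) (W.isCompl x)

/-- The projection `TN → W` in the direction of `H`. -/
noncomputable def Complement.projW (W : Complement Q) (x : N) :
    TangentSpace (𝓡 7) x →ₗ[ℝ] W.W x :=
  (W.W x).projectionOnto (Q.H x) (W.isCompl x).symm

/-- The quadratic form `∑ i, η_i²` (polarized). Its restriction to a complement `W` of `H` is the
metric on `W`; it does not depend on the admissible frame. -/
noncomputable def AdmissibleFrame.vert {g : CompatibleMetric Q} {U : Set N} (θ : AdmissibleFrame g U) (x : N)
    (u v : TangentSpace (𝓡 7) x) : ℝ :=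
  ∑ i, θ.η i x u * θ.η i x v

/-- `cov` is a connection on `N` adapted to the compatible metric `g` and the complement `W`.
`cov Y x v` stands for `(∇_v Y)(x)`, and `cov.torsion x u v` is the torsion
`T_{u,v} = ∇_u v - ∇_v u - [u, v]`. The orthogonal complement of `𝔰𝔬` in the endomorphisms is the
space of symmetric endomorphisms. -/
structure IsAdapted (g : CompatibleMetric Q) (W : Complement Q)
    (cov : CovariantDerivative (𝓡 7) E7 (fun x : N => TangentSpace (𝓡 7) x)) : Prop where
  smooth : CovariantDerivative.ContMDiffCovariantDerivative cov ∞
  /-- `∇` preserves `H` -/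
  preserves_H : ∀ (Y : ∀ x : N, Q.H x) (x : N),
    DiffFieldAt (fun y => (Y y : TangentSpace (𝓡 7) y)) x →
    ∀ v, cov (fun y => (Y y : TangentSpace (𝓡 7) y)) x v ∈ Q.H x
  /-- `∇` preserves `W` -/
  preserves_W : ∀ (R : ∀ x : N, W.W x) (x : N),
    DiffFieldAt (fun y => (R y : TangentSpace (𝓡 7) y)) x →
    ∀ v, cov (fun y => (R y : TangentSpace (𝓡 7) y)) x v ∈ W.W x
  /-- `∇` preserves the metric on `H` -/
  metric_H : ∀ (Y Z : ∀ x : N, Q.H x) (x : N),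
    DiffFieldAt (fun y => (Y y : TangentSpace (𝓡 7) y)) x →
    DiffFieldAt (fun y => (Z y : TangentSpace (𝓡 7) y)) x →
    ∀ v, mvfderiv (𝓡 7) (fun y => g.inner y (Y y) (Z y)) x v
      = g.inner x (W.projH x (cov (fun y => (Y y : TangentSpace (𝓡 7) y)) x v)) (Z x)
        + g.inner x (Y x) (W.projH x (cov (fun y => (Z y : TangentSpace (𝓡 7) y)) x v))
  /-- `∇` preserves the metric on `W` -/
  metric_W : ∀ (U : Set N) (θ : AdmissibleFrame g U), IsOpen U →
    ∀ (R S : ∀ x : N, W.W x), ∀ x ∈ U,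
    DiffFieldAt (fun y => (R y : TangentSpace (𝓡 7) y)) x →
    DiffFieldAt (fun y => (S y : TangentSpace (𝓡 7) y)) x →
    ∀ v, mvfderiv (𝓡 7) (fun y => θ.vert y (R y) (S y)) x v
      = θ.vert x (cov (fun y => (R y : TangentSpace (𝓡 7) y)) x v) (S x)
        + θ.vert x (R x) (cov (fun y => (S y : TangentSpace (𝓡 7) y)) x v)
  /-- `(T_{X,Y})_H = 0` for `X, Y ∈ H` -/
  torsion_H : ∀ (x : N) (X Y : Q.H x), W.projH x (cov.torsion x X Y) = 0
  /-- `(T_{R,S})_W = 0` for `R, S ∈ W` -/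
  torsion_W : ∀ (x : N) (R S : W.W x), W.projW x (cov.torsion x R S) = 0
  /-- for `X ∈ H`, the endomorphism `R ↦ (T_{X,R})_W` lies in `𝔰𝔬(W)^⊥` -/
  torsion_HW : ∀ (U : Set N) (θ : AdmissibleFrame g U), IsOpen U → ∀ x ∈ U,
    ∀ (X : Q.H x) (R S : W.W x),
    θ.vert x (W.projW x (cov.torsion x X R)) S = θ.vert x R (W.projW x (cov.torsion x X S))
  /-- for `R ∈ W`, the endomorphism `X ↦ (T_{R,X})_H` lies in `𝔰𝔬(H)^⊥` -/
  torsion_WH : ∀ (x : N) (R : W.W x) (X Y : Q.H x),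
    g.inner x (W.projH x (cov.torsion x R X)) Y = g.inner x X (W.projH x (cov.torsion x R Y))

/-- `T` is the tensor `T^W ∈ Γ(H* ⊗ End W)`, `T^W_X R = (T_{X,R})_W`, where `T_{X,R}` is the torsion
of the connection adapted to `g` and `W`. -/
def IsVerticalTorsion (g : CompatibleMetric Q) (W : Complement Q)
    (T : ∀ x : N, Q.H x →ₗ[ℝ] W.W x →ₗ[ℝ] W.W x) : Prop :=
  ∃ cov : CovariantDerivative (𝓡 7) E7 (fun x : N => TangentSpace (𝓡 7) x),
    IsAdapted g W cov ∧
    ∀ (x : N) (X : Q.H x) (R : W.W x), T x X R = W.projW x (cov.torsion x X R)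

/-- The components `a i j = η_j(T(R_i))` in `H_x*` of `T ∈ H* ⊗ End W` for a basis `(R_i)` of `W_x`
dual to `(η_i)`: in the identification `W ≃ Λ²₊H*`, `R_i ↦ dη_i|_H = g(I_i ·, ·)`, the tensor `T`
becomes `∑ a i j ⊗ I i ⊗ I j` (up to a constant factor due to the norm of the `I i`). -/
noncomputable def torsionComponents {g : CompatibleMetric Q} {W : Complement Q} {U : Set N}
    (θ : AdmissibleFrame g U) (T : ∀ x : N, Q.H x →ₗ[ℝ] W.W x →ₗ[ℝ] W.W x) (x : N)
    (R : Fin 3 → W.W x) : Fin 3 → Fin 3 → (Q.H x →ₗ[ℝ] ℝ) :=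
  fun i j => (θ.η j x : TangentSpace (𝓡 7) x →ₗ[ℝ] ℝ) ∘ₗ (W.W x).subtype ∘ₗ (T x).flip (R i)

/-- `T` is a section of `S^{5,1}`. -/
def TorsionInS51 (g : CompatibleMetric Q) {W : Complement Q}
    (T : ∀ x : N, Q.H x →ₗ[ℝ] W.W x →ₗ[ℝ] W.W x) : Prop :=
  ∀ (U : Set N) (θ : AdmissibleFrame g U), IsOpen U → ∀ x ∈ U, ∀ R : Fin 3 → W.W x,
    (∀ i j, θ.η j x (R i) = if i = j then 1 else 0) →
    torsionComponents θ T x R ∈ S51 (fun i => θ.I i x)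

/-- The `S^{5,1}` part of `T` vanishes. -/
def TorsionS51PartVanishes (g : CompatibleMetric Q) {W : Complement Q}
    (T : ∀ x : N, Q.H x →ₗ[ℝ] W.W x →ₗ[ℝ] W.W x) : Prop :=
  ∀ (U : Set N) (θ : AdmissibleFrame g U), IsOpen U → ∀ x ∈ U, ∀ R : Fin 3 → W.W x,
    (∀ i j, θ.η j x (R i) = if i = j then 1 else 0) →
    IsS51Part (fun i => θ.I i x) (torsionComponents θ T x R) 0

/-- `W` is the complement `W^g`: its torsion `T^W` is a section of `S^{5,1}`. -/
def IsReducing (g : CompatibleMetric Q) (W : Complement Q) : Prop :=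
  ∃ T, IsVerticalTorsion g W T ∧ TorsionInS51 g T

/-- For every admissible frame `(η_i)` and all vector fields `(R_i)` with `η_j(R_i) = δ_ij`, the
`S^{5,1}` part of `(i_{R_i} dη_j|_H + i_{R_j} dη_i|_H)_{i,j}` vanishes. -/
def FramesS51PartVanishes (g : CompatibleMetric Q) : Prop :=
  ∀ (U : Set N) (θ : AdmissibleFrame g U) (R : Fin 3 → ∀ x : N, TangentSpace (𝓡 7) x),
    IsOpen U → IsDualFrame θ R → ∀ x ∈ U, ∀ a : Fin 3 → Fin 3 → (Q.H x →ₗ[ℝ] ℝ),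
    (∀ (i j : Fin 3) (X : Q.H x), a i j X = extD (θ.η j) x (R i x) (X : TangentSpace (𝓡 7) x)
        + extD (θ.η i) x (R j x) (X : TangentSpace (𝓡 7) x)) →
    IsS51Part (fun i => θ.I i x) a 0

end QuaternionicContact

end QC

/-!
For an admissible frame `(η_i)` and vectors `(u_i)` with `η_j(u_i) = δ_ij`, consider the covectors
`b_ij = i_{u_i} dη_j|_H + i_{u_j} dη_i|_H` (`AdmissibleFrame.vertForm`), symmetric in `i, j`. All
the notions of the theorem are read off from `b`, and everything rests on how `b` depends on the
choices.

* Replacing `u_i` by `u_i + h_i` with `h_i ∈ H` adds to `b` the symmetrization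
  `I_i h_j + I_j h_i` (`AdmissibleFrame.vertForm_add`). The image of this map `h ↦ symAct h` is
  exactly `S^{3,1} ⊕ S^{1,1}` (`mem_S31_sup_S11`), it meets `S^{5,1}` only for `h = 0`
  (`eq_zero_of_symAct_mem_S51`), and an explicit `h` moves any symmetric `b` into `S^{5,1}`
  (`sub_symSolve_mem_S51`). So exactly one dual basis has `b ∈ S^{5,1}`.
* Two compatible metrics with the same bundle of self-dual forms are conformal, and their admissible
  frames differ by a positive factor and a rotation (`conformal_of_selfDual`). Under such a change
  `b` is rotated, and a multiple of the identity is added, which comes from the differential of the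
  factor and lies in `S^{1,1}` (`AdmissibleFrame.exists_change`).

Hence the vanishing at a point of the `S^{5,1}` part of `b` is independent of the metric, the frame
and the dual basis: it is a condition on `H` alone (`QCStructure.ObstructionVanishesAt`,
`AdmissibleFrame.obstructionVanishesAt_iff`). Integrability asks for dual frames with `b = 0`, and
taking the smooth dual frame with `b ∈ S^{5,1}` shows that it is equivalent to the vanishing of the
obstruction (`integrable_iff`); so is the condition on all frames (`framesS51PartVanishes_iff`). For
a single metric, the dual bases with `b ∈ S^{5,1}` are rotated into each other and span a complement
of `H`, the only one of its kind (`CompatibleMetric.exists_isNormalized`, `IsNormalized.unique`).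

It remains to relate `b` to the torsion. The coefficients of an adapted connection in an orthonormal
frame of `H ⊕ W` solve a linear system with exactly one solution, a Koszul formula
(`isAdaptedCoeff_adaptedCoeff`, `IsAdaptedCoeff.eq_adaptedCoeff`). So adapted connections exist
locally, they agree where they are both defined, and they glue (`exists_isAdapted`). For any of them
the metric condition on `W` and the symmetry of `T^W_X` force `T^W = -b / 2`
(`IsVerticalTorsion.eq_vertForm`); in particular `T^W` is unique, and the statements about `T^W`
become statements about `b`.
-/

set_option linter.unusedSectionVars false

namespace QC

/-! ### Smooth functions, vector fields and one-forms -/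

section Calculus

open scoped Topology Bundle
open VectorField

variable {N : Type*} [TopologicalSpace N] [ChartedSpace E7 N] [IsManifold (𝓡 7) ∞ N]

/-- Smoothness on `U` of a real function. -/
abbrev SmoothFnOn (U : Set N) (f : N → ℝ) : Prop := ContMDiffOn (𝓡 7) 𝓘(ℝ, ℝ) ∞ f U

theorem SmoothFieldOn.mono {U V : Set N} {X : ∀ x : N, TangentSpace (𝓡 7) x}
    (h : SmoothFieldOn U X) (hV : V ⊆ U) : SmoothFieldOn V X :=
  ContMDiffOn.mono h hV

theorem SmoothFormOn.mono {U V : Set N} {η : ∀ x : N, TangentSpace (𝓡 7) x →L[ℝ] ℝ}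
    (h : SmoothFormOn U η) (hV : V ⊆ U) : SmoothFormOn V η :=
  ContMDiffOn.mono h hV

theorem SmoothFieldOn.diffFieldAt {U : Set N} {X : ∀ x : N, TangentSpace (𝓡 7) x}
    (h : SmoothFieldOn U X) (hU : IsOpen U) {x : N} (hx : x ∈ U) : DiffFieldAt X x :=
  (ContMDiffOn.contMDiffAt h (hU.mem_nhds hx)).mdifferentiableAt (by simp)

theorem SmoothFnOn.mdifferentiableAt {U : Set N} {f : N → ℝ}
    (h : SmoothFnOn U f) (hU : IsOpen U) {x : N} (hx : x ∈ U) :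
    MDifferentiableAt (𝓡 7) 𝓘(ℝ, ℝ) f x :=
  (ContMDiffOn.contMDiffAt h (hU.mem_nhds hx)).mdifferentiableAt (by simp)

theorem SmoothFieldOn.congr {U : Set N} {X Y : ∀ x : N, TangentSpace (𝓡 7) x}
    (h : SmoothFieldOn U X) (hXY : ∀ x ∈ U, Y x = X x) : SmoothFieldOn U Y :=
  ContMDiffOn.congr h (fun x hx => by simp [hXY x hx])

theorem SmoothFieldOn.add {U : Set N} {X Y : ∀ x : N, TangentSpace (𝓡 7) x}
    (hX : SmoothFieldOn U X) (hY : SmoothFieldOn U Y) : SmoothFieldOn U (fun x => X x + Y x) :=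
  ContMDiffOn.add_section hX hY

theorem SmoothFieldOn.sub {U : Set N} {X Y : ∀ x : N, TangentSpace (𝓡 7) x}
    (hX : SmoothFieldOn U X) (hY : SmoothFieldOn U Y) : SmoothFieldOn U (fun x => X x - Y x) :=
  ContMDiffOn.sub_section hX hY

theorem SmoothFieldOn.smul {U : Set N} {f : N → ℝ} {X : ∀ x : N, TangentSpace (𝓡 7) x}
    (hf : SmoothFnOn U f) (hX : SmoothFieldOn U X) : SmoothFieldOn U (fun x => f x • X x) :=
  ContMDiffOn.smul_section hf hX

theorem SmoothFieldOn.sum {ι : Type*} [Fintype ι] {U : Set N}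
    {X : ι → ∀ x : N, TangentSpace (𝓡 7) x}
    (hX : ∀ i, SmoothFieldOn U (X i)) : SmoothFieldOn U (fun x => ∑ i, X i x) :=
  ContMDiffOn.sum_section (fun i _ => hX i)

theorem SmoothFormOn.apply {U : Set N} {η : ∀ x : N, TangentSpace (𝓡 7) x →L[ℝ] ℝ}
    {X : ∀ x : N, TangentSpace (𝓡 7) x}
    (hη : SmoothFormOn U η) (hX : SmoothFieldOn U X) : SmoothFnOn U (fun x => η x (X x)) := by
  have := ContMDiffOn.clm_bundle_apply (F₁ := E7) (F₂ := ℝ) (b := fun x : N => x)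
    (E₁ := fun x : N => TangentSpace (𝓡 7) x) (E₂ := Bundle.Trivial N ℝ)
    (ϕ := η) (v := X) hη hX
  intro x hx
  have h2 := this x hx
  rw [Bundle.contMDiffWithinAt_totalSpace] at h2
  simpa using h2.2

theorem mdifferentiableAt_form_apply {U : Set N} {η : ∀ x : N, TangentSpace (𝓡 7) x →L[ℝ] ℝ}
    {X : ∀ x : N, TangentSpace (𝓡 7) x} {x : N} (hU : IsOpen U) (hx : x ∈ U)
    (hη : SmoothFormOn U η) (hX : DiffFieldAt X x) :
    MDifferentiableAt (𝓡 7) 𝓘(ℝ, ℝ) (fun x => η x (X x)) x := by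
  have := MDifferentiableAt.clm_bundle_apply (F₁ := E7) (F₂ := ℝ) (b := fun x : N => x)
    (E₁ := fun x : N => TangentSpace (𝓡 7) x) (E₂ := Bundle.Trivial N ℝ)
    (ϕ := η) (v := X) ((ContMDiffOn.contMDiffAt hη (hU.mem_nhds hx)).mdifferentiableAt (by simp)) hX
  rw [mdifferentiableAt_totalSpace] at this
  simpa using this.2

theorem SmoothFieldOn.mlieBracket {U : Set N} {X Y : ∀ x : N, TangentSpace (𝓡 7) x}
    (hU : IsOpen U)
    (hX : SmoothFieldOn U X) (hY : SmoothFieldOn U Y) :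
    SmoothFieldOn U (mlieBracket (𝓡 7) X Y) := by
  intro x hx
  have : IsManifold (𝓡 7) (minSmoothness ℝ 2) N :=
    IsManifold.of_le (n := ∞) (by
      simpa using (show ((2 : ℕ∞) : ℕ∞ω) ≤ ((⊤ : ℕ∞) : ℕ∞ω) by exact_mod_cast le_top))
  have : IsManifold (𝓡 7) (((⊤ : ℕ∞) : ℕ∞ω) + 1) N := by simpa using ‹IsManifold (𝓡 7) ∞ N›
  exact (ContMDiffAt.mlieBracket_vectorField (m := (⊤ : ℕ∞)) (n := (⊤ : ℕ∞))
    (ContMDiffOn.contMDiffAt hX (hU.mem_nhds hx))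
    (ContMDiffOn.contMDiffAt hY (hU.mem_nhds hx)) (by simp)).contMDiffWithinAt

/-- The derivative of a smooth function along a smooth vector field is smooth. -/
theorem SmoothFnOn.mvfderiv_apply {U : Set N} {f : N → ℝ} {X : ∀ x : N, TangentSpace (𝓡 7) x}
    (hU : IsOpen U) (hf : SmoothFnOn U f) (hX : SmoothFieldOn U X) :
    SmoothFnOn U (fun x => mvfderiv (𝓡 7) f x (X x)) := by
  intro x hx
  have h1 : ContMDiffWithinAt (𝓡 7).tangent 𝓘(ℝ, ℝ).tangent ∞ (tangentMapWithin (𝓡 7) 𝓘(ℝ, ℝ) f U)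
      (Bundle.TotalSpace.proj ⁻¹' U) (⟨x, X x⟩ : TangentBundle (𝓡 7) N) :=
    hf.contMDiffOn_tangentMapWithin (m := ∞) (by simp) hU.uniqueMDiffOn _ hx
  have h2 := h1.comp x (hX x hx) (fun y hy => hy)
  have h3 := (Bundle.contMDiffWithinAt_totalSpace.1 h2).2
  refine h3.congr_of_eventuallyEq_of_mem ?_ hx
  filter_upwards [self_mem_nhdsWithin] with y hy
  simp [tangentMapWithin, mvfderiv, mfderivWithin_of_isOpen hU hy]
  rfl

/-- The value of `dη` at `x` as an alternating map on `ℝ⁷`. It is also one on `T_xN`, since the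
derivative at `x` of the chart at `x` is the identity. -/
noncomputable def extDAlt (η : ∀ x : N, TangentSpace (𝓡 7) x →L[ℝ] ℝ) (x : N) :
    E7 [⋀^Fin 2]→L[ℝ] ℝ :=
  extDeriv (fun y => ContinuousAlternatingMap.ofSubsingleton ℝ E7 ℝ (0 : Fin 1)
      (formInChart η x y)) (extChartAt (𝓡 7) x x)

/-- An alternating map of two variables as a bilinear form. -/
def altBilin {M : Type*} [AddCommGroup M] [Module ℝ M] [TopologicalSpace M]
    (f : M [⋀^Fin 2]→L[ℝ] ℝ) : LinearMap.BilinForm ℝ M :=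
  have hu : ∀ (i : Fin 2) (w : Fin 2 → M) (v : M), f (Function.update w i v) =
      f ![if i = 0 then v else w 0, if i = 1 then v else w 1] := by
    intro i w v
    congr 1
    ext k : 1
    fin_cases i <;> fin_cases k <;> rfl
  LinearMap.mk₂ ℝ (fun u v => f ![u, v])
    (fun u u' v => by simpa [hu] using f.map_update_add ![0, v] 0 u u')
    (fun c u v => by simpa [hu] using f.map_update_smul ![0, v] 0 c u)
    (fun u v v' => by simpa [hu] using f.map_update_add ![u, 0] 1 v v')
    (fun c u v => by simpa [hu] using f.map_update_smul ![u, 0] 1 c v)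

theorem extD_eq (η : ∀ x : N, TangentSpace (𝓡 7) x →L[ℝ] ℝ) (x : N)
    (u v : TangentSpace (𝓡 7) x) :
    extD η x u v = altBilin (extDAlt η x) u v := by
  rw [extD, mfderiv_extChartAt_self]
  rfl

/-- The bilinear form `dη` at a point. -/
noncomputable def extDBilin (η : ∀ x : N, TangentSpace (𝓡 7) x →L[ℝ] ℝ) (x : N) :
    LinearMap.BilinForm ℝ (TangentSpace (𝓡 7) x) := altBilin (extDAlt η x)

@[simp] theorem extDBilin_apply (η : ∀ x : N, TangentSpace (𝓡 7) x →L[ℝ] ℝ) (x : N)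
    (u v : TangentSpace (𝓡 7) x) : extDBilin η x u v = extD η x u v := (extD_eq η x u v).symm

theorem extD_self (η : ∀ x : N, TangentSpace (𝓡 7) x →L[ℝ] ℝ) (x : N)
    (u : TangentSpace (𝓡 7) x) : extD η x u u = 0 := by
  rw [extD_eq]
  exact (extDAlt η x).map_eq_zero_of_eq ![u, u] (i := 0) (j := 1) rfl (by simp)

theorem extD_swap (η : ∀ x : N, TangentSpace (𝓡 7) x →L[ℝ] ℝ) (x : N)
    (u v : TangentSpace (𝓡 7) x) : extD η x u v = - extD η x v u := by
  have h : LinearMap.IsAlt (extDBilin η x) := fun u => by rw [extDBilin_apply, extD_self]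
  have := h.neg u v
  simp only [extDBilin_apply] at this
  linarith

/-- A map into `Hom(ℝ⁷, F)` is smooth as soon as its values on fixed vectors are smooth. -/
theorem contMDiffAt_clm_of_apply {F : Type*} [NormedAddCommGroup F] [NormedSpace ℝ F]
    {f : N → E7 →L[ℝ] F} {x : N} (h : ∀ v, ContMDiffAt (𝓡 7) 𝓘(ℝ, F) ∞ (fun y => f y v) x) :
    ContMDiffAt (𝓡 7) 𝓘(ℝ, E7 →L[ℝ] F) ∞ f x := by
  have key : f = fun y => ∑ i, ContinuousLinearMap.smulRightL ℝ E7 F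
      (EuclideanSpace.proj i) (f y (EuclideanSpace.single i 1)) := by
    ext y v
    conv_lhs => rw [← (EuclideanSpace.basisFun (Fin 7) ℝ).sum_repr v]
    simp
  rw [key]
  apply ContMDiffAt.sum
  intro i _
  exact (ContinuousLinearMap.contMDiff _).contMDiffAt.comp x (h _)

/-- The vector field with constant components in the chart at `x₀`. -/
noncomputable def chartField (x₀ : N) (v : E7) (x : N) : TangentSpace (𝓡 7) x :=
  (trivializationAt E7 (fun x : N => TangentSpace (𝓡 7) x) x₀).symmL ℝ x v

theorem smoothFieldOn_chartField (x₀ : N) (v : E7) :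
    SmoothFieldOn (chartAt E7 x₀).source (chartField x₀ v) := by
  intro x hx
  have hx' : x ∈ (trivializationAt E7 (fun x : N => TangentSpace (𝓡 7) x) x₀).baseSet := by
    simpa using hx
  rw [(trivializationAt E7 (fun x : N => TangentSpace (𝓡 7) x) x₀).contMDiffWithinAt_section _ hx']
  have : ContMDiffWithinAt (𝓡 7) 𝓘(ℝ, E7) ∞ (fun _ : N => v) (chartAt E7 x₀).source x :=
    contMDiffWithinAt_const
  refine this.congr_of_eventuallyEq_of_mem ?_ hx
  filter_upwards [self_mem_nhdsWithin] with y hy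
  have hy' : y ∈ (trivializationAt E7 (fun x : N => TangentSpace (𝓡 7) x) x₀).baseSet := by
    simpa using hy
  rw [chartField, Bundle.Trivialization.symmL_apply, Bundle.Trivialization.apply_mk_symm _ hy']
  exact hy'

/-- A one-form is smooth as soon as its values on smooth vector fields are smooth. -/
theorem smoothFormOn_of_apply {U : Set N} (hU : IsOpen U)
    {η : ∀ x : N, TangentSpace (𝓡 7) x →L[ℝ] ℝ}
    (h : ∀ (V : Set N) (X : ∀ x : N, TangentSpace (𝓡 7) x), IsOpen V → V ⊆ U → SmoothFieldOn V X →
      SmoothFnOn V (fun x => η x (X x))) : SmoothFormOn U η := by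
  intro x hx
  apply ContMDiffAt.contMDiffWithinAt
  rw [contMDiffAt_hom_bundle]
  refine ⟨contMDiffAt_id, ?_⟩
  apply contMDiffAt_clm_of_apply
  intro v
  have hV : IsOpen (U ∩ (chartAt E7 x).source) := hU.inter (chartAt E7 x).open_source
  have hxV : x ∈ U ∩ (chartAt E7 x).source := ⟨hx, mem_chart_source _ _⟩
  have := h _ (chartField x v) hV Set.inter_subset_left
    ((smoothFieldOn_chartField x v).mono Set.inter_subset_right)
  refine (this.contMDiffAt (hV.mem_nhds hxV)).congr_of_eventuallyEq ?_
  filter_upwards with y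
  simp [ContinuousLinearMap.inCoordinates, chartField]

/-- A section of `Hom(TN, TN)` is smooth as soon as its values on smooth vector fields are
smooth. -/
theorem smoothEndOn_of_apply {U : Set N} (hU : IsOpen U)
    {φ : ∀ x : N, TangentSpace (𝓡 7) x →L[ℝ] TangentSpace (𝓡 7) x}
    (h : ∀ (V : Set N) (X : ∀ x : N, TangentSpace (𝓡 7) x), IsOpen V → V ⊆ U → SmoothFieldOn V X →
      SmoothFieldOn V (fun x => φ x (X x))) :
    ContMDiffOn (𝓡 7) ((𝓡 7).prod 𝓘(ℝ, E7 →L[ℝ] E7)) ∞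
      (fun x => Bundle.TotalSpace.mk' (E7 →L[ℝ] E7)
        (E := fun x : N => TangentSpace (𝓡 7) x →L[ℝ] TangentSpace (𝓡 7) x) x (φ x)) U := by
  intro x hx
  apply ContMDiffAt.contMDiffWithinAt
  rw [contMDiffAt_hom_bundle]
  refine ⟨contMDiffAt_id, ?_⟩
  apply contMDiffAt_clm_of_apply
  intro v
  have hV : IsOpen (U ∩ (chartAt E7 x).source) := hU.inter (chartAt E7 x).open_source
  have hxV : x ∈ U ∩ (chartAt E7 x).source := ⟨hx, mem_chart_source _ _⟩
  have := h _ (chartField x v) hV Set.inter_subset_left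
    ((smoothFieldOn_chartField x v).mono Set.inter_subset_right)
  have h2 := (Bundle.contMDiffAt_totalSpace.1 (ContMDiffOn.contMDiffAt this (hV.mem_nhds hxV))).2
  refine h2.congr_of_eventuallyEq ?_
  filter_upwards [(chartAt E7 x).open_source.mem_nhds (mem_chart_source _ x)] with y hy
  have hy' : y ∈ (trivializationAt E7 (fun x : N => TangentSpace (𝓡 7) x) x).baseSet := by
    simpa using hy
  rw [ContinuousLinearMap.inCoordinates]
  simp only [ContinuousLinearMap.comp_apply, chartField]
  rw [Bundle.Trivialization.continuousLinearMapAt_apply,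
    Bundle.Trivialization.coe_linearMapAt_of_mem _ hy']

theorem chartField_eq {x₀ x : N} (v : E7) (hx : x ∈ (chartAt E7 x₀).source) :
    chartField x₀ v x = mfderiv 𝓘(ℝ, E7) (𝓡 7) (extChartAt (𝓡 7) x₀).symm
      (extChartAt (𝓡 7) x₀ x) v := by
  rw [chartField, TangentBundle.symmL_trivializationAt hx]
  simp only [modelWithCornersSelf_coe, Set.range_id, mfderivWithin_univ]
  rfl

theorem mdifferentiableAt_extChartAt_symm' (x : N) :
    MDifferentiableAt 𝓘(ℝ, E7) (𝓡 7) (extChartAt (𝓡 7) x).symm (extChartAt (𝓡 7) x x) := by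
  have := (contMDiffOn_extChartAt_symm (n := ∞) (I := 𝓡 7) x)
  exact (this.contMDiffAt (extChartAt_target_mem_nhds x)).mdifferentiableAt (by simp)

theorem differentiableAt_formInChart {U : Set N} (hU : IsOpen U)
    {η : ∀ x : N, TangentSpace (𝓡 7) x →L[ℝ] ℝ} (hη : SmoothFormOn U η) {x : N} (hx : x ∈ U) :
    DifferentiableAt ℝ (formInChart η x) (extChartAt (𝓡 7) x x) := by
  have hchart : ∀ᶠ y in 𝓝 (extChartAt (𝓡 7) x x), y ∈ (extChartAt (𝓡 7) x).target :=
    extChartAt_target_mem_nhds x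
  have key : ∀ v : E7,
      DifferentiableAt ℝ (fun y => formInChart η x y v) (extChartAt (𝓡 7) x x) := by
    intro v
    have h1 := mdifferentiableAt_form_apply hU hx hη
      ((smoothFieldOn_chartField x v).diffFieldAt (chartAt E7 x).open_source (mem_chart_source _ x))
    have h2 : MDifferentiableAt (𝓡 7) 𝓘(ℝ, ℝ) (fun y => η y (chartField x v y))
      ((extChartAt (𝓡 7) x).symm (extChartAt (𝓡 7) x x)) := by simpa using h1
    have h3 := h2.comp _ (mdifferentiableAt_extChartAt_symm' x)
    rw [mdifferentiableAt_iff_differentiableAt] at h3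
    refine h3.congr_of_eventuallyEq ?_
    filter_upwards [hchart] with y hy
    have hy' : (extChartAt (𝓡 7) x).symm y ∈ (chartAt E7 x).source := by
      simpa using (extChartAt (𝓡 7) x).map_target hy
    simp only [Function.comp_apply, formInChart]
    rw [chartField_eq v hy', (extChartAt (𝓡 7) x).right_inv hy]
    rfl
  have hsum : formInChart η x = fun y => ∑ i, ContinuousLinearMap.smulRightL ℝ E7 ℝ
      (EuclideanSpace.proj i) (formInChart η x y (EuclideanSpace.single i 1)) := by
    ext y v
    conv_lhs => rw [← (EuclideanSpace.basisFun (Fin 7) ℝ).sum_repr v]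
    simp
  rw [hsum]
  apply DifferentiableAt.fun_sum
  intro i _
  exact (ContinuousLinearMap.differentiableAt _).comp _ (key _)

/-- The invariant formula for the exterior derivative, obtained by pulling the fields back to `ℝ⁷`
by the chart at `x`. -/
theorem extD_apply_fields {U : Set N} (hU : IsOpen U) {η : ∀ x : N, TangentSpace (𝓡 7) x →L[ℝ] ℝ}
    (hη : SmoothFormOn U η) {x : N} (hx : x ∈ U) {X Y : ∀ x : N, TangentSpace (𝓡 7) x}
    (hX : DiffFieldAt X x) (hY : DiffFieldAt Y x) :
    extD η x (X x) (Y x) = mvfderiv (𝓡 7) (fun y => η y (Y y)) x (X x)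
      - mvfderiv (𝓡 7) (fun y => η y (X y)) x (Y x) - η x (mlieBracket (𝓡 7) X Y x) := by
  set φ := extChartAt (𝓡 7) x with hφ
  -- the field `Z` read in the chart
  let pb : (∀ x : N, TangentSpace (𝓡 7) x) → E7 → E7 := fun Z =>
    mpullbackWithin 𝓘(ℝ, E7) (𝓡 7) φ.symm Z (Set.range (𝓡 7))
  have hpb : ∀ Z, DiffFieldAt Z x → DifferentiableAt ℝ (pb Z) (φ x) := by
    intro Z hZ
    have := MDifferentiableWithinAt.differentiableWithinAt_mpullbackWithin_vectorField
      (I := 𝓡 7) (s := Set.univ) (V := Z) (x := x) (by exact hZ.mdifferentiableWithinAt)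
    rw [Set.preimage_univ, Set.univ_inter] at this
    refine DifferentiableWithinAt.differentiableAt this ?_
    simp
  have hpbx : ∀ Z : ∀ x : N, TangentSpace (𝓡 7) x, pb Z (φ x) = Z x := by
    intro Z
    have h1 : pb Z (φ x) = (mfderivWithin 𝓘(ℝ, E7) (𝓡 7) φ.symm (Set.range (𝓡 7)) (φ x)).inverse
      (Z (φ.symm (φ x))) := rfl
    have h2 := mfderivWithin_extChartAt_symm_inverse_apply (I := 𝓡 7) (x := x)
      (Z (φ.symm (φ x)))
    rw [h1]
    refine h2.trans ?_
    rw [hφ, extChartAt_to_inv]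
  have hf : ∀ (y v : E7), formInChart η x y v =
      η (φ.symm y) (mfderiv 𝓘(ℝ, E7) (𝓡 7) φ.symm y v) := fun y v => rfl
  have happ : ∀ Z : ∀ x : N, TangentSpace (𝓡 7) x, ∀ y ∈ φ.target,
      formInChart η x y (pb Z y) = η (φ.symm y) (Z (φ.symm y)) := by
    intro Z y hy
    have h1 : (mfderivWithin 𝓘(ℝ, E7) (𝓡 7) φ.symm (Set.range (𝓡 7)) y).IsInvertible :=
      isInvertible_mfderivWithin_extChartAt_symm hy
    have h0 : mfderiv 𝓘(ℝ, E7) (𝓡 7) φ.symm y =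
      mfderivWithin 𝓘(ℝ, E7) (𝓡 7) φ.symm (Set.range (𝓡 7)) y := by simp
    rw [hf, h0]
    exact congrArg (η (φ.symm y)) (h1.self_apply_inverse _)
  have hder : ∀ Z : ∀ x : N, TangentSpace (𝓡 7) x, DiffFieldAt Z x → ∀ v : E7,
      fderiv ℝ (fun y => formInChart η x y (pb Z y)) (φ x) v
        = mvfderiv (𝓡 7) (fun y => η y (Z y)) x v := by
    intro Z hZ v
    have h1 := mdifferentiableAt_form_apply hU hx hη hZ
    have h2 : fderiv ℝ (fun y => formInChart η x y (pb Z y)) (φ x) =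
        fderiv ℝ ((fun y => η y (Z y)) ∘ φ.symm) (φ x) := by
      apply Filter.EventuallyEq.fderiv_eq
      filter_upwards [extChartAt_target_mem_nhds (I := 𝓡 7) x] with y hy
      exact happ Z y hy
    rw [h2]
    have h3 : mfderiv (𝓡 7) 𝓘(ℝ, ℝ) (fun y => η y (Z y)) x =
        fderivWithin ℝ ((fun y => η y (Z y)) ∘ φ.symm) (Set.range (𝓡 7)) (φ x) := by
      rw [h1.mfderiv]
      rfl
    rw [ModelWithCorners.range_eq_univ, fderivWithin_univ] at h3
    rw [← h3]
    rfl
  have hbr : formInChart η x (φ x) (lieBracket ℝ (pb X) (pb Y) (φ x)) =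
      η x (mlieBracket (𝓡 7) X Y x) := by
    have h1 : mlieBracket (𝓡 7) X Y x = (lieBracket ℝ (pb X) (pb Y) (φ x) : E7) := by
      rw [← mlieBracketWithin_univ, mlieBracketWithin_apply, Set.preimage_univ, Set.univ_inter,
        mfderiv_extChartAt_self]
      change (ContinuousLinearMap.id ℝ E7).inverse
        (lieBracketWithin ℝ (pb X) (pb Y) (Set.range (𝓡 7)) (φ x)) = _
      rw [ContinuousLinearMap.inverse_id, ModelWithCorners.range_eq_univ, lieBracketWithin_univ]
      rfl
    have h2 : ∀ v : E7, mfderiv 𝓘(ℝ, E7) (𝓡 7) φ.symm (φ x) v = v := by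
      intro v
      have := mfderivWithin_range_extChartAt_symm (I := 𝓡 7) (x := x)
      rw [ModelWithCorners.range_eq_univ, mfderivWithin_univ] at this
      exact DFunLike.congr_fun this v
    have h3 : ∀ z, z = x → ∀ v : E7, η z v = η x v := by
      rintro _ rfl v
      rfl
    rw [h1, hf]
    exact (congrArg (η (φ.symm (φ x))) (h2 _)).trans (h3 _ (extChartAt_to_inv x) _)
  have hω : DifferentiableAt ℝ (fun y => ContinuousAlternatingMap.ofSubsingleton ℝ E7 ℝ (0 : Fin 1)
      (formInChart η x y)) (φ x) :=
    ((ContinuousAlternatingMap.ofSubsingletonLIE (𝕜 := ℝ) (E := E7) (F := ℝ)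
      (0 : Fin 1)).differentiableAt).comp _ (differentiableAt_formInChart hU hη hx)
  have main := extDeriv_apply_vectorField hω (V := ![pb X, pb Y])
    (by intro i; fin_cases i; exacts [hpb X hX, hpb Y hY])
  have e : extD η x (X x) (Y x) = extDeriv (fun y => ContinuousAlternatingMap.ofSubsingleton ℝ E7 ℝ
      (0 : Fin 1) (formInChart η x y)) (φ x)
      (fun i => (![pb X, pb Y] : Fin 2 → E7 → E7) i (φ x)) := by
    rw [extD_eq]
    refine congrArg (extDAlt η x) (funext fun i => ?_)
    fin_cases i
    · exact (hpbx X).symm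
    · exact (hpbx Y).symm
  have e0 : fderiv ℝ (fun y => formInChart η x y
      ((Fin.removeNth (0 : Fin 2) fun i => (![pb X, pb Y] : Fin 2 → E7 → E7) i y) 0)) (φ x)
      ((![pb X, pb Y] : Fin 2 → E7 → E7) 0 (φ x)) =
      mvfderiv (𝓡 7) (fun y => η y (Y y)) x (X x) := (hder Y hY _).trans (congrArg _ (hpbx X))
  have e1 : fderiv ℝ (fun y => formInChart η x y
      ((Fin.removeNth (1 : Fin 2) fun i => (![pb X, pb Y] : Fin 2 → E7 → E7) i y) 0)) (φ x)
      ((![pb X, pb Y] : Fin 2 → E7 → E7) 1 (φ x)) =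
      mvfderiv (𝓡 7) (fun y => η y (X y)) x (Y x) := (hder X hX _).trans (congrArg _ (hpbx Y))
  rw [e, main, Fin.sum_univ_two]
  simp only [ContinuousAlternatingMap.ofSubsingleton_apply_apply, e0, e1]
  rw [Fin.sum_univ_succ, Finset.univ_eq_empty, Finset.sum_empty, add_zero]
  have hI : Finset.Ici (0 : Fin (0 + 1)) = {0} := by decide
  rw [hI, Finset.sum_singleton]
  simp only [Fin.val_zero, Fin.val_one, pow_zero, pow_one, one_smul, neg_smul, add_zero]
  rw [← sub_eq_add_neg, ← hbr]
  rfl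

end Calculus

/-! ### The decomposition of `V* ⊗ Sym²(Λ²₊)` -/

section Quaternionic

variable {V : Type*} [AddCommGroup V] [Module ℝ V]

namespace IsQuaternionic

variable {I : Fin 3 → (V →ₗ[ℝ] V)}

theorem sq (h : IsQuaternionic I) (i : Fin 3) (v : V) : I i (I i v) = -v :=
  LinearMap.congr_fun (h.1 i) v

theorem mul_zero_one (h : IsQuaternionic I) (v : V) : I 0 (I 1 v) = I 2 v :=
  LinearMap.congr_fun h.2.1 v

theorem mul_one_zero (h : IsQuaternionic I) (v : V) : I 1 (I 0 v) = -I 2 v :=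
  LinearMap.congr_fun h.2.2 v

theorem mul_zero_two (h : IsQuaternionic I) (v : V) : I 0 (I 2 v) = -I 1 v := by
  rw [← h.mul_zero_one, h.sq]

theorem mul_one_two (h : IsQuaternionic I) (v : V) : I 1 (I 2 v) = I 0 v := by
  have := h.mul_one_zero v
  rw [← neg_eq_iff_eq_neg] at this
  rw [← this, map_neg, h.sq, neg_neg]

theorem mul_two_zero (h : IsQuaternionic I) (v : V) : I 2 (I 0 v) = I 1 v := by
  rw [← h.mul_zero_one, h.mul_one_zero, map_neg, h.mul_zero_two, neg_neg]

theorem mul_two_one (h : IsQuaternionic I) (v : V) : I 2 (I 1 v) = -I 0 v := by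
  rw [← h.mul_zero_one, h.sq, map_neg]

theorem anticomm (h : IsQuaternionic I) {i j : Fin 3} (hij : i ≠ j) (v : V) :
    I i (I j v) = - I j (I i v) := by
  fin_cases i <;> fin_cases j <;>
    simp_all [h.mul_zero_one, h.mul_one_zero, h.mul_zero_two, h.mul_one_two, h.mul_two_zero,
      h.mul_two_one]

/-- The sign in the definition of `act` makes up for the reversal of products by transposition. -/
theorem act (h : IsQuaternionic I) : IsQuaternionic (fun i => act (I i)) := by
  refine ⟨fun i => ?_, ?_, ?_⟩ <;> ext a v <;> simp [QC.act]
  · simp [h.sq]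
  · simp [h.mul_one_zero]
  · simp [h.mul_zero_one]

end IsQuaternionic

/-- The symmetrization `(J i (r j) + J j (r i))` of `∑ J i (r j) ⊗ I i ⊗ I j`. It is used for the
action `J i = act (I i)` of a quaternionic structure on covectors. -/
def symAct (J : Fin 3 → (V →ₗ[ℝ] V)) (r : Fin 3 → V) : Fin 3 → Fin 3 → V :=
  fun i j => J i (r j) + J j (r i)

variable {J : Fin 3 → (V →ₗ[ℝ] V)}

/-- The contraction defining `S^{5,1}`, on a symmetrized tensor: the `r j`-terms are `J i J i (r
j)`, which gives `-3`, and `J i J j (r i)` for `i ≠ j`, which is `-J j J i (r i)`; completing the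
latter to a sum over all `i` costs `2 • J j J j (r j)`. -/
theorem sum_apply_symAct (hJ : IsQuaternionic J) (r : Fin 3 → V) (j : Fin 3) :
    ∑ i, J i (symAct J r i j) = (-5 : ℝ) • r j - J j (∑ i, J i (r i)) := by
  fin_cases j <;>
    simp [symAct, Fin.sum_univ_three, hJ.sq, hJ.mul_zero_one, hJ.mul_one_zero, hJ.mul_zero_two,
      hJ.mul_one_two, hJ.mul_two_zero, hJ.mul_two_one] <;> module

/-- If the contraction of `symAct J r` vanishes then `-5 r j = J j ρ` with `ρ = ∑ i, J i (r i)`.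
Applying `J j` and summing gives `-5 ρ = -3 ρ`, so `ρ = 0` and `r = 0`. -/
theorem eq_zero_of_sum_apply_symAct (hJ : IsQuaternionic J) (r : Fin 3 → V)
    (h : ∀ j, ∑ i, J i (symAct J r i j) = 0) : r = 0 := by
  set ρ := ∑ i, J i (r i) with hρ
  have h1 : ∀ j, (-5 : ℝ) • r j = J j ρ := fun j => by
    have := h j
    rw [sum_apply_symAct hJ, sub_eq_zero] at this
    exact this
  have h2 : (-5 : ℝ) • ρ = (-3 : ℝ) • ρ := by
    conv_lhs => rw [hρ, Finset.smul_sum]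
    have : ∀ i, (-5 : ℝ) • J i (r i) = -ρ := fun i => by
      rw [← map_smul, h1, hJ.sq]
    simp only [this, Fin.sum_univ_three]
    module
  have h3 : ρ = 0 := by
    have : (2 : ℝ) • ρ = 0 := by
      have : (2 : ℝ) • ρ = (-3 : ℝ) • ρ - (-5 : ℝ) • ρ := by module
      rw [this, h2, sub_self]
    simpa using this
  ext j
  have := h1 j
  rw [h3, map_zero] at this
  simpa using this

/-- The solution `r` of `∑ i, J i (b i j - J i (r j) - J j (r i)) = 0`. With `c j = ∑ i, J i (b i
j)` the equation reads `-5 r j - J j ρ = c j` for `ρ = ∑ i, J i (r i)`; applying `J j` and summing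
gives `ρ = -1/2 ∑ k, J k (c k)`, and then `r j`. -/
noncomputable def symSolve (J : Fin 3 → (V →ₗ[ℝ] V)) (b : Fin 3 → Fin 3 → V) (j : Fin 3) : V :=
  (-1 / 5 : ℝ) • (∑ i, J i (b i j)) + (1 / 10 : ℝ) • J j (∑ k, J k (∑ i, J i (b i k)))

theorem sum_apply_sub_symSolve (hJ : IsQuaternionic J) (b : Fin 3 → Fin 3 → V) (j : Fin 3) :
    ∑ i, J i (b i j - symAct J (symSolve J b) i j) = 0 := by
  simp only [map_sub, Finset.sum_sub_distrib]
  rw [sum_apply_symAct hJ]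
  set c : Fin 3 → V := fun j => ∑ i, J i (b i j) with hc
  have h1 : ∀ j, symSolve J b j = (-1 / 5 : ℝ) • c j + (1 / 10 : ℝ) • J j (∑ k, J k (c k)) :=
    fun _ => rfl
  have h2 : ∑ i, J i (symSolve J b i) = (-1 / 2 : ℝ) • ∑ k, J k (c k) := by
    simp only [h1, map_add, map_smul, hJ.sq, Fin.sum_univ_three]
    module
  rw [h2, h1]
  change c j - _ = 0
  rw [map_smul]
  module

variable {I : Fin 3 → (V →ₗ[ℝ] V)}

theorem symAct_comm (r : Fin 3 → V) (i j : Fin 3) : symAct J r i j = symAct J r j i := by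
  simp [symAct, add_comm]

/-- Every symmetric tensor is the sum of an element of `S^{5,1}` and of a symmetrized tensor. -/
theorem sub_symSolve_mem_S51 (hI : IsQuaternionic I) {b : Fin 3 → Fin 3 → (V →ₗ[ℝ] ℝ)}
    (hb : ∀ i j, b i j = b j i) :
    b - symAct (fun i => act (I i)) (symSolve (fun i => act (I i)) b) ∈ S51 I := by
  refine ⟨fun i j => ?_, fun j => ?_⟩
  · simp only [Pi.sub_apply]
    rw [hb, symAct_comm]
  · exact sum_apply_sub_symSolve hI.act b j

/-- Symmetrization is injective modulo `S^{5,1}`. -/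
theorem eq_zero_of_symAct_mem_S51 (hI : IsQuaternionic I) {r : Fin 3 → (V →ₗ[ℝ] ℝ)}
    (h : symAct (fun i => act (I i)) r ∈ S51 I) : r = 0 :=
  eq_zero_of_sum_apply_symAct hI.act r h.2

theorem symAct_add (r s : Fin 3 → V) : symAct J (r + s) = symAct J r + symAct J s := by
  ext i j
  simp only [symAct, Pi.add_apply, map_add]
  abel

theorem symAct_smul (c : ℝ) (r : Fin 3 → V) : symAct J (c • r) = c • symAct J r := by
  ext i j
  simp only [symAct, Pi.smul_apply, map_smul, smul_add]

/-- The component `S^{1,1}` is the image under symmetrization of the tensors `r k = J k s`. -/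
theorem symAct_apply_self (hJ : IsQuaternionic J) (s : V) (i j : Fin 3) :
    symAct J (fun k => J k s) i j = if i = j then (-2 : ℝ) • s else 0 := by
  split_ifs with h
  · subst h
    simp only [symAct, hJ.sq]
    module
  · simp only [symAct]
    rw [hJ.anticomm h, neg_add_cancel]

/-- The sum `S^{3,1} ⊕ S^{1,1}` is the image of `V* ⊗ Λ²₊` under symmetrization. -/
theorem mem_S31_sup_S11 (hI : IsQuaternionic I) {a : Fin 3 → Fin 3 → (V →ₗ[ℝ] ℝ)} :
    a ∈ S31 I ⊔ S11 V ↔ ∃ r, a = symAct (fun i => act (I i)) r := by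
  constructor
  · rw [Submodule.mem_sup]
    rintro ⟨y, ⟨r, -, hr⟩, z, ⟨s, hs⟩, rfl⟩
    refine ⟨r + (-1 / 2 : ℝ) • fun k => act (I k) s, ?_⟩
    ext1 i
    ext1 j
    rw [symAct_add, symAct_smul]
    simp only [Pi.add_apply, Pi.smul_apply, symAct_apply_self hI.act, hr, hs]
    congr 1
    split_ifs
    · module
    · simp
  · rintro ⟨r, rfl⟩
    set ρ := ∑ i, act (I i) (r i) with hρ
    -- the first summand has vanishing contraction, because `∑ k, I k (I k ρ) = -3 ρ`
    have e : r = (r + (1 / 3 : ℝ) • fun k => act (I k) ρ) +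
        (-1 / 3 : ℝ) • fun k => act (I k) ρ := by module
    rw [e, symAct_add]
    refine Submodule.add_mem_sup ⟨_, ?_, fun i j => rfl⟩ ⟨(2 / 3 : ℝ) • ρ, fun i j => ?_⟩
    · have := hI.act.sq
      simp only [Pi.add_apply, Pi.smul_apply, map_add, map_smul, Finset.sum_add_distrib, this,
        ← hρ, Fin.sum_univ_three]
      module
    · rw [symAct_smul]
      simp only [Pi.smul_apply, symAct_apply_self hI.act]
      split_ifs
      · module
      · simp

/-- The `S^{5,1}` part vanishes exactly for the symmetrized tensors. -/
theorem isS51Part_zero_iff (hI : IsQuaternionic I) {a : Fin 3 → Fin 3 → (V →ₗ[ℝ] ℝ)} :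
    IsS51Part I a 0 ↔ ∃ r, a = symAct (fun i => act (I i)) r := by
  rw [IsS51Part, sub_zero, mem_S31_sup_S11 hI]
  exact and_iff_right (S51 I).zero_mem

end Quaternionic

/-! ### Rotation of the quaternionic structure -/

section Rotation

variable {V : Type*} [AddCommGroup V] [Module ℝ V] {I I' : Fin 3 → (V →ₗ[ℝ] V)}
  {A : Matrix (Fin 3) (Fin 3) ℝ}

/-- The components `∑ A i k A j l a k l` of a tensor in a rotated basis. -/
def rotate {M : Type*} [AddCommGroup M] [Module ℝ M] (A : Matrix (Fin 3) (Fin 3) ℝ)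
    (a : Fin 3 → Fin 3 → M) : Fin 3 → Fin 3 → M :=
  fun i j => ∑ k, ∑ l, (A i k * A j l) • a k l

theorem act_rotated (hI' : ∀ i, I' i = ∑ k, A i k • I k) (i : Fin 3) (b : V →ₗ[ℝ] ℝ) :
    act (I' i) b = ∑ k, A i k • act (I k) b := by
  ext v
  simp [act, hI']

theorem sum_mul_left (hA : A.transpose * A = 1) (k l : Fin 3) :
    ∑ i, A i k * A i l = if k = l then 1 else 0 := by
  have := congrFun (congrFun hA k) l
  rw [Matrix.mul_apply, Matrix.one_apply] at this
  exact this

theorem sum_mul_right (hA : A * A.transpose = 1) (i j : Fin 3) :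
    ∑ k, A i k * A j k = if i = j then 1 else 0 := by
  have := congrFun (congrFun hA i) j
  rw [Matrix.mul_apply, Matrix.one_apply] at this
  exact this

/-- `S^{5,1}` does not depend on the basis of the quaternionic structure. -/
theorem rotate_mem_S51 (hA : A.transpose * A = 1) (hI' : ∀ i, I' i = ∑ k, A i k • I k)
    {a : Fin 3 → Fin 3 → (V →ₗ[ℝ] ℝ)} (ha : a ∈ S51 I) : rotate A a ∈ S51 I' := by
  refine ⟨fun i j => ?_, fun j => ?_⟩
  · simp only [rotate]
    rw [Finset.sum_comm]
    refine Finset.sum_congr rfl fun k _ => Finset.sum_congr rfl fun l _ => ?_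
    rw [ha.1, mul_comm]
  · simp only [act_rotated hI', rotate, map_sum, map_smul, Finset.smul_sum, smul_smul]
    have e : ∀ i m k l, (A i m * (A i k * A j l)) • act (I m) (a k l) =
        (A i m * A i k) • (A j l • act (I m) (a k l)) := fun i m k l => by
      rw [smul_smul]; congr 1; ring
    simp only [e]
    rw [Finset.sum_comm]
    have e2 : ∀ m, ∑ i, ∑ k, ∑ l, (A i m * A i k) • (A j l • act (I m) (a k l)) =
        ∑ l, A j l • act (I m) (a m l) := by
      intro m
      rw [Finset.sum_comm]
      simp only [← Finset.smul_sum]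
      simp only [← Finset.sum_smul, sum_mul_left hA]
      simp
    simp only [e2]
    rw [Finset.sum_comm]
    simp only [← Finset.smul_sum, ha.2, smul_zero, Finset.sum_const_zero]

theorem rotate_symAct (hI' : ∀ i, I' i = ∑ k, A i k • I k) (r : Fin 3 → (V →ₗ[ℝ] ℝ)) :
    rotate A (symAct (fun i => act (I i)) r) =
      symAct (fun i => act (I' i)) (fun j => ∑ l, A j l • r l) := by
  ext1 i
  ext1 j
  simp only [symAct, rotate, act_rotated hI', map_sum, map_smul, smul_add, Finset.sum_add_distrib,
    Finset.smul_sum, smul_smul]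
  congr 1
  rw [Finset.sum_comm]
  refine Finset.sum_congr rfl fun k _ => Finset.sum_congr rfl fun l _ => ?_
  rw [mul_comm]

end Rotation

/-! ### Metrics with the same self-dual forms are conformal -/

section Conformal

variable {V : Type*} [AddCommGroup V] [Module ℝ V]

/-- Two imaginary quaternions `K`, `L` of squared norms `n`, `m` and inner product `p`, with
`L = K P` for an almost complex structure `P`, are orthogonal and have the same norm. -/
theorem orthogonal_of_eq_mul [Nontrivial V] {K L P : V →ₗ[ℝ] V} {n m p : ℝ} (hn : n ≠ 0)
    (hK : ∀ v, K (K v) = -(n • v)) (hL : ∀ v, L (L v) = -(m • v))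
    (hKL : ∀ v, K (L v) + L (K v) = (-2 * p) • v)
    (hP : ∀ v, P (P v) = -v) (h : ∀ v, L v = K (P v)) : p = 0 ∧ n = m := by
  have h1 : ∀ v, K (L v) = -(n • P v) := fun v => by rw [h, hK]
  -- `(K L)²` computed in two ways, from `K L = -n P` and from `L K = -2p - K L`
  have h2 : ∀ v, K (L (K (L v))) = -((n * n) • v) := fun v => by
    rw [h1, h1, map_neg, map_smul, hP]
    module
  have h3 : ∀ v, K (L (K (L v))) = (2 * p * n) • P v - (m * n) • v := fun v => by
    have e : L (K (L v)) = (-2 * p) • L v - K (L (L v)) := by rw [← hKL]; abel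
    rw [e, map_sub, map_smul, h1, hL, map_neg, map_neg, map_smul, map_smul, hK]
    module
  have h4 : ∀ v, (2 * p * n) • P v = (m * n - n * n) • v := fun v => by
    have := (h3 v).symm.trans (h2 v)
    rw [sub_eq_iff_eq_add] at this
    rw [this]
    module
  obtain ⟨v, hv⟩ := exists_ne (0 : V)
  have hp : p = 0 := by
    by_contra hp
    -- otherwise `P` would be a real multiple of the identity, although `P² = -1`
    have h5 : (2 * p * n) • (2 * p * n) • P (P v) =
        ((m * n - n * n) * (m * n - n * n)) • v := by
      rw [h4, smul_comm, h4, smul_smul]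
    have h6 : ((m * n - n * n) * (m * n - n * n) + (2 * p * n) * (2 * p * n)) • v = 0 := by
      rw [add_smul, ← h5, hP]
      module
    rcases smul_eq_zero.1 h6 with h7 | h7
    · have : 2 * p * n ≠ 0 := by positivity
      nlinarith [mul_self_nonneg (m * n - n * n), mul_self_pos.2 this]
    · exact hv h7
  refine ⟨hp, ?_⟩
  have h5 := (h4 v).symm
  rw [hp, mul_zero, zero_mul, zero_smul] at h5
  have h6 := (smul_eq_zero.1 h5).resolve_right hv
  have h7 : n * (m - n) = 0 := by linarith
  have := (mul_eq_zero.1 h7).resolve_left hn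
  linarith

/-- If the 2-forms `g'(I' i ·, ·)` are combinations of the 2-forms `g(I i ·, ·)`, then `g'` is
conformal to `g` and the frame `I'` is obtained from `I` by an orthogonal matrix.

Let `g' = g(P ·, ·)` and `K i = ∑ j, B i j • I j`, so that `K i = P ∘ I' i` is an imaginary
quaternion for the structure `I`. From `K c = K a ∘ I' b` for `I' c = I' a ∘ I' b` one gets that the
`K i` are orthogonal to each other and have the same norm. With `n` the square of this norm, `P` is
up to the factor `n` a product of the `K i`, whence `P² = n`, and `P = √n` since `g'` is positive.
-/
theorem conformal_of_selfDual [Nontrivial V] {g g' : LinearMap.BilinForm ℝ V}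
    (hg : ∀ X, X ≠ 0 → 0 < g X X) (hg' : ∀ X, X ≠ 0 → 0 < g' X X)
    {I I' : Fin 3 → (V →ₗ[ℝ] V)} (hI : IsQuaternionic I) (hI' : IsQuaternionic I')
    {B : Matrix (Fin 3) (Fin 3) ℝ}
    (h : ∀ i X Y, g' (I' i X) Y = ∑ j, B i j * g (I j X) Y) :
    ∃ f : ℝ, 0 < f ∧ (B * B.transpose = (f ^ 2) • 1) ∧ (B.transpose * B = (f ^ 2) • 1) ∧
      (∀ i, I' i = ∑ j, (f⁻¹ * B i j) • I j) ∧ ∀ X Y, g' X Y = f * g X Y := by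
  have nondeg : ∀ X, (∀ Y, g X Y = 0) → X = 0 := fun X hX => by
    by_contra hne
    exact (hg X hne).ne' (hX X)
  let K : Fin 3 → (V →ₗ[ℝ] V) := fun i => ∑ j, B i j • I j
  have hK : ∀ i v, K i v = B i 0 • I 0 v + B i 1 • I 1 v + B i 2 • I 2 v := fun i v => by
    simp [K, Fin.sum_univ_three]
  have hgK : ∀ i X Y, g' (I' i X) Y = g (K i X) Y := fun i X Y => by
    rw [h, hK, Fin.sum_univ_three]
    simp
  -- the inner products of the imaginary quaternions `K i`
  let q : Fin 3 → Fin 3 → ℝ := fun i j => B i 0 * B j 0 + B i 1 * B j 1 + B i 2 * B j 2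
  have hKK : ∀ i j v, K i (K j v) + K j (K i v) = (-2 * q i j) • v := fun i j v => by
    simp only [hK, map_add, map_smul, hI.sq, hI.mul_zero_one, hI.mul_one_zero, hI.mul_zero_two,
      hI.mul_one_two, hI.mul_two_zero, hI.mul_two_one, q]
    module
  have hKsq : ∀ i v, K i (K i v) = -(q i i • v) := fun i v => by
    have := hKK i i v
    have h2 : (2 : ℝ) • (K i (K i v)) = (2 : ℝ) • (-(q i i • v)) := by
      rw [two_smul, this]; module
    exact smul_right_injective V (two_ne_zero (α := ℝ)) h2
  let P : V →ₗ[ℝ] V := -(K 0 ∘ₗ I' 0)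
  have hgP : ∀ X Y, g' X Y = g (P X) Y := fun X Y => by
    have : X = I' 0 (-(I' 0 X)) := by rw [map_neg, hI'.sq, neg_neg]
    conv_lhs => rw [this]
    rw [hgK]
    simp [P]
  have hKP : ∀ i X, K i X = P (I' i X) := fun i X => by
    rw [← sub_eq_zero]
    apply nondeg
    intro Y
    rw [map_sub, LinearMap.sub_apply, ← hgK, ← hgP, sub_self]
  have hq : ∀ i, q i i ≠ 0 := by
    intro i hi
    obtain ⟨v, hv⟩ := exists_ne (0 : V)
    have key : ∀ w, K i w = 0 → w = 0 := fun w hw => by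
      by_contra hne
      have h1 : I' i w ≠ 0 := fun h0 => hne (by
        have := hI'.sq i w
        rw [h0, map_zero] at this
        simpa using this.symm)
      have h2 := hgK i w (I' i w)
      rw [hw, map_zero, LinearMap.zero_apply] at h2
      exact (hg' _ h1).ne' h2
    apply hv
    apply key
    apply key
    rw [hKsq, hi, zero_smul, neg_zero]
  have hKmul : ∀ a b c, (∀ v, I' a (I' b v) = I' c v) → q a c = 0 ∧ q a a = q c c := by
    intro a b c habc
    refine orthogonal_of_eq_mul (P := I' b) (hq a) (hKsq a) (hKsq c) (hKK a c) (hI'.sq b) ?_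
    intro v
    rw [hKP, hKP, habc]
  obtain ⟨h02, n02⟩ := hKmul 0 1 2 hI'.mul_zero_one
  obtain ⟨h10, n10⟩ := hKmul 1 2 0 hI'.mul_one_two
  obtain ⟨h21, -⟩ := hKmul 2 0 1 hI'.mul_two_zero
  have hqs : ∀ i j, q i j = q j i := fun i j => by simp only [q]; ring
  set n := q 0 0 with hn
  have hn0 : 0 < n := lt_of_le_of_ne
    (by simp only [hn, q]; nlinarith [sq_nonneg (B 0 0), sq_nonneg (B 0 1), sq_nonneg (B 0 2)])
    (hq 0).symm
  have hqn : ∀ i j, q i j = if i = j then n else 0 := by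
    intro i j
    fin_cases i <;> fin_cases j <;> simp
    exacts [rfl, (hqs _ _).trans h10, h02, h10, n10, (hqs _ _).trans h21, (hqs _ _).trans h02, h21,
      n02.symm]
  have hKan : ∀ i j v, i ≠ j → K i (K j v) = -K j (K i v) := fun i j v hij => by
    rw [eq_neg_iff_add_eq_zero, hKK, hqn, if_neg hij, mul_zero, zero_smul]
  have hKsq' : ∀ i v, K i (K i v) = -(n • v) := fun i v => by rw [hKsq, hqn, if_pos rfl]
  have hP3 : ∀ v, n • P v = K 1 (K 0 (K 2 v)) := fun v => by
    have e1 : K 0 (K 2 v) = -(n • I' 1 v) := by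
      rw [hKP 2, ← hI'.mul_zero_one, ← hKP, hKsq']
    rw [e1, map_neg, map_smul, hKP, hI'.sq, map_neg]
    module
  have hPP : ∀ v, P (P v) = n • v := fun v => by
    have e1 : n • P (n • P v) = K 1 (K 0 (K 2 (K 1 (K 0 (K 2 v))))) := by rw [hP3, hP3]
    have e2 : K 1 (K 0 (K 2 (K 1 (K 0 (K 2 v))))) = n • n • n • v := by
      rw [hKan 2 1 _ (by decide), map_neg, map_neg, hKan 0 1 _ (by decide), map_neg, hKsq',
        hKan 2 0 _ (by decide), map_neg, hKsq', hKsq']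
      simp
    have e : n • n • P (P v) = n • n • n • v := by rw [← e2, ← e1, map_smul]
    exact smul_right_injective V hn0.ne' (smul_right_injective V hn0.ne' e)
  set f := √n with hf
  have hf0 : 0 < f := Real.sqrt_pos.2 hn0
  have hff : f * f = n := Real.mul_self_sqrt hn0.le
  have hPf : ∀ v, P v = f • v := fun v => by
    rw [← sub_eq_zero]
    -- `P v - f v` lies in the eigenspace of `-f`, on which `g'` would be negative
    by_contra hne
    have e : P (P v - f • v) = -(f • (P v - f • v)) := by
      rw [map_sub, map_smul, hPP, ← hff]
      module
    have h1 := hg' _ hne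
    rw [hgP, e] at h1
    have h2 := hg _ hne
    simp only [map_neg, map_smul, LinearMap.neg_apply, LinearMap.smul_apply, smul_eq_mul] at h1
    nlinarith
  have hBB : B * B.transpose = (f ^ 2) • 1 := by
    ext i j
    rw [Matrix.mul_apply, Fin.sum_univ_three]
    have := hqn i j
    simp only [q] at this
    rw [Matrix.transpose_apply, Matrix.transpose_apply, Matrix.transpose_apply, this, sq, hff]
    simp [Matrix.one_apply]
  have hBB' : B.transpose * B = (f ^ 2) • 1 := by
    have e : B * ((f ^ 2)⁻¹ • B.transpose) = 1 := by
      rw [Matrix.mul_smul, hBB, smul_smul, inv_mul_cancel₀ (by positivity), one_smul]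
    have e2 := mul_eq_one_comm.1 e
    rw [Matrix.smul_mul] at e2
    rw [← e2, smul_smul, mul_inv_cancel₀ (by positivity), one_smul]
  refine ⟨f, hf0, hBB, hBB', fun i => ?_, fun X Y => ?_⟩
  · ext v
    have h1 : K i v = f • I' i v := by rw [hKP, hPf]
    have h2 : I' i v = f⁻¹ • K i v := by rw [h1, smul_smul, inv_mul_cancel₀ hf0.ne', one_smul]
    rw [h2, hK]
    simp [Fin.sum_univ_three, smul_smul]
  · rw [hgP, hPf]
    simp

end Conformal

/-! ### Differentials of one-forms vanishing on a distribution -/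

section Tensor

open scoped Topology Bundle
open VectorField

variable {N : Type*} [TopologicalSpace N] [ChartedSpace E7 N] [IsManifold (𝓡 7) ∞ N]

theorem mvfderiv_congr {f h : N → ℝ} {x : N} (hfh : f =ᶠ[𝓝 x] h) :
    mvfderiv (𝓡 7) f x = mvfderiv (𝓡 7) h x := by
  ext v
  simp only [mvfderiv]
  rw [hfh.mfderiv_eq]
  rfl

theorem mvfderiv_eq_zero_of_eventually_const {f : N → ℝ} {x : N} {c : ℝ}
    (hf : ∀ᶠ y in 𝓝 x, f y = c) : mvfderiv (𝓡 7) f x = 0 := by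
  rw [mvfderiv_congr (h := fun _ => c) hf, mvfderiv_const]

theorem mdifferentiableAt_sum_mul {ι : Type*} {f h : ι → N → ℝ} {x : N} {s : Finset ι}
    (hf : ∀ i, MDifferentiableAt (𝓡 7) 𝓘(ℝ, ℝ) (f i) x)
    (hh : ∀ i, MDifferentiableAt (𝓡 7) 𝓘(ℝ, ℝ) (h i) x) :
    MDifferentiableAt (𝓡 7) 𝓘(ℝ, ℝ) (fun y => ∑ i ∈ s, f i y * h i y) x := by
  classical
  induction s using Finset.induction_on with
  | empty => simpa using mdifferentiableAt_const
  | insert a s ha ih =>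
    simp only [Finset.sum_insert ha]
    exact ((hf a).mul (hh a)).add ih

theorem mvfderiv_sum_mul {ι : Type*} {f h : ι → N → ℝ} {x : N} (s : Finset ι)
    (hf : ∀ i, MDifferentiableAt (𝓡 7) 𝓘(ℝ, ℝ) (f i) x)
    (hh : ∀ i, MDifferentiableAt (𝓡 7) 𝓘(ℝ, ℝ) (h i) x) (v : TangentSpace (𝓡 7) x) :
    mvfderiv (𝓡 7) (fun y => ∑ i ∈ s, f i y * h i y) x v =
      ∑ i ∈ s, (f i x * mvfderiv (𝓡 7) (h i) x v + h i x * mvfderiv (𝓡 7) (f i) x v) := by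
  classical
  induction s using Finset.induction_on with
  | empty => simp [mvfderiv_const]
  | insert a s ha ih =>
    simp only [Finset.sum_insert ha]
    have h1 := mvfderiv_fun_add ((hf a).mul (hh a)) (mdifferentiableAt_sum_mul (s := s) hf hh)
    have h2 := mvfderiv_fun_mul (hf a) (hh a)
    have h3 := DFunLike.congr_fun h1 v
    have h4 := DFunLike.congr_fun h2 v
    refine h3.trans ?_
    rw [← ih]
    exact congrArg (· + _) h4

theorem diffFieldAt_extend {x : N} (v : TangentSpace (𝓡 7) x) :
    DiffFieldAt (FiberBundle.extend E7 v) x :=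
  FiberBundle.mdifferentiableAt_extend (𝓡 7) E7 v

theorem SmoothFormOn.smoothFnOn_extD {U : Set N} (hU : IsOpen U)
    {η : ∀ x : N, TangentSpace (𝓡 7) x →L[ℝ] ℝ} (hη : SmoothFormOn U η)
    {X Y : ∀ x : N, TangentSpace (𝓡 7) x} (hX : SmoothFieldOn U X) (hY : SmoothFieldOn U Y) :
    SmoothFnOn U (fun x => extD η x (X x) (Y x)) := by
  have h1 := SmoothFnOn.mvfderiv_apply hU (hη.apply hY) hX
  have h2 := SmoothFnOn.mvfderiv_apply hU (hη.apply hX) hY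
  have h3 := hη.apply (hX.mlieBracket hU hY)
  refine ContMDiffOn.congr ((h1.sub h2).sub h3) fun x hx => ?_
  exact extD_apply_fields hU hη hx (hX.diffFieldAt hU hx) (hY.diffFieldAt hU hx)

/-- The Leibniz rule `d(∑ f_j η_j) = ∑ df_j ∧ η_j + f_j dη_j`. -/
theorem extD_sum_smul {ι : Type*} [Fintype ι] {U : Set N} (hU : IsOpen U)
    {ζ : ∀ x : N, TangentSpace (𝓡 7) x →L[ℝ] ℝ} {η : ι → ∀ x : N, TangentSpace (𝓡 7) x →L[ℝ] ℝ}
    {f : ι → N → ℝ} (hζ : SmoothFormOn U ζ) (hη : ∀ j, SmoothFormOn U (η j))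
    (hf : ∀ j, SmoothFnOn U (f j)) (h : ∀ x ∈ U, ∀ v, ζ x v = ∑ j, f j x * η j x v)
    {x : N} (hx : x ∈ U) (u v : TangentSpace (𝓡 7) x) :
    extD ζ x u v = ∑ j, (f j x * extD (η j) x u v
      + (mvfderiv (𝓡 7) (f j) x u * η j x v - mvfderiv (𝓡 7) (f j) x v * η j x u)) := by
  set X : ∀ y : N, TangentSpace (𝓡 7) y := FiberBundle.extend E7 u with hXdef
  set Y : ∀ y : N, TangentSpace (𝓡 7) y := FiberBundle.extend E7 v with hYdef
  have hX : DiffFieldAt X x := diffFieldAt_extend u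
  have hY : DiffFieldAt Y x := diffFieldAt_extend v
  have hXx : X x = u := FiberBundle.extend_apply_self ..
  have hYx : Y x = v := FiberBundle.extend_apply_self ..
  have hfd := fun j => (hf j).mdifferentiableAt hU hx
  have happ : ∀ Z, DiffFieldAt Z x → ∀ w, mvfderiv (𝓡 7) (fun y => ζ y (Z y)) x w =
      ∑ j, (f j x * mvfderiv (𝓡 7) (fun y => η j y (Z y)) x w
        + η j x (Z x) * mvfderiv (𝓡 7) (f j) x w) := fun Z hZ w => by
    rw [mvfderiv_congr (h := fun y => ∑ j, f j y * η j y (Z y))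
      (Filter.eventuallyEq_of_mem (hU.mem_nhds hx) fun y hy => h y hy _)]
    exact mvfderiv_sum_mul _ hfd (fun j => mdifferentiableAt_form_apply hU hx (hη j) hZ) w
  have e1 := extD_apply_fields hU hζ hx hX hY
  have e2 := fun j => extD_apply_fields hU (hη j) hx hX hY
  rw [happ _ hX, happ _ hY, h x hx] at e1
  rw [hXx, hYx] at e1
  simp only [hXx, hYx] at e2
  rw [e1]
  simp only [e2]
  rw [← Finset.sum_sub_distrib, ← Finset.sum_sub_distrib]
  refine Finset.sum_congr rfl fun j _ => ?_
  ring

/-- If `α(X)` and `α(Y)` are constant near `x` then `dα(X, Y) = -α([X, Y])`. -/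
theorem extD_eq_neg_bracket {U : Set N} (hU : IsOpen U)
    {α : ∀ x : N, TangentSpace (𝓡 7) x →L[ℝ] ℝ} (hα : SmoothFormOn U α) {x : N} (hx : x ∈ U)
    {X Y : ∀ x : N, TangentSpace (𝓡 7) x} (hX : DiffFieldAt X x) (hY : DiffFieldAt Y x) {a b : ℝ}
    (ha : ∀ᶠ y in 𝓝 x, α y (X y) = a) (hb : ∀ᶠ y in 𝓝 x, α y (Y y) = b) :
    extD α x (X x) (Y x) = - α x (mlieBracket (𝓡 7) X Y x) := by
  rw [extD_apply_fields hU hα hx hX hY, mvfderiv_eq_zero_of_eventually_const ha,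
    mvfderiv_eq_zero_of_eventually_const hb]
  simp

theorem IsOrientedDistribution.isDistribution {k : ℕ}
    {D : ∀ x : N, Submodule ℝ (TangentSpace (𝓡 7) x)}
    {o : ∀ x : N, Orientation ℝ (D x) (Fin k)} (h : IsOrientedDistribution k D o) :
    IsDistribution k D := fun x₀ => by
  obtain ⟨U, X, hU, hx, hX, hb⟩ := h x₀
  exact ⟨U, X, hU, hx, hX, fun x hx => (hb x hx).imp fun b hb => hb.1⟩

theorem IsDistribution.exists_extension {k : ℕ} {D : ∀ x : N, Submodule ℝ (TangentSpace (𝓡 7) x)}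
    (h : IsDistribution k D) (x : N) (v : D x) :
    ∃ (U : Set N) (X : ∀ y : N, D y), IsOpen U ∧ x ∈ U ∧
      SmoothFieldOn U (fun y => (X y : TangentSpace (𝓡 7) y)) ∧ X x = v := by
  obtain ⟨U, X, hU, hx, hX, hb⟩ := h x
  obtain ⟨b, hb⟩ := hb x hx
  refine ⟨U, fun y => ∑ i, b.repr v i • X i y, hU, hx, ?_, ?_⟩
  · have := SmoothFieldOn.sum (ι := Fin k) (U := U)
      (X := fun i y => b.repr v i • (X i y : TangentSpace (𝓡 7) y))
      (fun i => SmoothFieldOn.smul (f := fun _ => b.repr v i) contMDiffOn_const (hX i))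
    refine this.congr fun y _ => ?_
    simp
  · simp only [← hb]
    exact b.sum_repr v

theorem IsDistribution.finrank_eq {k : ℕ} {D : ∀ x : N, Submodule ℝ (TangentSpace (𝓡 7) x)}
    (h : IsDistribution k D) (x : N) : Module.finrank ℝ (D x) = k := by
  obtain ⟨U, X, hU, hx, hX, hb⟩ := h x
  obtain ⟨b, hb⟩ := hb x hx
  rw [Module.finrank_eq_card_basis b, Fintype.card_fin]

/-- If a form vanishes on `D`, and vanishes at `x`, then its differential vanishes on `D_x`. -/
theorem extD_eq_zero_of_vanish {k : ℕ} {D : ∀ x : N, Submodule ℝ (TangentSpace (𝓡 7) x)}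
    (h : IsDistribution k D) {U : Set N} (hU : IsOpen U)
    {α : ∀ x : N, TangentSpace (𝓡 7) x →L[ℝ] ℝ} (hα : SmoothFormOn U α)
    (hv : ∀ y ∈ U, ∀ X ∈ D y, α y X = 0) {x : N} (hx : x ∈ U) (hαx : α x = 0) (X Y : D x) :
    extD α x (X : TangentSpace (𝓡 7) x) (Y : TangentSpace (𝓡 7) x) = 0 := by
  obtain ⟨V, X', hV, hxV, hX', rfl⟩ := h.exists_extension x X
  obtain ⟨W, Y', hW, hxW, hY', rfl⟩ := h.exists_extension x Y
  have hnear : ∀ Z : ∀ y : N, D y, ∀ᶠ y in 𝓝 x, α y (Z y) = 0 := fun Z =>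
    Filter.mem_of_superset (hU.mem_nhds hx) fun y hy => hv y hy _ (Z y).2
  have := extD_eq_neg_bracket hU hα hx (hX'.diffFieldAt hV hxV) (hY'.diffFieldAt hW hxW)
    (hnear X') (hnear Y')
  rw [this, hαx]
  simp

/-! ### Smooth matrices -/

theorem smoothFnOn_det {n : Type*} [Fintype n] [DecidableEq n] {U : Set N}
    {M : N → Matrix n n ℝ} (hM : ∀ i j, SmoothFnOn U (fun x => M x i j)) :
    SmoothFnOn U (fun x => (M x).det) := by
  simp only [Matrix.det_apply']
  intro x hx
  refine ContMDiffWithinAt.sum fun σ _ => ?_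
  refine contMDiffWithinAt_const.mul ?_
  exact contMDiffWithinAt_finsetProd fun i _ => hM _ _ x hx

/-- The entries of the inverse of a smooth matrix are smooth, by Cramer's rule. -/
theorem smoothFnOn_inv {n : Type*} [Fintype n] [DecidableEq n] {U : Set N}
    {M : N → Matrix n n ℝ} (hM : ∀ i j, SmoothFnOn U (fun x => M x i j))
    (hdet : ∀ x ∈ U, (M x).det ≠ 0) (i j : n) : SmoothFnOn U (fun x => (M x)⁻¹ i j) := by
  have h1 : SmoothFnOn U (fun x => ((M x).updateRow j (Pi.single i 1)).det) := by
    apply smoothFnOn_det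
    intro k l
    by_cases hk : k = j
    · subst hk
      simpa using contMDiffOn_const
    · simpa [Matrix.updateRow_ne hk] using hM k l
  have h2 : SmoothFnOn U (fun x => ((M x).det)⁻¹) := (smoothFnOn_det hM).inv₀ hdet
  refine ContMDiffOn.congr (h2.mul h1) fun x _ => ?_
  simp [Matrix.inv_def, Matrix.adjugate_apply]

theorem exists_open_det_ne_zero {n : Type*} [Fintype n] [DecidableEq n] {U : Set N} (hU : IsOpen U)
    {M : N → Matrix n n ℝ} (hM : ∀ i j, SmoothFnOn U (fun x => M x i j)) {x₀ : N} (hx₀ : x₀ ∈ U)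
    (h0 : (M x₀).det ≠ 0) :
    ∃ V ⊆ U, IsOpen V ∧ x₀ ∈ V ∧ ∀ x ∈ V, (M x).det ≠ 0 := by
  have h1 := (ContMDiffOn.continuousOn (smoothFnOn_det hM)).isOpen_inter_preimage hU
    (isOpen_compl_singleton (x := (0 : ℝ)))
  exact ⟨_, Set.inter_subset_left, h1, ⟨hx₀, h0⟩, fun x hx => hx.2⟩

/-- Vector fields `V_i` for which the matrix `η_j(V_i)` is invertible at a point can be combined,
near this point, to a frame dual to `(η_j)`. -/
theorem exists_dual_fields {n : Type*} [Fintype n] [DecidableEq n] {U : Set N} (hU : IsOpen U)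
    {η : n → ∀ x : N, TangentSpace (𝓡 7) x →L[ℝ] ℝ} (hη : ∀ j, SmoothFormOn U (η j))
    {X : n → ∀ x : N, TangentSpace (𝓡 7) x} (hX : ∀ i, SmoothFieldOn U (X i)) {x₀ : N}
    (hx₀ : x₀ ∈ U) (h0 : (Matrix.of fun i j => η j x₀ (X i x₀)).det ≠ 0) :
    ∃ V ⊆ U, IsOpen V ∧ x₀ ∈ V ∧ ∃ A : N → Matrix n n ℝ,
      (∀ i, SmoothFieldOn V (fun x => ∑ k, A x i k • X k x)) ∧
      ∀ x ∈ V, ∀ i j, η j x (∑ k, A x i k • X k x) = if i = j then 1 else 0 := by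
  let M : N → Matrix n n ℝ := fun x => Matrix.of fun i j => η j x (X i x)
  have hM : ∀ i j, SmoothFnOn U (fun x => M x i j) := fun i j => (hη j).apply (hX i)
  obtain ⟨V, hVU, hV, hxV, hdet⟩ := exists_open_det_ne_zero hU hM hx₀ h0
  refine ⟨V, hVU, hV, hxV, fun x => (M x)⁻¹, fun i => ?_, fun x hx i j => ?_⟩
  · refine SmoothFieldOn.sum fun k => SmoothFieldOn.smul ?_ ((hX k).mono hVU)
    exact smoothFnOn_inv (fun i j => (hM i j).mono hVU) hdet i k
  · have e := Matrix.nonsing_inv_mul (M x) (isUnit_iff_ne_zero.2 (hdet x hx))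
    have e2 := congrFun (congrFun e i) j
    rw [Matrix.mul_apply, Matrix.one_apply] at e2
    rw [← e2, map_sum]
    refine Finset.sum_congr rfl fun k _ => ?_
    rw [map_smul]
    rfl

end Tensor

/-! ### Self-dual forms and quaternions -/

section QuaternionTriple

variable {V : Type*} [AddCommGroup V] [Module ℝ V]

/-- The quaternionic structure attached to a basis `e₀, e₁, e₂, e₃`, identified with the basis
`1, i, j, k` of the quaternions: left multiplication by `i`, `j`, `k`. -/
noncomputable def quaternionTriple (e : Module.Basis (Fin 4) ℝ V) : Fin 3 → (V →ₗ[ℝ] V) :=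
  ![e.constr ℝ ![e 1, -e 0, e 3, -e 2], e.constr ℝ ![e 2, -e 3, -e 0, e 1],
    e.constr ℝ ![e 3, e 2, -e 1, -e 0]]

theorem quaternionTriple_basis (e : Module.Basis (Fin 4) ℝ V) (k : Fin 3) (j : Fin 4) :
    quaternionTriple e k (e j) = (![![e 1, -e 0, e 3, -e 2], ![e 2, -e 3, -e 0, e 1],
      ![e 3, e 2, -e 1, -e 0]] : Fin 3 → Fin 4 → V) k j := by
  fin_cases k <;> exact e.constr_basis ℝ _ j

theorem isQuaternionic_quaternionTriple (e : Module.Basis (Fin 4) ℝ V) :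
    IsQuaternionic (quaternionTriple e) := by
  refine ⟨fun i => e.ext fun j => ?_, e.ext fun j => ?_, e.ext fun j => ?_⟩
  · fin_cases i <;> fin_cases j <;> simp [quaternionTriple_basis]
  all_goals fin_cases j <;> simp [quaternionTriple_basis]

/-- A self-dual form is determined by its values on `(e₀, e_k)`. -/
theorem selfDual_eq_sum {g w : LinearMap.BilinForm ℝ V} {e : Module.Basis (Fin 4) ℝ V}
    (he : ∀ i j, g (e i) (e j) = if i = j then 1 else 0) (hw : w.IsAlt)
    (h1 : w (e 0) (e 1) = w (e 2) (e 3)) (h2 : w (e 0) (e 2) = - w (e 1) (e 3))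
    (h3 : w (e 0) (e 3) = w (e 1) (e 2)) :
    w = ∑ k : Fin 3, w (e 0) (e k.succ) • (g ∘ₗ quaternionTriple e k) := by
  have hs : ∀ i j, w (e i) (e j) = - w (e j) (e i) := fun i j => (hw.neg_eq (e j) (e i)).symm
  have h0 : ∀ i, w (e i) (e i) = 0 := fun i => hw (e i)
  refine e.ext fun i => e.ext fun j => ?_
  have s1 := hs 1 0
  have s2 := hs 2 0
  have s3 := hs 3 0
  have s4 := hs 2 1
  have s5 := hs 3 1
  have s6 := hs 3 2
  have h2' : w (e 1) (e 3) = - w (e 0) (e 2) := by rw [h2, neg_neg]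
  fin_cases i <;> fin_cases j <;>
    simp [quaternionTriple_basis, Fin.sum_univ_three, he, h0, s1, s2, s3, s4,
      s5, s6, ← h1, h2', ← h3]

theorem linearIndependent_of_orthonormal {n : ℕ} {g : LinearMap.BilinForm ℝ V} {e : Fin n → V}
    (he : ∀ i j, g (e i) (e j) = if i = j then 1 else 0) : LinearIndependent ℝ e := by
  rw [Fintype.linearIndependent_iff]
  intro c hc i
  have := congrArg (fun v => g v (e i)) hc
  simpa [he] using this

/-- A space of dimension `n` contained in the span of `n` vectors contains these vectors. -/
theorem mem_of_finrank_eq_card {n : ℕ} {P : Submodule ℝ V} {v : Fin n → V}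
    (hle : P ≤ Submodule.span ℝ (Set.range v)) (hP : Module.finrank ℝ P = n) (k : Fin n) :
    v k ∈ P := by
  have : FiniteDimensional ℝ (Submodule.span ℝ (Set.range v)) :=
    FiniteDimensional.span_of_finite ℝ (Set.finite_range v)
  have : P = Submodule.span ℝ (Set.range v) := by
    refine Submodule.eq_of_le_of_finrank_le hle ?_
    rw [hP]
    exact (finrank_range_le_card (R := ℝ) v).trans (by simp)
  rw [this]
  exact Submodule.subset_span ⟨k, rfl⟩

/-- A three-dimensional space of self-dual forms contains the forms `g(I_k ·, ·)` attached to an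
oriented orthonormal basis, because these span a space containing all self-dual forms. -/
theorem comp_quaternionTriple_mem {g : LinearMap.BilinForm ℝ V} {o : Orientation ℝ V (Fin 4)}
    {P : Submodule ℝ (LinearMap.BilinForm ℝ V)} (hP : Module.finrank ℝ P = 3)
    (hsd : ∀ w ∈ P, IsSelfDual g o w) {e : Module.Basis (Fin 4) ℝ V} (ho : e.orientation = o)
    (he : ∀ i j, g (e i) (e j) = if i = j then 1 else 0) (k : Fin 3) :
    (g ∘ₗ quaternionTriple e k : LinearMap.BilinForm ℝ V) ∈ P := by
  let v : Fin 3 → LinearMap.BilinForm ℝ V := fun k => g ∘ₗ quaternionTriple e k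
  have hle : P ≤ Submodule.span ℝ (Set.range v) := fun w hw => by
    obtain ⟨hw1, hw2⟩ := hsd w hw
    obtain ⟨h1, h2, h3⟩ := hw2 e ho he
    have h4 : w = ∑ k : Fin 3, w (e 0) (e k.succ) • v k := selfDual_eq_sum he hw1 h1 h2 h3
    rw [h4]
    exact Submodule.sum_mem _ fun k _ => Submodule.smul_mem _ _
      (Submodule.subset_span (Set.mem_range_self k))
  exact mem_of_finrank_eq_card (V := LinearMap.BilinForm ℝ V) (v := v) hle (by convert hP) k

theorem IsSelfDual.add {g w w' : LinearMap.BilinForm ℝ V} {o : Orientation ℝ V (Fin 4)}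
    (h : IsSelfDual g o w) (h' : IsSelfDual g o w') : IsSelfDual g o (w + w') := by
  refine ⟨h.1.add h'.1, fun e ho he => ?_⟩
  obtain ⟨a, b, c⟩ := h.2 e ho he
  obtain ⟨a', b', c'⟩ := h'.2 e ho he
  simp only [LinearMap.add_apply]
  exact ⟨by rw [a, a'], by rw [b, b']; ring, by rw [c, c']⟩

theorem IsSelfDual.smul {g w : LinearMap.BilinForm ℝ V} {o : Orientation ℝ V (Fin 4)}
    (h : IsSelfDual g o w) (t : ℝ) : IsSelfDual g o (t • w) := by
  refine ⟨h.1.smul t, fun e ho he => ?_⟩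
  obtain ⟨a, b, c⟩ := h.2 e ho he
  simp only [LinearMap.smul_apply]
  exact ⟨by rw [a], by rw [b, smul_neg], by rw [c]⟩

end QuaternionTriple

/-! ### Existence of admissible frames -/

section Frames

open scoped Topology Bundle
open VectorField

variable {N : Type*} [TopologicalSpace N] [ChartedSpace E7 N] [IsManifold (𝓡 7) ∞ N]
  {Q : QCStructure N}

theorem CompatibleMetric.nondegenerate (g : CompatibleMetric Q) {x : N} {X : Q.H x}
    (h : ∀ Y, g.inner x X Y = 0) : X = 0 := by
  by_contra hne
  exact (g.pos x X hne).ne' (h X)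

/-- Gram–Schmidt orthonormalization; the change of frame is triangular with positive diagonal
entries, hence preserves the orientation. -/
theorem CompatibleMetric.exists_orthonormal (g : CompatibleMetric Q) {U : Set N} (hU : IsOpen U) :
    ∀ (n : ℕ) (X : Fin n → ∀ x : N, Q.H x),
      (∀ i, SmoothFieldOn U (fun x => (X i x : TangentSpace (𝓡 7) x))) →
      (∀ x ∈ U, LinearIndependent ℝ (fun i => X i x)) →
      ∃ E : Fin n → ∀ x : N, Q.H x,
        (∀ i, SmoothFieldOn U (fun x => (E i x : TangentSpace (𝓡 7) x))) ∧
        ∀ x ∈ U, (∀ i j, g.inner x (E i x) (E j x) = if i = j then 1 else 0) ∧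
          ∃ T : Matrix (Fin n) (Fin n) ℝ, (∀ i j, i < j → T i j = 0) ∧ (∀ i, 0 < T i i) ∧
            ∀ i, E i x = ∑ j, T i j • X j x := by
  intro n
  induction n with
  | zero =>
    intro X _ _
    exact ⟨X, fun i => i.elim0, fun x _ => ⟨fun i => i.elim0, 1, fun i => i.elim0,
      fun i => i.elim0, fun i => i.elim0⟩⟩
  | succ n ih =>
    intro X hX hli
    obtain ⟨E, hE, hEx⟩ := ih (fun i => X i.castSucc) (fun i => hX _)
      (fun x hx => (hli x hx).comp _ (Fin.castSucc_injective n))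
    -- the component of the last vector orthogonal to the vectors before it
    let Y : ∀ x : N, Q.H x := fun x =>
      X (Fin.last n) x - ∑ i, g.inner x (X (Fin.last n) x) (E i x) • E i x
    have hY : SmoothFieldOn U (fun x => (Y x : TangentSpace (𝓡 7) x)) := by
      have := (hX (Fin.last n)).sub (SmoothFieldOn.sum fun i =>
        SmoothFieldOn.smul (g.smooth U _ _ hU (hX (Fin.last n)) (hE i)) (hE i))
      refine this.congr fun x _ => ?_
      simp [Y]
    have hYE : ∀ x ∈ U, ∀ i, g.inner x (Y x) (E i x) = 0 := fun x hx i => by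
      simp [Y, (hEx x hx).1]
    have hY0 : ∀ x ∈ U, Y x ≠ 0 := by
      intro x hx h0
      obtain ⟨-, T, -, -, hT⟩ := hEx x hx
      have h1 : X (Fin.last n) x ∈
          Submodule.span ℝ (Set.range fun i : Fin n => X i.castSucc x) := by
        rw [sub_eq_zero.1 h0]
        refine Submodule.sum_mem _ fun i _ => Submodule.smul_mem _ _ ?_
        rw [hT]
        exact Submodule.sum_mem _ fun j _ => Submodule.smul_mem _ _
          (Submodule.subset_span ⟨j, rfl⟩)
      have h2 := hli x hx
      rw [← Fin.snoc_init_self (fun i => X i x), linearIndependent_finSnoc] at h2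
      exact h2.2 h1
    let c : N → ℝ := fun x => (√(g.inner x (Y x) (Y x)))⁻¹
    have hpos : ∀ x ∈ U, 0 < g.inner x (Y x) (Y x) := fun x hx => g.pos x _ (hY0 x hx)
    have hc : SmoothFnOn U c := by
      intro x hx
      have h1 : ContMDiffWithinAt (𝓡 7) 𝓘(ℝ, ℝ) ∞ (fun x => g.inner x (Y x) (Y x)) U x :=
        g.smooth U _ _ hU hY hY x hx
      have h2 : ContDiffAt ℝ ∞ (fun t : ℝ => (√t)⁻¹) (g.inner x (Y x) (Y x)) :=
        (Real.contDiffAt_sqrt (hpos x hx).ne').inv (Real.sqrt_pos.2 (hpos x hx)).ne'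
      exact ContMDiffAt.comp_contMDiffWithinAt (g := fun t : ℝ => (√t)⁻¹) x h2.contMDiffAt h1
    have hcpos : ∀ x ∈ U, 0 < c x := fun x hx => inv_pos.2 (Real.sqrt_pos.2 (hpos x hx))
    have hcc : ∀ x ∈ U, c x * (c x * g.inner x (Y x) (Y x)) = 1 := fun x hx => by
      have h1 := Real.mul_self_sqrt (hpos x hx).le
      have h2 := (Real.sqrt_pos.2 (hpos x hx)).ne'
      simp only [c]
      nth_rewrite 3 [← h1]
      field_simp
    refine ⟨Fin.snoc (α := fun _ => ∀ x : N, Q.H x) E (fun x => c x • Y x), ?_,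
      fun x hx => ⟨?_, ?_⟩⟩
    · intro i
      refine Fin.lastCases ?_ (fun i => ?_) i
      · simp only [Fin.snoc_last]
        exact (SmoothFieldOn.smul hc hY)
      · simp only [Fin.snoc_castSucc]
        exact hE i
    · have hsymm := g.symm x
      intro i j
      refine Fin.lastCases ?_ (fun i => ?_) i <;> refine Fin.lastCases ?_ (fun j => ?_) j
      · simp only [Fin.snoc_last, map_smul, LinearMap.smul_apply, smul_eq_mul, if_true]
        exact hcc x hx
      · simp [hYE x hx, (Fin.castSucc_lt_last j).ne']
      · rw [hsymm]
        simp [hYE x hx, (Fin.castSucc_lt_last i).ne]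
      · simp [(hEx x hx).1]
    · obtain ⟨-, T, hT0, hTp, hT⟩ := hEx x hx
      refine ⟨Matrix.of (Fin.snoc (α := fun _ => Fin (n + 1) → ℝ)
        (fun i => Fin.snoc (α := fun _ => ℝ) (T i) 0)
        (Fin.snoc (α := fun _ => ℝ)
          (fun k => - (c x * ∑ i, g.inner x (X (Fin.last n) x) (E i x) * T i k)) (c x))),
        ?_, ?_, ?_⟩
      · intro i j
        refine Fin.lastCases ?_ (fun i => ?_) i <;> refine Fin.lastCases ?_ (fun j => ?_) j
        · simp
        · intro h
          exact absurd h (Fin.castSucc_lt_last j).not_gt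
        · simp
        · intro h
          simpa using hT0 i j (by simpa using h)
      · intro i
        refine Fin.lastCases ?_ (fun i => ?_) i
        · simpa using hcpos x hx
        · simpa using hTp i
      · intro i
        refine Fin.lastCases ?_ (fun i => ?_) i
        · simp only [Fin.snoc_last, Fin.sum_univ_castSucc, Matrix.of_apply, Fin.snoc_castSucc, Y]
          rw [smul_sub, sub_eq_neg_add, add_left_inj, Finset.smul_sum, ← Finset.sum_neg_distrib]
          have : ∀ i, E i x = ∑ j, T i j • X j.castSucc x := hT
          calc ∑ i, -(c x • g.inner x (X (Fin.last n) x) (E i x) • E i x)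
              = ∑ i, ∑ k, (-(c x * (g.inner x (X (Fin.last n) x) (E i x) * T i k))) •
                  X k.castSucc x := by
                refine Finset.sum_congr rfl fun i _ => ?_
                conv_lhs => rw [show c x • g.inner x (X (Fin.last n) x) (E i x) • E i x =
                  c x • g.inner x (X (Fin.last n) x) (E i x) • ∑ j, T i j • X j.castSucc x by
                    rw [← this]]
                rw [Finset.smul_sum, Finset.smul_sum, ← Finset.sum_neg_distrib]
                refine Finset.sum_congr rfl fun k _ => ?_
                module
            _ = _ := by
                rw [Finset.sum_comm]
                refine Finset.sum_congr rfl fun k _ => ?_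
                rw [← Finset.sum_smul, Finset.mul_sum, Finset.sum_neg_distrib]
        · simp [Fin.sum_univ_castSucc, hT]

/-- Local smooth oriented orthonormal frames of `H`. -/
theorem CompatibleMetric.exists_oriented_orthonormal (g : CompatibleMetric Q) (x₀ : N) :
    ∃ (U : Set N) (E : Fin 4 → ∀ x : N, Q.H x), IsOpen U ∧ x₀ ∈ U ∧
      (∀ i, SmoothFieldOn U (fun x => (E i x : TangentSpace (𝓡 7) x))) ∧
      ∀ x ∈ U, ∃ e : Module.Basis (Fin 4) ℝ (Q.H x), (∀ i, e i = E i x) ∧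
        e.orientation = Q.orient x ∧ ∀ i j, g.inner x (e i) (e j) = if i = j then 1 else 0 := by
  obtain ⟨U, X, hU, hx₀, hX, hb⟩ := Q.oriented x₀
  obtain ⟨E, hE, hEx⟩ := g.exists_orthonormal hU 4 X hX (fun x hx => by
    obtain ⟨b, hb, -⟩ := hb x hx
    simpa only [← hb] using b.linearIndependent)
  refine ⟨U, E, hU, hx₀, hE, fun x hx => ?_⟩
  obtain ⟨hon, T, hT0, hTp, hT⟩ := hEx x hx
  obtain ⟨b, hb, ho⟩ := hb x hx
  let e := basisOfLinearIndependentOfCardEqFinrank (linearIndependent_of_orthonormal hon)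
    (Module.finrank_eq_card_basis b).symm
  have he : ∀ i, e i = E i x := fun i => by simp [e]
  refine ⟨e, he, ?_, by simpa only [he] using hon⟩
  rw [← ho, eq_comm, Module.Basis.orientation_eq_iff_det_pos, Module.Basis.det_apply]
  have h1 : b.toMatrix e = T.transpose := by
    ext i j
    rw [Module.Basis.toMatrix_apply, he, hT]
    simp [← hb, Finsupp.single_apply]
  rw [h1, Matrix.det_transpose, Matrix.det_of_isLowerTriangular T (fun i j hij => hT0 i j hij)]
  exact Finset.prod_pos fun i _ => hTp i

/-- The forms `dη|_H` at a point make up a linear subspace, being the self-dual forms. -/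
theorem mem_leviForms_of_mem_span (g : CompatibleMetric Q) {x : N}
    {w : LinearMap.BilinForm ℝ (Q.H x)} (hw : w ∈ Submodule.span ℝ (leviForms Q.H x)) :
    w ∈ leviForms Q.H x := by
  rw [g.selfDual]
  induction hw using Submodule.span_induction with
  | mem w h => exact (g.selfDual x w).1 h
  | zero => exact ⟨fun _ => rfl, by simp⟩
  | add w w' _ _ h h' => exact h.add h'
  | smul t w _ h => exact h.smul t

theorem comp_quaternionTriple_mem_leviForms (g : CompatibleMetric Q) {x : N}
    (e : Module.Basis (Fin 4) ℝ (Q.H x)) (ho : e.orientation = Q.orient x)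
    (he : ∀ i j, g.inner x (e i) (e j) = if i = j then 1 else 0) (k : Fin 3) :
    (g.inner x ∘ₗ quaternionTriple e k : LinearMap.BilinForm ℝ (Q.H x)) ∈ leviForms Q.H x :=
  mem_leviForms_of_mem_span g (comp_quaternionTriple_mem (P := Submodule.span ℝ (leviForms Q.H x))
    (Q.rank_three x) (fun _ hw => (g.selfDual x _).1 (mem_leviForms_of_mem_span g hw)) ho he k)

theorem SmoothFormOn.sum_smul {ι : Type*} [Fintype ι] {U : Set N} (hU : IsOpen U)
    {f : ι → N → ℝ} {α : ι → ∀ x : N, TangentSpace (𝓡 7) x →L[ℝ] ℝ}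
    (hf : ∀ j, SmoothFnOn U (f j)) (hα : ∀ j, SmoothFormOn U (α j)) :
    SmoothFormOn U (fun x => ∑ j, f j x • α j x) := by
  refine smoothFormOn_of_apply hU fun V X hV hVU hX => ?_
  have : SmoothFnOn V (fun x => ∑ j, f j x * α j x (X x)) := fun x hx =>
    ContMDiffWithinAt.sum fun j _ =>
      (((hf j).mono hVU) x hx).mul ((((hα j).mono hVU).apply hX) x hx)
  refine ContMDiffOn.congr this fun x _ => ?_
  simp

/-- Near every point there is an admissible frame for which the complex structures have constant
coefficients in a smooth oriented orthonormal frame `E` of `H`.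

The forms `g(I_k ·, ·)` given by the frame are self-dual, so at `x₀` they are the `dα_k|_H` of
one-forms `α_k` vanishing on `H`. Near `x₀`, `dα_j|_H = ∑ k, B j k g(I_k ·, ·)` with `B` smooth and
`B(x₀) = 1`, and the forms `η = B⁻¹ α` are as required, since `dη|_H = B⁻¹ dα|_H`. -/
theorem CompatibleMetric.exists_admissibleFrame (g : CompatibleMetric Q) (x₀ : N) :
    ∃ (U : Set N) (E : Fin 4 → ∀ x : N, Q.H x) (θ : AdmissibleFrame g U), IsOpen U ∧ x₀ ∈ U ∧
      (∀ i, SmoothFieldOn U (fun x => (E i x : TangentSpace (𝓡 7) x))) ∧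
      ∀ x ∈ U, ∃ e : Module.Basis (Fin 4) ℝ (Q.H x), (∀ i, e i = E i x) ∧
        (∀ i j, g.inner x (e i) (e j) = if i = j then 1 else 0) ∧
        ∀ i, θ.I i x = quaternionTriple e i := by
  classical
  obtain ⟨U, E, hU, hx₀, hE, he⟩ := g.exists_oriented_orthonormal x₀
  have hne : ∀ x, Nonempty (Module.Basis (Fin 4) ℝ (Q.H x)) := fun x => by
    obtain ⟨_, _, _, hx, _, hb⟩ := Q.oriented x
    exact ⟨(hb x hx).choose⟩
  choose! e heE ho hon using he
  have hlevi := fun k => comp_quaternionTriple_mem_leviForms g (e x₀) (ho x₀ hx₀) (hon x₀ hx₀) k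
  choose V α hV hxV hα hαH hαd using hlevi
  let W : Set N := U ∩ ⋂ k, V k
  have hW : IsOpen W := hU.inter (isOpen_iInter_of_finite hV)
  have hxW : x₀ ∈ W := ⟨hx₀, Set.mem_iInter.2 hxV⟩
  have hWU : W ⊆ U := Set.inter_subset_left
  have hWV : ∀ k, W ⊆ V k := fun k => Set.inter_subset_right.trans (Set.iInter_subset _ k)
  have hαW : ∀ k, SmoothFormOn W (α k) := fun k => (hα k).mono (hWV k)
  have hvan : ∀ k, ∀ x ∈ W, ∀ X ∈ Q.H x, α k x X = 0 := fun k x hx => hαH k x (hWV k hx)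
  let B : N → Matrix (Fin 3) (Fin 3) ℝ := fun x => Matrix.of fun j k =>
    extD (α j) x (E 0 x : TangentSpace (𝓡 7) x) (E k.succ x : TangentSpace (𝓡 7) x)
  have hB : ∀ j k, SmoothFnOn W (fun x => B x j k) := fun j k =>
    (hαW j).smoothFnOn_extD hW ((hE 0).mono hWU) ((hE k.succ).mono hWU)
  have hBd : ∀ j, ∀ x ∈ W, ∀ X Y : Q.H x, extD (α j) x (X : TangentSpace (𝓡 7) x)
      (Y : TangentSpace (𝓡 7) x) = ∑ k, B x j k * g.inner x (quaternionTriple (e x) k X) Y := by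
    intro j x hx X Y
    let w : LinearMap.BilinForm ℝ (Q.H x) := (extDBilin (α j) x).restrict (Q.H x)
    have hw : ∀ X Y : Q.H x, w X Y = extD (α j) x (X : TangentSpace (𝓡 7) x)
      (Y : TangentSpace (𝓡 7) x) := fun X Y => extDBilin_apply _ _ _ _
    obtain ⟨h0, hsd⟩ := (g.selfDual x w).1 ⟨W, α j, hW, hx, hαW j, hvan j, hw⟩
    obtain ⟨h1, h2, h3⟩ := hsd (e x) (ho x (hWU hx)) (hon x (hWU hx))
    rw [← hw, selfDual_eq_sum (hon x (hWU hx)) h0 h1 h2 h3]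
    simp only [LinearMap.sum_apply, LinearMap.smul_apply, smul_eq_mul, LinearMap.comp_apply]
    refine Finset.sum_congr rfl fun k _ => ?_
    rw [hw, heE x (hWU hx), heE x (hWU hx)]
    rfl
  have hB0 : B x₀ = 1 := by
    ext j k
    have h1 := hαd j (E 0 x₀) (E k.succ x₀)
    change extD (α j) x₀ (E 0 x₀ : TangentSpace (𝓡 7) x₀) (E k.succ x₀ : TangentSpace (𝓡 7) x₀) = _
    rw [← h1, ← heE x₀ hx₀, ← heE x₀ hx₀]
    have h2 := hon x₀ hx₀
    fin_cases j <;> fin_cases k <;> simp [quaternionTriple_basis, h2]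
  obtain ⟨O, hOW, hO, hxO, hdet⟩ := exists_open_det_ne_zero hW hB hxW (by rw [hB0]; simp)
  have hA : ∀ i j, SmoothFnOn O (fun x => (B x)⁻¹ i j) :=
    smoothFnOn_inv (fun i j => (hB i j).mono hOW) hdet
  have hsm : ∀ i, SmoothFormOn O (fun x => ∑ j, (B x)⁻¹ i j • α j x) := fun i =>
    SmoothFormOn.sum_smul hO (hA i) fun j => (hαW j).mono hOW
  refine ⟨O, E, ⟨fun i x => ∑ j, (B x)⁻¹ i j • α j x, fun i x => quaternionTriple (e x) i, hsm,
    ?_, fun x _ => isQuaternionic_quaternionTriple (e x), ?_⟩, hO, hxO,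
    fun i => (hE i).mono (hOW.trans hWU), fun x hx => ⟨e x, heE x (hWU (hOW hx)),
    hon x (hWU (hOW hx)), fun i => rfl⟩⟩
  · intro i x hx X hX
    simp [fun j => hvan j x (hOW hx) X hX]
  · intro i x hx X Y
    rw [extD_sum_smul hO (hsm i) (fun j => (hαW j).mono hOW) (hA i)
      (fun x _ v => by simp) hx]
    have h0 := fun j => hvan j x (hOW hx) X X.2
    have h0' := fun j => hvan j x (hOW hx) Y Y.2
    simp only [h0, h0', mul_zero, sub_zero, add_zero, hBd _ x (hOW hx), Finset.mul_sum]
    rw [Finset.sum_comm]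
    have e := Matrix.nonsing_inv_mul (B x) (isUnit_iff_ne_zero.2 (hdet x hx))
    have e2 : ∀ k, ∑ j, (B x)⁻¹ i j * B x j k = if i = k then 1 else 0 := fun k => by
      have := congrFun (congrFun e i) k
      rwa [Matrix.mul_apply, Matrix.one_apply] at this
    simp only [← mul_assoc, ← Finset.sum_mul, e2]
    simp

end Frames

/-! ### The covectors `i_{R_i} dη_j|_H + i_{R_j} dη_i|_H` -/

section VerticalForm

open scoped Topology Bundle
open VectorField

variable {N : Type*} [TopologicalSpace N] [ChartedSpace E7 N] [IsManifold (𝓡 7) ∞ N]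
  {Q : QCStructure N} {g g' : CompatibleMetric Q} {U U' : Set N}

theorem QCStructure.isDistribution (Q : QCStructure N) : IsDistribution 4 Q.H :=
  Q.oriented.isDistribution

theorem QCStructure.nontrivial (Q : QCStructure N) (x : N) : Nontrivial (Q.H x) :=
  Module.nontrivial_of_finrank_pos (R := ℝ) (by rw [Q.isDistribution.finrank_eq x]; norm_num)

namespace AdmissibleFrame

/-- The restriction of an admissible frame to a smaller set. -/
def restrict (θ : AdmissibleFrame g U) {V : Set N} (hV : V ⊆ U) : AdmissibleFrame g V where
  η := θ.η
  I := θ.I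
  smooth i := (θ.smooth i).mono hV
  vanish i x hx := θ.vanish i x (hV hx)
  quaternionic x hx := θ.quaternionic x (hV hx)
  d_eq i x hx := θ.d_eq i x (hV hx)

theorem inner_I_left (θ : AdmissibleFrame g U) {x : N} (hx : x ∈ U) (i : Fin 3) (X Y : Q.H x) :
    g.inner x (θ.I i x X) Y = - g.inner x X (θ.I i x Y) := by
  rw [← θ.d_eq i x hx, extD_swap, θ.d_eq i x hx, g.symm]

/-- The forms of an admissible frame are pointwise independent: if `∑ c_i η_i` vanishes at `x`, then
so does `∑ c_i dη_i|_H`, hence `∑ c_i I_i = 0`, whose square is `-∑ c_i²`. -/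
theorem eq_zero_of_sum_eq_zero (θ : AdmissibleFrame g U) (hU : IsOpen U) {x : N} (hx : x ∈ U)
    {c : Fin 3 → ℝ} (hc : ∀ v, ∑ i, c i * θ.η i x v = 0) : c = 0 := by
  have hsm : SmoothFormOn U (fun x => ∑ i, c i • θ.η i x) :=
    SmoothFormOn.sum_smul hU (f := fun i _ => c i) (fun i => contMDiffOn_const) θ.smooth
  have h1 := fun X Y => extD_eq_zero_of_vanish Q.isDistribution hU hsm
    (fun y hy X hX => by simp [fun i => θ.vanish i y hy X hX]) hx
    (by ext v; simpa using hc v) X Y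
  have h2 : ∀ X Y : Q.H x, ∑ i, c i * g.inner x (θ.I i x X) Y = 0 := fun X Y => by
    have := h1 X Y
    rw [extD_sum_smul hU (η := θ.η) (f := fun i _ => c i) hsm θ.smooth
      (fun i => contMDiffOn_const) (fun y _ v => by simp) hx] at this
    simpa [fun i => θ.vanish i x hx X X.2, fun i => θ.vanish i x hx Y Y.2,
      fun i => θ.d_eq i x hx] using this
  have h3 : ∀ X, c 0 • θ.I 0 x X + c 1 • θ.I 1 x X + c 2 • θ.I 2 x X = 0 := fun X => by
    apply g.nondegenerate
    intro Y
    have := h2 X Y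
    rw [Fin.sum_univ_three] at this
    simpa using this
  have hI := θ.quaternionic x hx
  obtain ⟨X, hX⟩ := @exists_ne _ (Q.nontrivial x) (0 : Q.H x)
  have h4 : (c 0 ^ 2 + c 1 ^ 2 + c 2 ^ 2) • X = 0 := by
    have e0 := h3 X
    have e : c 0 • θ.I 0 x (c 0 • θ.I 0 x X + c 1 • θ.I 1 x X + c 2 • θ.I 2 x X)
      + c 1 • θ.I 1 x (c 0 • θ.I 0 x X + c 1 • θ.I 1 x X + c 2 • θ.I 2 x X)
      + c 2 • θ.I 2 x (c 0 • θ.I 0 x X + c 1 • θ.I 1 x X + c 2 • θ.I 2 x X) = 0 := by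
      rw [e0]; simp
    have s0 := fun i v => hI.sq i v
    have m01 := fun v => hI.mul_zero_one v
    have m10 := fun v => hI.mul_one_zero v
    have m02 := fun v => hI.mul_zero_two v
    have m12 := fun v => hI.mul_one_two v
    have m20 := fun v => hI.mul_two_zero v
    have m21 := fun v => hI.mul_two_one v
    simp only [map_add, map_smul] at e
    simp only [s0, m01, m10, m02, m12, m20, m21] at e
    rw [← neg_eq_zero, ← e]
    module
  have h5 := (smul_eq_zero.1 h4).resolve_right hX
  ext i
  fin_cases i <;> simp <;> nlinarith [sq_nonneg (c 0), sq_nonneg (c 1), sq_nonneg (c 2)]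

/-- The forms of an admissible frame take all triples of values on `T_xN`. -/
theorem surjective (θ : AdmissibleFrame g U) (hU : IsOpen U) {x : N} (hx : x ∈ U) :
    Function.Surjective
      (LinearMap.pi fun i => (θ.η i x : TangentSpace (𝓡 7) x →ₗ[ℝ] ℝ)) := by
  rw [← LinearMap.range_eq_top]
  by_contra hne
  obtain ⟨f, hf0, hf⟩ := Submodule.exists_le_ker_of_lt_top _ (lt_top_iff_ne_top.2 hne)
  apply hf0
  have hfc : ∀ c, f c = ∑ i, f (Pi.single i 1) * c i := fun c => by
    conv_lhs => rw [← Finset.univ_sum_single c, map_sum]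
    refine Finset.sum_congr rfl fun i _ => ?_
    rw [show Pi.single i (c i) = c i • (Pi.single i 1 : Fin 3 → ℝ) by
      rw [← Pi.single_smul, smul_eq_mul, mul_one], map_smul, smul_eq_mul, mul_comm]
  have h := θ.eq_zero_of_sum_eq_zero hU hx (c := fun i => f (Pi.single i 1)) (fun v => by
    have := hf (LinearMap.mem_range_self _ v)
    rw [LinearMap.mem_ker, hfc] at this
    exact this)
  refine LinearMap.ext fun c => ?_
  rw [hfc]
  have h' := fun i => congrFun h i
  simp only [Pi.zero_apply] at h'
  simp [h']

/-- `H` is the common kernel of the forms of an admissible frame. -/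
theorem mem_H_iff (θ : AdmissibleFrame g U) (hU : IsOpen U) {x : N} (hx : x ∈ U)
    {v : TangentSpace (𝓡 7) x} : v ∈ Q.H x ↔ ∀ i, θ.η i x v = 0 := by
  let Φ : TangentSpace (𝓡 7) x →ₗ[ℝ] (Fin 3 → ℝ) :=
    LinearMap.pi fun i => (θ.η i x : TangentSpace (𝓡 7) x →ₗ[ℝ] ℝ)
  have : FiniteDimensional ℝ (TangentSpace (𝓡 7) x) :=
    inferInstanceAs (FiniteDimensional ℝ E7)
  have h7 : Module.finrank ℝ (TangentSpace (𝓡 7) x) = 7 := finrank_euclideanSpace_fin (𝕜 := ℝ)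
  have h1 := Φ.finrank_range_add_finrank_ker
  rw [LinearMap.range_eq_top.2 (θ.surjective hU hx), finrank_top, Module.finrank_fin_fun, h7] at h1
  have hle : Q.H x ≤ LinearMap.ker Φ := fun v hv => by
    rw [LinearMap.mem_ker]
    ext i
    exact θ.vanish i x hx v hv
  have := Submodule.eq_of_le_of_finrank_le hle (by rw [Q.isDistribution.finrank_eq x]; omega)
  rw [this, LinearMap.mem_ker]
  exact ⟨fun h i => congrFun h i, fun h => funext h⟩

/-- `(u_i)` is a basis of a complement of `H_x`, dual to `(η_i)`. -/
def IsDualAt (θ : AdmissibleFrame g U) (x : N) (u : Fin 3 → TangentSpace (𝓡 7) x) : Prop :=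
  ∀ i j, θ.η j x (u i) = if i = j then 1 else 0

theorem exists_isDualAt (θ : AdmissibleFrame g U) (hU : IsOpen U) {x : N} (hx : x ∈ U) :
    ∃ u, θ.IsDualAt x u := by
  choose u hu using fun i : Fin 3 => θ.surjective hU hx (Pi.single i 1)
  refine ⟨u, fun i j => ?_⟩
  have := congrFun (hu i) j
  rw [Pi.single_apply] at this
  simp only [eq_comm (a := i)]
  exact this

theorem IsDualAt.sub_sum_mem {θ : AdmissibleFrame g U} (hU : IsOpen U) {x : N} (hx : x ∈ U)
    {u : Fin 3 → TangentSpace (𝓡 7) x} (hu : θ.IsDualAt x u) (v : TangentSpace (𝓡 7) x) :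
    v - ∑ i, θ.η i x v • u i ∈ Q.H x := by
  rw [θ.mem_H_iff hU hx]
  intro j
  simp [fun i => hu i j]

/-- Near every point of `U` there is a smooth dual frame. -/
theorem exists_isDualFrame (θ : AdmissibleFrame g U) (hU : IsOpen U) {x₀ : N} (hx₀ : x₀ ∈ U) :
    ∃ V, ∃ hV : V ⊆ U, IsOpen V ∧ x₀ ∈ V ∧ ∃ R, IsDualFrame (θ.restrict hV) R := by
  obtain ⟨u, hu⟩ := θ.exists_isDualAt hU hx₀
  have hself : x₀ ∈ (chartAt E7 x₀).source := mem_chart_source E7 x₀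
  let t := trivializationAt E7 (fun x : N => TangentSpace (𝓡 7) x) x₀
  let w : Fin 3 → E7 := fun i => t.continuousLinearMapAt ℝ x₀ (u i)
  have hw : ∀ i, chartField x₀ (w i) x₀ = u i := fun i =>
    t.symmL_continuousLinearMapAt (R := ℝ) (FiberBundle.mem_baseSet_trivializationAt' x₀) (u i)
  obtain ⟨V, hVU, hV, hxV, A, hA, hd⟩ := exists_dual_fields (η := θ.η)
    (U := U ∩ (chartAt E7 x₀).source) (hU.inter (chartAt E7 x₀).open_source)
    (fun j => (θ.smooth j).mono Set.inter_subset_left)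
    (fun i => (smoothFieldOn_chartField x₀ (w i)).mono Set.inter_subset_right) ⟨hx₀, hself⟩
    (by
      have : (Matrix.of fun i j => θ.η j x₀ (chartField x₀ (w i) x₀)) = 1 := by
        ext i j
        rw [Matrix.of_apply, hw, hu, Matrix.one_apply]
      rw [this]
      simp)
  exact ⟨V, hVU.trans Set.inter_subset_left, hV, hxV, _, hA, hd⟩

/-- The covectors `i_{u_i} dη_j|_H + i_{u_j} dη_i|_H` at a point `x`. The vectors `u_i` are given at
`x` only, since `dη_j` is a tensor. -/
noncomputable def vertForm (θ : AdmissibleFrame g U) (x : N) (u : Fin 3 → TangentSpace (𝓡 7) x) :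
    Fin 3 → Fin 3 → (Q.H x →ₗ[ℝ] ℝ) := fun i j =>
  extDBilin (θ.η j) x (u i) ∘ₗ (Q.H x).subtype + extDBilin (θ.η i) x (u j) ∘ₗ (Q.H x).subtype

theorem vertForm_apply (θ : AdmissibleFrame g U) (x : N) (u : Fin 3 → TangentSpace (𝓡 7) x)
    (i j : Fin 3) (X : Q.H x) : θ.vertForm x u i j X =
      extD (θ.η j) x (u i) (X : TangentSpace (𝓡 7) x)
        + extD (θ.η i) x (u j) (X : TangentSpace (𝓡 7) x) := by
  simp [vertForm]

theorem vertForm_comm (θ : AdmissibleFrame g U) (x : N) (u : Fin 3 → TangentSpace (𝓡 7) x)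
    (i j : Fin 3) : θ.vertForm x u i j = θ.vertForm x u j i := by
  ext X
  rw [vertForm_apply, vertForm_apply, add_comm]

/-- Adding vectors `h_i ∈ H` to the `u_i` adds to `dη_j(u_i, ·)` the covector
`dη_j(h_i, ·) = g(I_j h_i, ·)`, which is the action of `I_j` on `g(h_i, ·)`. -/
theorem vertForm_add (θ : AdmissibleFrame g U) {x : N} (hx : x ∈ U)
    (u : Fin 3 → TangentSpace (𝓡 7) x) (h : Fin 3 → Q.H x) :
    θ.vertForm x (fun i => u i + h i) =
      θ.vertForm x u + symAct (fun i => act (θ.I i x)) (fun i => g.inner x (h i)) := by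
  ext i j X
  have key : ∀ i j, extD (θ.η j) x (u i + h i) (X : TangentSpace (𝓡 7) x) =
      extD (θ.η j) x (u i) (X : TangentSpace (𝓡 7) x) - g.inner x (h i) (θ.I j x X) := by
    intro i j
    have e := θ.d_eq j x hx (h i) X
    rw [θ.inner_I_left hx] at e
    rw [← extDBilin_apply, map_add, LinearMap.add_apply, extDBilin_apply, extDBilin_apply, e]
    ring
  simp only [Pi.add_apply, LinearMap.add_apply, vertForm_apply, key, symAct]
  simp only [act, LinearMap.coe_mk, AddHom.coe_mk, LinearMap.neg_apply, LinearMap.comp_apply]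
  ring

/-- Two dual bases differ by vectors of `H`. -/
theorem IsDualAt.exists_add {θ : AdmissibleFrame g U} (hU : IsOpen U) {x : N} (hx : x ∈ U)
    {u u' : Fin 3 → TangentSpace (𝓡 7) x} (hu : θ.IsDualAt x u) (hu' : θ.IsDualAt x u') :
    ∃ h : Fin 3 → Q.H x, u' = fun i => u i + h i := by
  have hm : ∀ i, u' i - u i ∈ Q.H x := fun i => by
    rw [θ.mem_H_iff hU hx]
    intro j
    rw [map_sub, hu, hu', sub_self]
  exact ⟨fun i => ⟨_, hm i⟩, funext fun i => (add_sub_cancel (u i) (u' i)).symm⟩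

theorem IsDualAt.add {θ : AdmissibleFrame g U} {x : N} (hx : x ∈ U)
    {u : Fin 3 → TangentSpace (𝓡 7) x} (hu : θ.IsDualAt x u) (h : Fin 3 → Q.H x) :
    θ.IsDualAt x (fun i => u i + h i) := fun i j => by
  rw [map_add, θ.vanish j x hx _ (h i).2, add_zero, hu]

/-- Two admissible frames, for two compatible metrics, are related by a conformal factor `f` and a
rotation `A`. The covectors `i_{u_i} dη_j|_H + i_{u_j} dη_i|_H` of suitable dual bases are then
related by `A`, up to a multiple of the identity given by the differential of the factor.

Writing `η' = B η` with a matrix-valued function `B`, one has `B Bᵀ = f²` by `conformal_of_selfDual`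
at every point, and `dη' = B dη + dB ∧ η`. The second term adds `-(dB Bᵀ + B dBᵀ) / f² = -d(f²) /
f²` to the symmetrized covectors. -/
theorem exists_change (θ : AdmissibleFrame g U) (hU : IsOpen U) (θ' : AdmissibleFrame g' U')
    (hU' : IsOpen U') {x : N} (hx : x ∈ U) (hx' : x ∈ U') {u : Fin 3 → TangentSpace (𝓡 7) x}
    (hu : θ.IsDualAt x u) :
    ∃ (f : ℝ) (A : Matrix (Fin 3) (Fin 3) ℝ) (ψ : Q.H x →ₗ[ℝ] ℝ), 0 < f ∧ A.transpose * A = 1 ∧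
      (∀ i, θ'.I i x = ∑ k, A i k • θ.I k x) ∧
      (∀ i v, θ'.η i x v = ∑ k, f * A i k * θ.η k x v) ∧
      θ'.IsDualAt x (fun i => ∑ k, (f⁻¹ * A i k) • u k) ∧
      (∀ i j, θ'.vertForm x (fun i => ∑ k, (f⁻¹ * A i k) • u k) i j =
        rotate A (θ.vertForm x u) i j - if i = j then ψ else 0) ∧
      (g = g' → f = 1 ∧ ψ = 0) := by
  obtain ⟨V, hVU, hV, hxV, R, hR, hRd⟩ := θ.exists_isDualFrame hU hx
  let O : Set N := V ∩ U'
  have hO : IsOpen O := hV.inter hU'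
  have hxO : x ∈ O := ⟨hxV, hx'⟩
  let B : N → Matrix (Fin 3) (Fin 3) ℝ := fun y => Matrix.of fun i k => θ'.η i y (R k y)
  have hBs : ∀ i k, SmoothFnOn O (fun y => B y i k) := fun i k =>
    ((θ'.smooth i).mono Set.inter_subset_right).apply ((hR k).mono Set.inter_subset_left)
  have hηs : ∀ i, SmoothFormOn O (θ.η i) := fun i =>
    (θ.smooth i).mono (Set.inter_subset_left.trans hVU)
  have hη's : ∀ i, SmoothFormOn O (θ'.η i) := fun i => (θ'.smooth i).mono Set.inter_subset_right
  have hη' : ∀ i, ∀ y ∈ O, ∀ v, θ'.η i y v = ∑ k, B y i k * θ.η k y v := by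
    intro i y hy v
    have h1 := θ'.vanish i y hy.2 _ (IsDualAt.sub_sum_mem (θ := θ) hU (hVU hy.1)
      (u := fun i => R i y) (hRd y hy.1) v)
    rw [map_sub, map_sum, sub_eq_zero] at h1
    rw [h1]
    refine Finset.sum_congr rfl fun k _ => ?_
    rw [map_smul, smul_eq_mul, mul_comm]
    rfl
  have hdη' : ∀ i, ∀ y ∈ O, ∀ v w, extD (θ'.η i) y v w = ∑ k, (B y i k * extD (θ.η k) y v w
      + (mvfderiv (𝓡 7) (fun y => B y i k) y v * θ.η k y w
        - mvfderiv (𝓡 7) (fun y => B y i k) y w * θ.η k y v)) := fun i y hy v w =>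
    extD_sum_smul hO (hη's i) hηs (hBs i) (hη' i) hy v w
  have hconf : ∀ y ∈ O, ∃ f : ℝ, 0 < f ∧ (B y * (B y).transpose = (f ^ 2) • 1) ∧
      ((B y).transpose * B y = (f ^ 2) • 1) ∧
      (∀ i, θ'.I i y = ∑ j, (f⁻¹ * B y i j) • θ.I j y) ∧
      ∀ X Y, g'.inner y X Y = f * g.inner y X Y := by
    intro y hy
    have : Nontrivial (Q.H y) := Q.nontrivial y
    refine conformal_of_selfDual (g.pos y) (g'.pos y) (θ.quaternionic y (hVU hy.1))
      (θ'.quaternionic y hy.2) fun i X Y => ?_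
    rw [← θ'.d_eq i y hy.2, hdη' i y hy]
    refine Finset.sum_congr rfl fun k _ => ?_
    rw [θ.d_eq k y (hVU hy.1), θ.vanish k y (hVU hy.1) X X.2, θ.vanish k y (hVU hy.1) Y Y.2]
    ring
  obtain ⟨f, hf, hBB, hBB', hI, hgg⟩ := hconf x hxO
  have hf0 := hf.ne'
  let A : Matrix (Fin 3) (Fin 3) ℝ := f⁻¹ • B x
  have hA : ∀ i k, A i k = f⁻¹ * B x i k := fun i k => rfl
  have hfA : ∀ i k, f * A i k = B x i k := fun i k => by rw [hA, mul_inv_cancel_left₀ hf0]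
  -- the function `f²`, written so that its smoothness is plain
  let φ : N → ℝ := fun y => ∑ l, B y 0 l * B y 0 l
  have hφ : ∀ i j, ∀ y ∈ O, ∑ l, B y i l * B y j l = if i = j then φ y else 0 := by
    intro i j y hy
    obtain ⟨f, -, h, -⟩ := hconf y hy
    have h' : ∀ i j, ∑ l, B y i l * B y j l = if i = j then f ^ 2 else 0 := fun i j => by
      have := congrFun (congrFun h i) j
      rw [Matrix.mul_apply, Matrix.smul_apply, Matrix.one_apply] at this
      simpa using this
    rw [h', show φ y = f ^ 2 by simpa using h' 0 0]
  have hBd := fun i k => (hBs i k).mdifferentiableAt hO hxO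
  have hdφ : ∀ i j (v : TangentSpace (𝓡 7) x), ∑ l, (B x i l * mvfderiv (𝓡 7) (fun y => B y j l) x v
      + B x j l * mvfderiv (𝓡 7) (fun y => B y i l) x v) =
      if i = j then mvfderiv (𝓡 7) φ x v else 0 := by
    intro i j v
    rw [← mvfderiv_sum_mul Finset.univ (hBd i) (hBd j)]
    rw [mvfderiv_congr (Filter.eventuallyEq_of_mem (hO.mem_nhds hxO) (hφ i j))]
    split_ifs
    · rfl
    · rw [mvfderiv_const]; rfl
  have hAA : A.transpose * A = 1 := by
    rw [show A = f⁻¹ • B x from rfl, Matrix.transpose_smul, Matrix.smul_mul, Matrix.mul_smul, hBB',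
      smul_smul, smul_smul, show f⁻¹ * f⁻¹ * f ^ 2 = 1 by field_simp, one_smul]
  have hAA' : A * A.transpose = 1 := mul_eq_one_comm.1 hAA
  have hu' : ∀ k i, θ.η k x (∑ l, (f⁻¹ * A i l) • u l) = f⁻¹ * A i k := fun k i => by
    simp [fun l => hu l k]
  refine ⟨f, A, (f⁻¹ * f⁻¹) • ((mvfderiv (𝓡 7) φ x : TangentSpace (𝓡 7) x →ₗ[ℝ] ℝ) ∘ₗ
    (Q.H x).subtype), hf, hAA, fun i => ?_, fun i v => ?_, fun i j => ?_, fun i j => ?_,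
    fun hgg' => ?_⟩
  · exact hI i
  · simp only [hfA]
    exact hη' i x hxO v
  · rw [hη' j x hxO]
    simp only [hu', ← hfA]
    rw [← sum_mul_right hAA' i j]
    refine Finset.sum_congr rfl fun k _ => ?_
    field_simp
  · ext X
    have key : ∀ i j, extD (θ'.η j) x (∑ l, (f⁻¹ * A i l) • u l) (X : TangentSpace (𝓡 7) x) =
        (∑ k, ∑ l, A i k * A j l * extD (θ.η l) x (u k) (X : TangentSpace (𝓡 7) x))
        - f⁻¹ * f⁻¹ * ∑ l, B x i l * mvfderiv (𝓡 7) (fun y => B y j l) x X := by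
      intro i j
      rw [hdη' j x hxO]
      simp only [hu', fun k => θ.vanish k x hx X X.2, mul_zero, zero_sub]
      rw [Finset.sum_add_distrib, sub_eq_add_neg]
      congr 1
      · rw [Finset.sum_comm]
        refine Finset.sum_congr rfl fun k _ => ?_
        rw [← extDBilin_apply, map_sum, LinearMap.sum_apply, Finset.mul_sum]
        refine Finset.sum_congr rfl fun l _ => ?_
        rw [map_smul, LinearMap.smul_apply, extDBilin_apply, ← hfA, smul_eq_mul]
        field_simp
      · rw [Finset.mul_sum, ← Finset.sum_neg_distrib]
        refine Finset.sum_congr rfl fun k _ => ?_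
        rw [hA]
        ring
    have h1 := hdφ i j X
    rw [Finset.sum_add_distrib] at h1
    rw [vertForm_apply, key, key, LinearMap.sub_apply]
    have h2 : ((if i = j then (f⁻¹ * f⁻¹) • ((mvfderiv (𝓡 7) φ x : TangentSpace (𝓡 7) x →ₗ[ℝ] ℝ) ∘ₗ
        (Q.H x).subtype) else 0 : Q.H x →ₗ[ℝ] ℝ)) X = f⁻¹ * f⁻¹ *
          (if i = j then mvfderiv (𝓡 7) φ x X else 0) := by
      split_ifs
      · rfl
      · simp
    have h3 : rotate A (θ.vertForm x u) i j X =
        (∑ k, ∑ l, A i k * A j l * extD (θ.η l) x (u k) (X : TangentSpace (𝓡 7) x)) +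
        ∑ k, ∑ l, A j k * A i l * extD (θ.η l) x (u k) (X : TangentSpace (𝓡 7) x) := by
      simp only [rotate, LinearMap.sum_apply, LinearMap.smul_apply, vertForm_apply, smul_eq_mul,
        mul_add, Finset.sum_add_distrib]
      congr 1
      rw [Finset.sum_comm]
      refine Finset.sum_congr rfl fun k _ => Finset.sum_congr rfl fun l _ => ?_
      ring
    rw [h2, h3, ← h1]
    ring
  · subst hgg'
    have hone : ∀ y, ∀ f : ℝ, (∀ X Y, g.inner y X Y = f * g.inner y X Y) → f = 1 := by
      intro y f hf
      obtain ⟨X, hX⟩ := @exists_ne _ (Q.nontrivial y) (0 : Q.H y)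
      have h1 := g.pos y X hX
      have h2 := hf X X
      exact (mul_right_cancel₀ h1.ne' (by rw [← h2, one_mul])).symm
    refine ⟨hone x f hgg, ?_⟩
    have h0 : mvfderiv (𝓡 7) φ x = 0 := by
      refine mvfderiv_eq_zero_of_eventually_const (c := 1)
        (Filter.mem_of_superset (hO.mem_nhds hxO) fun y hy => ?_)
      obtain ⟨f, -, h, -, -, hgf⟩ := hconf y hy
      have := congrFun (congrFun h 0) 0
      rw [Matrix.mul_apply, hone y f hgf] at this
      simpa using this
    rw [h0]
    ext X
    simp

end AdmissibleFrame

end VerticalForm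

/-! ### The obstruction to integrability -/

section Obstruction

open scoped Topology Bundle
open VectorField

variable {N : Type*} [TopologicalSpace N] [ChartedSpace E7 N] [IsManifold (𝓡 7) ∞ N]
  {Q : QCStructure N} {g g' : CompatibleMetric Q} {U U' : Set N}

/-- The `S^{5,1}` part of the covectors `i_{u_i} dη_j|_H + i_{u_j} dη_i|_H` vanishes at `x`, for
some compatible metric, some admissible frame and some dual basis. -/
def QCStructure.ObstructionVanishesAt (Q : QCStructure N) (x : N) : Prop :=
  ∃ (g : CompatibleMetric Q) (U : Set N) (θ : AdmissibleFrame g U)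
    (u : Fin 3 → TangentSpace (𝓡 7) x), IsOpen U ∧ x ∈ U ∧ θ.IsDualAt x u ∧
    ∃ r, θ.vertForm x u = symAct (fun i => act (θ.I i x)) r

/-- The vanishing of the `S^{5,1}` part does not depend on the metric, the frame and the basis. -/
theorem AdmissibleFrame.obstructionVanishesAt_iff (θ : AdmissibleFrame g U) (hU : IsOpen U) {x : N}
    (hx : x ∈ U) {u : Fin 3 → TangentSpace (𝓡 7) x} (hu : θ.IsDualAt x u) :
    Q.ObstructionVanishesAt x ↔ ∃ r, θ.vertForm x u = symAct (fun i => act (θ.I i x)) r := by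
  refine ⟨?_, fun h => ⟨g, U, θ, u, hU, hx, hu, h⟩⟩
  rintro ⟨g₀, U₀, θ₀, u₀, hU₀, hx₀, hu₀, r, hr⟩
  obtain ⟨f, A, ψ, -, -, hI, -, hd, hb, -⟩ := θ₀.exists_change hU₀ θ hU hx₀ hx hu₀
  obtain ⟨h, rfl⟩ := hd.exists_add hU hx hu
  rw [θ.vertForm_add hx]
  -- the multiple `-ψ` of the identity is itself a symmetrized tensor
  have hb' : θ.vertForm x (fun i => ∑ k, (f⁻¹ * A i k) • u₀ k) =
      symAct (fun i => act (θ.I i x)) (fun j => ∑ l, A j l • r l) +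
        symAct (fun i => act (θ.I i x)) (fun k => act (θ.I k x) ((1 / 2 : ℝ) • ψ)) := by
    ext1 i
    ext1 j
    rw [hb, hr, rotate_symAct hI, Pi.add_apply, Pi.add_apply,
      symAct_apply_self (θ.quaternionic x hx).act, sub_eq_add_neg]
    congr 1
    split_ifs <;> module
  rw [hb', ← symAct_add, ← symAct_add]
  exact ⟨_, rfl⟩

/-- At most one dual basis is normalized, that is, has its covectors `vertForm` in `S^{5,1}`. -/
theorem AdmissibleFrame.eq_of_vertForm_mem_S51 (θ : AdmissibleFrame g U) (hU : IsOpen U) {x : N}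
    (hx : x ∈ U) {u u' : Fin 3 → TangentSpace (𝓡 7) x} (hu : θ.IsDualAt x u)
    (hu' : θ.IsDualAt x u') (h : θ.vertForm x u ∈ S51 (fun i => θ.I i x))
    (h' : θ.vertForm x u' ∈ S51 (fun i => θ.I i x)) : u = u' := by
  obtain ⟨k, rfl⟩ := hu.exists_add hU hx hu'
  rw [θ.vertForm_add hx] at h'
  have h1 := eq_zero_of_symAct_mem_S51 (θ.quaternionic x hx)
    ((Submodule.add_mem_iff_right _ h).1 h')
  have h2 : ∀ i, k i = 0 := fun i => g.nondegenerate fun Y => by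
    exact DFunLike.congr_fun (congrFun h1 i) Y
  simp [h2]

/-- A field of covectors on `H` is smooth along a frame `E` if its components are. -/
def SmoothAlong (E : Fin 4 → ∀ x : N, Q.H x) (V : Set N) (c : ∀ x : N, Q.H x →ₗ[ℝ] ℝ) : Prop :=
  ∀ k, SmoothFnOn V (fun x => c x (E k x))

theorem SmoothAlong.add {E : Fin 4 → ∀ x : N, Q.H x} {V : Set N}
    {c c' : ∀ x : N, Q.H x →ₗ[ℝ] ℝ} (h : SmoothAlong E V c) (h' : SmoothAlong E V c') :
    SmoothAlong E V (fun x => c x + c' x) := fun k => (h k).add (h' k)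

theorem SmoothAlong.const_smul {E : Fin 4 → ∀ x : N, Q.H x} {V : Set N}
    {c : ∀ x : N, Q.H x →ₗ[ℝ] ℝ} (t : ℝ) (h : SmoothAlong E V c) :
    SmoothAlong E V (fun x => t • c x) := fun k => contMDiffOn_const.mul (h k)

theorem SmoothAlong.sum {ι : Type*} [Fintype ι] {E : Fin 4 → ∀ x : N, Q.H x} {V : Set N}
    {c : ι → ∀ x : N, Q.H x →ₗ[ℝ] ℝ} (h : ∀ i, SmoothAlong E V (c i)) :
    SmoothAlong E V (fun x => ∑ i, c i x) := fun k => by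
  simp only [LinearMap.sum_apply]
  exact fun x hx => ContMDiffWithinAt.sum fun i _ => h i k x hx

/-- If the complex structures have constant coefficients in the frame `E`, their action on
covectors preserves smoothness along `E`. -/
theorem SmoothAlong.act {E : Fin 4 → ∀ x : N, Q.H x} {V : Set N}
    {I : Fin 3 → ∀ x : N, (Q.H x →ₗ[ℝ] Q.H x)}
    (hI : ∀ x ∈ V, ∃ e : Module.Basis (Fin 4) ℝ (Q.H x), (∀ i, e i = E i x) ∧
      ∀ i, I i x = quaternionTriple e i)
    {c : ∀ x : N, Q.H x →ₗ[ℝ] ℝ} (h : SmoothAlong E V c) (l : Fin 3) :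
    SmoothAlong E V (fun x => QC.act (I l x) (c x)) := by
  intro k
  have h1 : ∀ m : Fin 4, ∀ t : ℝ, (∀ x ∈ V, I l x (E k x) = t • E m x) →
      SmoothFnOn V (fun x => QC.act (I l x) (c x) (E k x)) := fun m t hm => by
    refine ContMDiffOn.congr ((contMDiffOn_const (c := -t)).mul (h m)) fun x hx => ?_
    change -(c x (I l x (E k x))) = -t * c x (E m x)
    rw [hm x hx, map_smul, smul_eq_mul, neg_mul]
  have h2 : ∃ (m : Fin 4) (t : ℝ), ∀ x ∈ V, I l x (E k x) = t • E m x := by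
    have h3 : ∃ (m : Fin 4) (t : ℝ), ∀ x, ∀ e : Module.Basis (Fin 4) ℝ (Q.H x),
        quaternionTriple e l (e k) = t • e m := by
      simp only [quaternionTriple_basis]
      fin_cases l <;> fin_cases k
      · exact ⟨1, 1, fun x e => by simp⟩
      · exact ⟨0, -1, fun x e => by simp⟩
      · exact ⟨3, 1, fun x e => by simp⟩
      · exact ⟨2, -1, fun x e => by simp⟩
      · exact ⟨2, 1, fun x e => by simp⟩
      · exact ⟨3, -1, fun x e => by simp⟩
      · exact ⟨0, -1, fun x e => by simp⟩
      · exact ⟨1, 1, fun x e => by simp⟩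
      · exact ⟨3, 1, fun x e => by simp⟩
      · exact ⟨2, 1, fun x e => by simp⟩
      · exact ⟨1, -1, fun x e => by simp⟩
      · exact ⟨0, -1, fun x e => by simp⟩
    obtain ⟨m, t, hmt⟩ := h3
    refine ⟨m, t, fun x hx => ?_⟩
    obtain ⟨e, he, hIe⟩ := hI x hx
    rw [← he, ← he, hIe]
    exact hmt x e
  obtain ⟨m, t, hmt⟩ := h2
  exact h1 m t hmt

/-- Near every point there are an admissible frame and a dual frame `R` for which the covectors
`i_{R_i} dη_j|_H + i_{R_j} dη_i|_H` lie in `S^{5,1}`. An arbitrary dual frame is corrected by vector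
fields `h_i` in `H`, given by `symSolve`; they are smooth because the complex structures have
constant coefficients in the frame `E` of `H`. -/
theorem CompatibleMetric.exists_normalized (g : CompatibleMetric Q) (x₀ : N) :
    ∃ (V : Set N) (θ : AdmissibleFrame g V) (R : Fin 3 → ∀ x : N, TangentSpace (𝓡 7) x),
      IsOpen V ∧ x₀ ∈ V ∧ IsDualFrame θ R ∧
      ∀ x ∈ V, θ.vertForm x (fun i => R i x) ∈ S51 (fun i => θ.I i x) := by
  obtain ⟨U, E, θ₀, hU, hxU, hE, he⟩ := g.exists_admissibleFrame x₀
  obtain ⟨V, hVU, hV, hxV, R, hR, hRd⟩ := θ₀.exists_isDualFrame hU hxU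
  let θ := θ₀.restrict hVU
  let b : ∀ x : N, Fin 3 → Fin 3 → (Q.H x →ₗ[ℝ] ℝ) := fun x => θ.vertForm x (fun i => R i x)
  have hEV : ∀ k, SmoothFieldOn V (fun x => (E k x : TangentSpace (𝓡 7) x)) :=
    fun k => (hE k).mono hVU
  have hb : ∀ i j, SmoothAlong E V (fun x => b x i j) := fun i j k => by
    simp only [b, AdmissibleFrame.vertForm_apply]
    exact ((θ.smooth j).smoothFnOn_extD hV (hR i) (hEV k)).add
      ((θ.smooth i).smoothFnOn_extD hV (hR j) (hEV k))
  have hact : ∀ l {c : ∀ x : N, Q.H x →ₗ[ℝ] ℝ}, SmoothAlong E V c →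
      SmoothAlong E V (fun x => act (θ.I l x) (c x)) := fun l c hc =>
    hc.act (I := θ.I) (fun x hx => (he x (hVU hx)).imp fun e he => ⟨he.1, he.2.2⟩) l
  let r : ∀ x : N, Fin 3 → (Q.H x →ₗ[ℝ] ℝ) := fun x => symSolve (fun i => act (θ.I i x)) (b x)
  have hr : ∀ j, SmoothAlong E V (fun x => r x j) := fun j => by
    refine SmoothAlong.add (SmoothAlong.const_smul _ (SmoothAlong.sum fun i => hact i (hb i j)))
      (SmoothAlong.const_smul _ (hact j (SmoothAlong.sum fun k => hact k
        (SmoothAlong.sum fun i => hact i (hb i k)))))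
  -- the vectors dual to `-r i` for the metric
  let h : Fin 3 → ∀ x : N, Q.H x := fun i x => ∑ k, (-(r x i (E k x))) • E k x
  have hh : ∀ i, SmoothFieldOn V (fun x => (h i x : TangentSpace (𝓡 7) x)) := fun i => by
    have := SmoothFieldOn.sum fun k => SmoothFieldOn.smul (ContMDiffOn.neg (hr i k)) (hEV k)
    refine this.congr fun x _ => ?_
    simp [h]
  have hgh : ∀ x ∈ V, (fun i => g.inner x (h i x)) = - r x := fun x hx => by
    obtain ⟨e, heE, hon, -⟩ := he x (hVU hx)
    ext1 i
    refine e.ext fun j => ?_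
    simp [h, ← heE, hon]
  refine ⟨V, θ, fun i x => R i x + h i x, hV, hxV, ⟨fun i => (hR i).add (hh i), fun x hx => ?_⟩,
    fun x hx => ?_⟩
  · exact AdmissibleFrame.IsDualAt.add (θ := θ) hx (u := fun i => R i x) (hRd x hx) (fun i => h i x)
  · have h1 := θ.vertForm_add hx (fun i => R i x) (fun i => h i x)
    rw [h1, hgh x hx]
    have h2 := sub_symSolve_mem_S51 (θ.quaternionic x hx) (b := b x) (fun i j =>
      θ.vertForm_comm x _ i j)
    convert h2 using 1
    rw [sub_eq_add_neg]
    congr 1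
    ext1 i
    ext1 j
    simp [symAct, r, add_comm]

/-- Integrability is the pointwise vanishing of the obstruction: a normalized dual frame is one for
which the `S^{5,1}` part is the whole of `i_{R_i} dη_j|_H + i_{R_j} dη_i|_H`. -/
theorem integrable_iff (g : CompatibleMetric Q) :
    Integrable g ↔ ∀ x, Q.ObstructionVanishesAt x := by
  constructor
  · intro h x
    obtain ⟨U, θ, R, hU, hx, hR, h0⟩ := h x
    refine ⟨g, U, θ, fun i => R i x, hU, hx, hR.2 x hx, 0, ?_⟩
    ext i j X
    rw [AdmissibleFrame.vertForm_apply, h0 x hx]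
    simp [symAct]
  · intro h x₀
    obtain ⟨V, θ, R, hV, hx₀, hR, hS⟩ := g.exists_normalized x₀
    refine ⟨V, θ, R, hV, hx₀, hR, fun x hx i j X => ?_⟩
    obtain ⟨r, hr⟩ := (θ.obstructionVanishesAt_iff hV hx (u := fun i => R i x) (hR.2 x hx)).1 (h x)
    have h1 := hS x hx
    rw [hr] at h1
    have h2 := eq_zero_of_symAct_mem_S51 (θ.quaternionic x hx) h1
    have h3 := DFunLike.congr_fun (congrFun (congrFun hr i) j) X
    rw [AdmissibleFrame.vertForm_apply, h2] at h3
    simp only [symAct, Pi.zero_apply, map_zero, add_zero, LinearMap.zero_apply] at h3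
    exact eq_neg_of_add_eq_zero_left h3

/-- The condition on all frames is the vanishing of the obstruction; for the direct implication some
frame is needed around every point. -/
theorem framesS51PartVanishes_iff (g : CompatibleMetric Q) :
    FramesS51PartVanishes g ↔ ∀ x, Q.ObstructionVanishesAt x := by
  constructor
  · intro h x
    obtain ⟨V, θ, R, hV, hx, hR, -⟩ := g.exists_normalized x
    rw [θ.obstructionVanishesAt_iff hV hx (u := fun i => R i x) (hR.2 x hx)]
    exact (isS51Part_zero_iff (θ.quaternionic x hx)).1
      (h V θ R hV hR x hx _ fun i j X => θ.vertForm_apply x _ i j X)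
  · intro h U θ R hU hR x hx a ha
    rw [isS51Part_zero_iff (θ.quaternionic x hx)]
    have : a = θ.vertForm x (fun i => R i x) := by
      ext i j X
      rw [ha, θ.vertForm_apply]
    rw [this, ← θ.obstructionVanishesAt_iff hU hx (hR.2 x hx)]
    exact h x

/-! ### Complements of `H` -/

namespace Complement

theorem eq_zero_of_mem (W : Complement Q) {x : N} {v : TangentSpace (𝓡 7) x} (h : v ∈ Q.H x)
    (h' : v ∈ W.W x) : v = 0 :=
  Submodule.disjoint_def.1 (W.isCompl x).disjoint v h h'

theorem projH_add_projW (W : Complement Q) (x : N) (v : TangentSpace (𝓡 7) x) :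
    ((W.projH x v : TangentSpace (𝓡 7) x) + W.projW x v) = v :=
  Submodule.projection_add_projection_eq_self (W.isCompl x) v

theorem exists_isDualAt (W : Complement Q) (θ : AdmissibleFrame g U) (hU : IsOpen U) {x : N}
    (hx : x ∈ U) : ∃ u : Fin 3 → W.W x, θ.IsDualAt x (fun i => u i) := by
  obtain ⟨u, hu⟩ := θ.exists_isDualAt hU hx
  refine ⟨fun i => W.projW x (u i), fun i j => ?_⟩
  have h1 : ((W.projH x (u i) : TangentSpace (𝓡 7) x) + W.projW x (u i)) = u i :=
    W.projH_add_projW x (u i)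
  have h2 := congrArg (θ.η j x) h1
  rw [map_add, θ.vanish j x hx _ (W.projH x (u i)).2, zero_add, hu] at h2
  exact h2

theorem eq_sum (W : Complement Q) (θ : AdmissibleFrame g U) (hU : IsOpen U) {x : N}
    (hx : x ∈ U) {u : Fin 3 → W.W x} (hu : θ.IsDualAt x (fun i => u i)) (v : W.W x) :
    v = ∑ i, θ.η i x v • u i := by
  have h1 := hu.sub_sum_mem hU hx v
  have h2 := W.eq_zero_of_mem h1 (Submodule.sub_mem _ v.2
    (Submodule.sum_mem _ fun i _ => Submodule.smul_mem _ _ (u i).2))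
  apply Subtype.ext
  refine (sub_eq_zero.1 h2).trans ?_
  simp only [Submodule.coe_sum, Submodule.coe_smul]

/-- Near every point of `U`, a complement has a smooth frame dual to an admissible frame. -/
theorem exists_isDualFrame (W : Complement Q) (θ : AdmissibleFrame g U) (hU : IsOpen U) {x₀ : N}
    (hx₀ : x₀ ∈ U) : ∃ V, ∃ hV : V ⊆ U, IsOpen V ∧ x₀ ∈ V ∧ ∃ R : Fin 3 → ∀ x : N, W.W x,
      IsDualFrame (θ.restrict hV) (fun i x => (R i x : TangentSpace (𝓡 7) x)) := by
  obtain ⟨O, X, hO, hxO, hX, hb⟩ := W.distribution x₀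
  obtain ⟨b, hb⟩ := hb x₀ hxO
  obtain ⟨V, hVU, hV, hxV, A, hA, hd⟩ := exists_dual_fields (η := θ.η)
    (X := fun i x => (X i x : TangentSpace (𝓡 7) x)) (U := U ∩ O) (hU.inter hO)
    (fun j => (θ.smooth j).mono Set.inter_subset_left)
    (fun i => (hX i).mono Set.inter_subset_right) ⟨hx₀, hxO⟩ (by
      intro h0
      obtain ⟨c, hc0, hc⟩ := Matrix.exists_vecMul_eq_zero_iff.2 h0
      apply hc0
      have h1 : ((∑ i, c i • b i : W.W x₀) : TangentSpace (𝓡 7) x₀) = 0 := by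
        refine W.eq_zero_of_mem ?_ (Subtype.mem _)
        rw [θ.mem_H_iff hU hx₀]
        intro j
        have := congrFun hc j
        simp only [Matrix.vecMul, dotProduct, Matrix.of_apply, Pi.zero_apply] at this
        simpa [hb] using this
      ext i
      exact Fintype.linearIndependent_iff.1 b.linearIndependent c (Subtype.ext h1) i)
  refine ⟨V, hVU.trans Set.inter_subset_left, hV, hxV, fun i x => ∑ k, A x i k • X k x,
    fun i => ?_, fun x hx i j => ?_⟩
  · refine (hA i).congr fun x _ => ?_
    simp
  · have := hd x hx i j
    simp only [Submodule.coe_sum, Submodule.coe_smul]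
    exact this

end Complement

/-- The complement `W` is normalized: the covectors `i_{u_i} dη_j|_H + i_{u_j} dη_i|_H` lie in
`S^{5,1}` for the dual bases `u` of `W`. -/
def IsNormalized (g : CompatibleMetric Q) (W : Complement Q) : Prop :=
  ∀ (U : Set N) (θ : AdmissibleFrame g U), IsOpen U → ∀ x ∈ U, ∀ u : Fin 3 → W.W x,
    θ.IsDualAt x (fun i => u i) → θ.vertForm x (fun i => u i) ∈ S51 (fun i => θ.I i x)

theorem Complement.span_eq (W : Complement Q) (θ : AdmissibleFrame g U) (hU : IsOpen U) {x : N}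
    (hx : x ∈ U) {u : Fin 3 → W.W x} (hu : θ.IsDualAt x (fun i => u i)) :
    Submodule.span ℝ (Set.range fun i => (u i : TangentSpace (𝓡 7) x)) = W.W x := by
  refine le_antisymm (Submodule.span_le.2 ?_) fun v hv => ?_
  · rintro _ ⟨i, rfl⟩
    exact (u i).2
  · have := congrArg Subtype.val (W.eq_sum θ hU hx hu ⟨v, hv⟩)
    rw [show v = (⟨v, hv⟩ : W.W x).1 from rfl, this]
    simp only [Submodule.coe_sum, Submodule.coe_smul]
    exact Submodule.sum_mem _ fun i _ => Submodule.smul_mem _ _ (Submodule.subset_span ⟨i, rfl⟩)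

theorem IsNormalized.unique {W W' : Complement Q} (h : IsNormalized g W)
    (h' : IsNormalized g W') : W = W' := by
  have : W.W = W'.W := by
    ext1 x
    obtain ⟨U, E, θ, hU, hx, -⟩ := g.exists_admissibleFrame x
    obtain ⟨u, hu⟩ := W.exists_isDualAt θ hU hx
    obtain ⟨u', hu'⟩ := W'.exists_isDualAt θ hU hx
    have := θ.eq_of_vertForm_mem_S51 hU hx hu hu' (h U θ hU x hx u hu) (h' U θ hU x hx u' hu')
    rw [← W.span_eq θ hU hx hu, ← W'.span_eq θ hU hx hu', this]
  cases W
  cases W'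
  cases this
  rfl

/-- The span of a normalized dual basis does not depend on the admissible frame. -/
theorem AdmissibleFrame.span_eq_of_mem_S51 (θ : AdmissibleFrame g U) (hU : IsOpen U)
    (θ' : AdmissibleFrame g U') (hU' : IsOpen U') {x : N} (hx : x ∈ U) (hx' : x ∈ U')
    {u u' : Fin 3 → TangentSpace (𝓡 7) x} (hu : θ.IsDualAt x u) (hu' : θ'.IsDualAt x u')
    (h : θ.vertForm x u ∈ S51 (fun i => θ.I i x))
    (h' : θ'.vertForm x u' ∈ S51 (fun i => θ'.I i x)) :
    ∃ A : Matrix (Fin 3) (Fin 3) ℝ, ∀ i, u' i = ∑ k, A i k • u k := by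
  obtain ⟨f, A, ψ, -, hA, hI, -, hd, hb, hfψ⟩ := θ.exists_change hU θ' hU' hx hx' hu
  obtain ⟨-, hψ⟩ := hfψ rfl
  have h1 : θ'.vertForm x (fun i => ∑ k, (f⁻¹ * A i k) • u k) = rotate A (θ.vertForm x u) := by
    ext1 i
    ext1 j
    rw [hb, hψ]
    simp
  have h2 := rotate_mem_S51 hA hI h
  rw [← h1] at h2
  have h3 := θ'.eq_of_vertForm_mem_S51 hU' hx' hu' hd h' h2
  exact ⟨fun i k => f⁻¹ * A i k, fun i => congrFun h3 i⟩

/-- The spans of the local normalized dual frames agree where they are both defined, and make up a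
normalized complement. -/
theorem CompatibleMetric.exists_isNormalized (g : CompatibleMetric Q) :
    ∃ W : Complement Q, IsNormalized g W := by
  classical
  choose V θ R hV hxV hR hS using fun x₀ => g.exists_normalized x₀
  let W : ∀ x : N, Submodule ℝ (TangentSpace (𝓡 7) x) := fun x =>
    Submodule.span ℝ (Set.range fun i => R x i x)
  have hd : ∀ x₀, ∀ x ∈ V x₀, (θ x₀).IsDualAt x (fun i => R x₀ i x) := fun x₀ => (hR x₀).2
  have hle : ∀ x₀ x₁ x, x ∈ V x₀ → x ∈ V x₁ →
      Submodule.span ℝ (Set.range fun i => R x₀ i x) ≤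
        Submodule.span ℝ (Set.range fun i => R x₁ i x) := by
    intro x₀ x₁ x h0 h1
    obtain ⟨A, hA⟩ := (θ x₁).span_eq_of_mem_S51 (hV x₁) (θ x₀) (hV x₀) h1 h0 (hd x₁ x h1)
      (hd x₀ x h0) (hS x₁ x h1) (hS x₀ x h0)
    rw [Submodule.span_le]
    rintro _ ⟨i, rfl⟩
    change R x₀ i x ∈ _
    rw [hA i]
    exact Submodule.sum_mem _ fun k _ => Submodule.smul_mem _ _ (Submodule.subset_span ⟨k, rfl⟩)
  have hW : ∀ x₀, ∀ x ∈ V x₀, W x = Submodule.span ℝ (Set.range fun i => R x₀ i x) :=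
    fun x₀ x hx => le_antisymm (hle _ _ _ (hxV x) hx) (hle _ _ _ hx (hxV x))
  have hmem : ∀ x₀, ∀ x ∈ V x₀, ∀ i, R x₀ i x ∈ W x := fun x₀ x hx i => by
    rw [hW x₀ x hx]
    exact Submodule.subset_span ⟨i, rfl⟩
  have hli : ∀ x₀, ∀ x ∈ V x₀, ∀ c : Fin 3 → ℝ, ∑ i, c i • R x₀ i x ∈ Q.H x → c = 0 := by
    intro x₀ x hx c hc
    ext j
    have := ((θ x₀).mem_H_iff (hV x₀) hx).1 hc j
    simpa [fun i => hd x₀ x hx i j] using this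
  let 𝒲 : Complement Q :=
    { W := W
      distribution := fun x₀ => by
        -- the fields need values in `W x` also outside `V x₀`, where zero will do
        refine ⟨V x₀, fun i x => if hx : x ∈ V x₀ then ⟨R x₀ i x, hmem x₀ x hx i⟩ else 0, hV x₀,
          hxV x₀, fun i => ((hR x₀).1 i).congr fun x hx => by simp only [dif_pos hx],
          fun x hx => ?_⟩
        have hl : LinearIndependent ℝ (fun i => (⟨R x₀ i x, hmem x₀ x hx i⟩ : W x)) := by
          rw [Fintype.linearIndependent_iff]
          intro c hc i
          have h1 := congrArg Subtype.val hc
          simp only [Submodule.coe_sum, Submodule.coe_smul, Submodule.coe_zero] at h1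
          exact congrFun (hli x₀ x hx c (by rw [h1]; exact Submodule.zero_mem _)) i
        refine ⟨Module.Basis.mk hl ?_, fun i => ?_⟩
        · rintro ⟨v, hv⟩ -
          have hv' := hv
          rw [hW x₀ x hx, Submodule.mem_span_range_iff_exists_fun] at hv'
          obtain ⟨c, hc⟩ := hv'
          rw [Submodule.mem_span_range_iff_exists_fun]
          exact ⟨c, Subtype.ext (by simpa using hc)⟩
        · simp only [Module.Basis.mk_apply, dif_pos hx]
      isCompl := fun x => by
        refine IsCompl.of_eq ?_ ?_
        · rw [Submodule.eq_bot_iff]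
          rintro v ⟨hv, hv'⟩
          rw [SetLike.mem_coe, hW x x (hxV x), Submodule.mem_span_range_iff_exists_fun] at hv'
          obtain ⟨c, rfl⟩ := hv'
          have := hli x x (hxV x) c hv
          simp [this]
        · rw [Submodule.eq_top_iff']
          intro v
          rw [← sub_add_cancel v (∑ i, (θ x).η i x v • R x i x)]
          refine Submodule.add_mem_sup ((hd x x (hxV x)).sub_sum_mem (hV x) (hxV x) v) ?_
          exact Submodule.sum_mem _ fun i _ => Submodule.smul_mem _ _ (hmem x x (hxV x) i) }
  refine ⟨𝒲, fun U θ' hU x hx u hu => ?_⟩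
  obtain ⟨f, A, ψ, -, hA, hI, -, hdu, hb, hfψ⟩ :=
    (θ x).exists_change (hV x) θ' hU (hxV x) hx (hd x x (hxV x))
  obtain ⟨-, hψ⟩ := hfψ rfl
  have h1 : θ'.vertForm x (fun i => ∑ k, (f⁻¹ * A i k) • R x k x) =
      rotate A ((θ x).vertForm x (fun i => R x i x)) := by
    ext1 i
    ext1 j
    rw [hb, hψ]
    simp
  have h2 : (fun i => (u i : TangentSpace (𝓡 7) x)) = fun i => ∑ k, (f⁻¹ * A i k) • R x k x := by
    ext1 i
    have h3 := congrArg Subtype.val (𝒲.eq_sum θ' hU hx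
      (u := fun i => ⟨∑ k, (f⁻¹ * A i k) • R x k x, Submodule.sum_mem _ fun k _ =>
        Submodule.smul_mem _ _ (hmem x x (hxV x) k)⟩) hdu (u i))
    rw [h3]
    simp [fun j => hu i j]
  rw [h2, h1]
  exact rotate_mem_S51 hA hI (hS x x (hxV x))

end Obstruction

/-! ### The linear algebra of adapted connections -/

section Coefficients

variable {ι κ : Type*} [DecidableEq κ]

/-- The linear system satisfied by the coefficients `G a b c = ε_c(∇_{F_a} F_b)` of an adapted
connection in an adapted frame `F` with dual coframe `ε` and structure functions `C a b c =
ε_c([F_a, F_b])`; the map `t` tells whether a vector of the frame belongs to `H` or to `W`. In this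
order, the equations say that the connection preserves `H` and `W`, that it is metric, that the
torsion of two vectors of one type has no component of this type, and that the torsion with a vector
of the other type is symmetric. -/
structure IsAdaptedCoeff (t : ι → κ) (C G : ι → ι → ι → ℝ) : Prop where
  mixed : ∀ a b c, t b ≠ t c → G a b c = 0
  skew : ∀ a b c, G a b c + G a c b = 0
  torsion : ∀ a b c, t a = t b → t b = t c → G a b c - G b a c = C a b c
  symm : ∀ a b c, t a ≠ t b → t b = t c → G a b c - C a b c = G a c b - C a c b

/-- The solution of the system: the Koszul formula for three vectors of the same type, and the
skew-symmetrized structure functions for two vectors of one type and one of the other. -/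
noncomputable def adaptedCoeff (t : ι → κ) (C : ι → ι → ι → ℝ) (a b c : ι) : ℝ :=
  if t b = t c then (1 / 2) * (C a b c - C a c b - if t a = t b then C b c a else 0) else 0

theorem isAdaptedCoeff_adaptedCoeff {t : ι → κ} {C : ι → ι → ι → ℝ}
    (hC : ∀ a b c, C a b c = - C b a c) : IsAdaptedCoeff t C (adaptedCoeff t C) where
  mixed a b c h := by rw [adaptedCoeff, if_neg h]
  skew a b c := by
    simp only [adaptedCoeff]
    by_cases h : t b = t c
    · by_cases h' : t a = t b
      · rw [if_pos h, if_pos h', if_pos h.symm, if_pos (h'.trans h), hC c b a]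
        ring
      · rw [if_pos h, if_neg h', if_pos h.symm, if_neg (fun e => h' (e.trans h.symm))]
        ring
    · rw [if_neg h, if_neg (Ne.symm h), add_zero]
  torsion a b c h h' := by
    simp only [adaptedCoeff]
    rw [if_pos h', if_pos h, if_pos (h.trans h'), if_pos h.symm, hC b a c]
    ring
  symm a b c h h' := by
    simp only [adaptedCoeff]
    rw [if_pos h', if_neg h, if_pos h'.symm, if_neg (fun e => h (e.trans h'.symm))]
    ring

/-- The system has no other solution: for three indices of the same type by the computation of the
Levi-Civita connection, otherwise because `G a` is skew-symmetric and `G a - C a` is symmetric,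
which makes `G a` the skew-symmetric part of `C a`. -/
theorem IsAdaptedCoeff.eq_adaptedCoeff {t : ι → κ} {C G : ι → ι → ι → ℝ}
    (h : IsAdaptedCoeff t C G) (a b c : ι) : G a b c = adaptedCoeff t C a b c := by
  simp only [adaptedCoeff]
  by_cases h1 : t b = t c
  · by_cases h2 : t a = t b
    · rw [if_pos h1, if_pos h2]
      have e1 := h.torsion a b c h2 h1
      have e2 := h.torsion a c b (h2.trans h1) h1.symm
      have e3 := h.torsion b c a h1 (h2.trans h1).symm
      have s1 := h.skew a b c
      have s2 := h.skew b a c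
      have s3 := h.skew c a b
      linarith
    · rw [if_pos h1, if_neg h2]
      have e1 := h.symm a b c h2 h1
      have s1 := h.skew a b c
      linarith
  · rw [if_neg h1, h.mixed a b c h1]

end Coefficients

/-! ### The connection of an adapted frame -/

section Connection

open scoped Topology Bundle
open VectorField

variable {N : Type*} [TopologicalSpace N] [ChartedSpace E7 N] [IsManifold (𝓡 7) ∞ N]
  {Q : QCStructure N} {g : CompatibleMetric Q} {W : Complement Q} {U : Set N}

theorem Complement.η_projW (W : Complement Q) (θ : AdmissibleFrame g U) {x : N} (hx : x ∈ U)
    (j : Fin 3) (v : TangentSpace (𝓡 7) x) :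
    θ.η j x (W.projW x v : TangentSpace (𝓡 7) x) = θ.η j x v := by
  conv_rhs => rw [← W.projH_add_projW x v]
  rw [map_add, θ.vanish j x hx _ (W.projH x v).2, zero_add]

variable (g W) in
/-- A frame of `TN = H ⊕ W` on `U`: a smooth orthonormal frame of `H`, and a smooth frame of `W`
which is dual to an admissible frame. -/
structure AdaptedFrame (U : Set N) where
  /-- the contact forms -/
  θ : AdmissibleFrame g U
  /-- the frame of `H` -/
  E : Fin 4 → ∀ x : N, Q.H x
  /-- the frame of `W` -/
  R : Fin 3 → ∀ x : N, W.W x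
  smooth_E : ∀ i, SmoothFieldOn U (fun x => (E i x : TangentSpace (𝓡 7) x))
  basis : ∀ x ∈ U, ∃ e : Module.Basis (Fin 4) ℝ (Q.H x), ∀ i, e i = E i x
  orthonormal : ∀ x ∈ U, ∀ i j, g.inner x (E i x) (E j x) = if i = j then 1 else 0
  dual : IsDualFrame θ (fun i x => (R i x : TangentSpace (𝓡 7) x))

variable (g W) in
theorem exists_adaptedFrame (x₀ : N) :
    ∃ (U : Set N) (_ : AdaptedFrame g W U), IsOpen U ∧ x₀ ∈ U := by
  obtain ⟨U, E, θ, hU, hx, hE, he⟩ := g.exists_admissibleFrame x₀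
  obtain ⟨V, hVU, hV, hxV, R, hR⟩ := W.exists_isDualFrame θ hU hx
  refine ⟨V, ⟨θ.restrict hVU, E, R, fun i => (hE i).mono hVU, fun x hx => ?_, fun x hx => ?_, hR⟩,
    hV, hxV⟩
  · obtain ⟨e, he, -⟩ := he x (hVU hx)
    exact ⟨e, he⟩
  · obtain ⟨e, he, hon, -⟩ := he x (hVU hx)
    simpa only [he] using hon

namespace AdaptedFrame

variable (𝔉 : AdaptedFrame g W U)

/-- The vector fields of the frame. -/
def F (a : Fin 4 ⊕ Fin 3) (x : N) : TangentSpace (𝓡 7) x :=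
  a.elim (fun i => (𝔉.E i x : TangentSpace (𝓡 7) x)) (fun j => (𝔉.R j x : TangentSpace (𝓡 7) x))

/-- The dual coframe. -/
noncomputable def ε (a : Fin 4 ⊕ Fin 3) (x : N) : TangentSpace (𝓡 7) x →L[ℝ] ℝ :=
  haveI : FiniteDimensional ℝ (TangentSpace (𝓡 7) x) := inferInstanceAs (FiniteDimensional ℝ E7)
  haveI : T2Space (TangentSpace (𝓡 7) x) := inferInstanceAs (T2Space E7)
  a.elim (fun i => LinearMap.toContinuousLinearMap
    ((g.inner x).flip (𝔉.E i x) ∘ₗ W.projH x)) (fun j => 𝔉.θ.η j x)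

theorem ε_inl (i : Fin 4) (x : N) (v : TangentSpace (𝓡 7) x) :
    𝔉.ε (Sum.inl i) x v = g.inner x (W.projH x v) (𝔉.E i x) := rfl

theorem ε_inr (j : Fin 3) (x : N) (v : TangentSpace (𝓡 7) x) :
    𝔉.ε (Sum.inr j) x v = 𝔉.θ.η j x v := rfl

theorem smooth_F (a : Fin 4 ⊕ Fin 3) : SmoothFieldOn U (𝔉.F a) := by
  cases a with
  | inl i => exact 𝔉.smooth_E i
  | inr j => exact 𝔉.dual.1 j

theorem ε_inr_of_mem {x : N} (hx : x ∈ U) (j : Fin 3) {v : TangentSpace (𝓡 7) x} (hv : v ∈ Q.H x) :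
    𝔉.ε (Sum.inr j) x v = 0 := 𝔉.θ.vanish j x hx v hv

theorem projH_of_mem {x : N} {v : TangentSpace (𝓡 7) x} (hv : v ∈ W.W x) : W.projH x v = 0 :=
  (Submodule.projectionOnto_apply_eq_zero_iff (W.isCompl x)).2 hv

theorem ε_inl_of_mem {x : N} (i : Fin 4) {v : TangentSpace (𝓡 7) x} (hv : v ∈ W.W x) :
    𝔉.ε (Sum.inl i) x v = 0 := by
  rw [ε_inl, projH_of_mem hv, map_zero, LinearMap.zero_apply]

theorem projH_coe {x : N} (X : Q.H x) : W.projH x (X : TangentSpace (𝓡 7) x) = X :=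
  Submodule.projectionOnto_apply_left (W.isCompl x) X

theorem eq_sum_E {x : N} (hx : x ∈ U) (X : Q.H x) : X = ∑ i, g.inner x X (𝔉.E i x) • 𝔉.E i x := by
  obtain ⟨e, he⟩ := 𝔉.basis x hx
  have hon := 𝔉.orthonormal x hx
  conv_lhs => rw [← e.sum_repr X]
  refine Finset.sum_congr rfl fun i _ => ?_
  rw [← he]
  congr 1
  conv_rhs => rw [← e.sum_repr X]
  simp [he, hon]

theorem projW_eq_sum (hU : IsOpen U) {x : N} (hx : x ∈ U) (v : TangentSpace (𝓡 7) x) :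
    W.projW x v = ∑ j, 𝔉.θ.η j x v • 𝔉.R j x := by
  have := W.eq_sum 𝔉.θ hU hx (u := fun i => 𝔉.R i x) (𝔉.dual.2 x hx) (W.projW x v)
  simpa only [W.η_projW 𝔉.θ hx] using this

theorem smooth_ε (hU : IsOpen U) (a : Fin 4 ⊕ Fin 3) : SmoothFormOn U (𝔉.ε a) := by
  cases a with
  | inl i =>
    refine smoothFormOn_of_apply hU fun V X hV hVU hX => ?_
    refine g.smooth V (fun x => W.projH x (X x)) (𝔉.E i) hV ?_ ((𝔉.smooth_E i).mono hVU)
    have := hX.sub (SmoothFieldOn.sum fun j =>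
      SmoothFieldOn.smul (((𝔉.θ.smooth j).mono hVU).apply hX) ((𝔉.dual.1 j).mono hVU))
    refine this.congr fun x hx => ?_
    have h1 := W.projH_add_projW x (X x)
    rw [𝔉.projW_eq_sum hU (hVU hx)] at h1
    rw [eq_sub_iff_add_eq]
    simpa using h1
  | inr j => exact 𝔉.θ.smooth j

theorem ε_F {x : N} (hx : x ∈ U) (a b : Fin 4 ⊕ Fin 3) :
    𝔉.ε a x (𝔉.F b x) = if b = a then 1 else 0 := by
  cases a with
  | inl i =>
    cases b with
    | inl k =>
      change g.inner x (W.projH x (𝔉.E k x)) (𝔉.E i x) = _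
      rw [projH_coe, 𝔉.orthonormal x hx]
      simp only [Sum.inl.injEq]
    | inr k => exact (𝔉.ε_inl_of_mem i (𝔉.R k x).2).trans (if_neg (by simp)).symm
  | inr j =>
    cases b with
    | inl k => exact (𝔉.ε_inr_of_mem hx j (𝔉.E k x).2).trans (if_neg (by simp)).symm
    | inr k =>
      refine (𝔉.dual.2 x hx k j).trans ?_
      simp only [Sum.inr.injEq]

theorem eq_sum (hU : IsOpen U) {x : N} (hx : x ∈ U) (v : TangentSpace (𝓡 7) x) :
    v = ∑ a, 𝔉.ε a x v • 𝔉.F a x := by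
  rw [Fintype.sum_sum_type]
  conv_lhs => rw [← W.projH_add_projW x v, 𝔉.projW_eq_sum hU hx, 𝔉.eq_sum_E hx (W.projH x v)]
  simp only [Submodule.coe_sum, Submodule.coe_smul]
  rfl

theorem ext_ε (hU : IsOpen U) {x : N} (hx : x ∈ U) {v w : TangentSpace (𝓡 7) x}
    (h : ∀ a, 𝔉.ε a x v = 𝔉.ε a x w) : v = w := by
  rw [𝔉.eq_sum hU hx v, 𝔉.eq_sum hU hx w]
  simp only [h]

/-- The structure functions of the frame. -/
noncomputable def C (x : N) (a b c : Fin 4 ⊕ Fin 3) : ℝ :=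
  𝔉.ε c x (mlieBracket (𝓡 7) (𝔉.F a) (𝔉.F b) x)

theorem C_swap (x : N) (a b c : Fin 4 ⊕ Fin 3) : 𝔉.C x a b c = - 𝔉.C x b a c := by
  rw [C, C, mlieBracket_swap]
  exact map_neg _ _

/-- The coefficients of the adapted connection in the frame. -/
noncomputable def Γ (x : N) (a b c : Fin 4 ⊕ Fin 3) : ℝ :=
  adaptedCoeff Sum.isLeft (𝔉.C x) a b c

theorem isAdaptedCoeff_Γ (x : N) : IsAdaptedCoeff Sum.isLeft (𝔉.C x) (𝔉.Γ x) :=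
  isAdaptedCoeff_adaptedCoeff (𝔉.C_swap x)

theorem smooth_Γ (hU : IsOpen U) (a b c : Fin 4 ⊕ Fin 3) :
    SmoothFnOn U (fun x => 𝔉.Γ x a b c) := by
  have hC : ∀ a b c, SmoothFnOn U (fun x => 𝔉.C x a b c) := fun a b c =>
    (𝔉.smooth_ε hU c).apply ((𝔉.smooth_F a).mlieBracket hU (𝔉.smooth_F b))
  have hite : ∀ (p : Prop) [Decidable p] {f : N → ℝ}, SmoothFnOn U f →
      SmoothFnOn U (fun x => if p then f x else 0) := fun p _ f hf => by
    by_cases hp : p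
    · simpa only [if_pos hp] using hf
    · simpa only [if_neg hp] using contMDiffOn_const
  exact hite _ (contMDiffOn_const.mul (((hC a b c).sub (hC a c b)).sub (hite _ (hC b c a))))

/-- The connection one-forms of the frame. -/
noncomputable def connForm (x : N) (b c : Fin 4 ⊕ Fin 3) : TangentSpace (𝓡 7) x →L[ℝ] ℝ :=
  ∑ a, 𝔉.Γ x a b c • 𝔉.ε a x

theorem connForm_apply (x : N) (b c : Fin 4 ⊕ Fin 3) (v : TangentSpace (𝓡 7) x) :
    𝔉.connForm x b c v = ∑ a, 𝔉.Γ x a b c * 𝔉.ε a x v := by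
  simp [connForm]

/-- The adapted connection on the domain of the frame. -/
noncomputable def conn (σ : ∀ x : N, TangentSpace (𝓡 7) x) (x : N) :
    TangentSpace (𝓡 7) x →L[ℝ] TangentSpace (𝓡 7) x :=
  ∑ c, (mvfderiv (𝓡 7) (fun y => 𝔉.ε c y (σ y)) x + ∑ b, 𝔉.ε b x (σ x) • 𝔉.connForm x b c).smulRight
    (𝔉.F c x)

theorem conn_apply (σ : ∀ x : N, TangentSpace (𝓡 7) x) (x : N) (v : TangentSpace (𝓡 7) x) :
    𝔉.conn σ x v = ∑ c, (mvfderiv (𝓡 7) (fun y => 𝔉.ε c y (σ y)) x v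
      + ∑ b, 𝔉.ε b x (σ x) * 𝔉.connForm x b c v) • 𝔉.F c x := by
  simp only [conn, sum_apply, ContinuousLinearMap.smulRight_apply, add_apply, smul_apply,
    smul_eq_mul]

theorem ε_conn {x : N} (hx : x ∈ U) (c : Fin 4 ⊕ Fin 3) (σ : ∀ x : N, TangentSpace (𝓡 7) x)
    (v : TangentSpace (𝓡 7) x) : 𝔉.ε c x (𝔉.conn σ x v) =
      mvfderiv (𝓡 7) (fun y => 𝔉.ε c y (σ y)) x v + ∑ b, 𝔉.ε b x (σ x) * 𝔉.connForm x b c v := by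
  rw [conn_apply, map_sum]
  simp only [map_smul, 𝔉.ε_F hx, smul_eq_mul, mul_ite, mul_one, mul_zero, Finset.sum_ite_eq',
    Finset.mem_univ, if_true]

theorem mdifferentiableAt_ε (hU : IsOpen U) {x : N} (hx : x ∈ U) (c : Fin 4 ⊕ Fin 3)
    {σ : ∀ x : N, TangentSpace (𝓡 7) x} (hσ : DiffFieldAt σ x) :
    MDifferentiableAt (𝓡 7) 𝓘(ℝ, ℝ) (fun y => 𝔉.ε c y (σ y)) x :=
  mdifferentiableAt_form_apply hU hx (𝔉.smooth_ε hU c) hσ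

theorem conn_add (hU : IsOpen U) {x : N} (hx : x ∈ U) {σ τ : ∀ x : N, TangentSpace (𝓡 7) x}
    (hσ : DiffFieldAt σ x) (hτ : DiffFieldAt τ x) :
    𝔉.conn (σ + τ) x = 𝔉.conn σ x + 𝔉.conn τ x := by
  ext1 v
  refine 𝔉.ext_ε hU hx fun c => ?_
  rw [add_apply, map_add, 𝔉.ε_conn hx, 𝔉.ε_conn hx, 𝔉.ε_conn hx]
  have h1 : mvfderiv (𝓡 7) (fun y => 𝔉.ε c y ((σ + τ) y)) x = _ :=
    (mvfderiv_congr (Filter.Eventually.of_forall fun y => map_add (𝔉.ε c y) (σ y) (τ y))).trans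
      (mvfderiv_fun_add (𝔉.mdifferentiableAt_ε hU hx c hσ) (𝔉.mdifferentiableAt_ε hU hx c hτ))
  rw [h1, add_apply]
  simp only [Pi.add_apply, map_add, add_mul, Finset.sum_add_distrib]
  ring

theorem conn_leibniz (hU : IsOpen U) {x : N} (hx : x ∈ U) {σ : ∀ x : N, TangentSpace (𝓡 7) x}
    {f : N → ℝ} (hσ : DiffFieldAt σ x) (hf : MDifferentiableAt (𝓡 7) 𝓘(ℝ, ℝ) f x) :
    𝔉.conn (f • σ) x = f x • 𝔉.conn σ x + (mvfderiv (𝓡 7) f x).smulRight (σ x) := by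
  ext1 v
  refine 𝔉.ext_ε hU hx fun c => ?_
  rw [add_apply, map_add, 𝔉.ε_conn hx, smul_apply, map_smul,
    𝔉.ε_conn hx, ContinuousLinearMap.smulRight_apply, map_smul]
  have h1 : mvfderiv (𝓡 7) (fun y => 𝔉.ε c y ((f • σ) y)) x = _ :=
    (mvfderiv_congr (Filter.Eventually.of_forall fun y => map_smul (𝔉.ε c y) (f y) (σ y))).trans
      (mvfderiv_fun_mul hf (𝔉.mdifferentiableAt_ε hU hx c hσ))
  rw [h1]
  simp only [add_apply, smul_apply, Pi.smul_apply',
    map_smul, smul_eq_mul, mul_assoc, ← Finset.mul_sum]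
  ring

theorem smooth_conn (hU : IsOpen U) {σ : ∀ x : N, TangentSpace (𝓡 7) x} (hσ : SmoothFieldOn U σ) :
    ContMDiffOn (𝓡 7) ((𝓡 7).prod 𝓘(ℝ, E7 →L[ℝ] E7)) ∞
      (fun x => Bundle.TotalSpace.mk' (E7 →L[ℝ] E7)
        (E := fun x : N => TangentSpace (𝓡 7) x →L[ℝ] TangentSpace (𝓡 7) x) x (𝔉.conn σ x)) U := by
  refine smoothEndOn_of_apply hU fun V X hV hVU hX => ?_
  simp only [conn_apply, connForm_apply]
  have hσV := hσ.mono hVU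
  have hε := fun c => (𝔉.smooth_ε hU c).mono hVU
  refine SmoothFieldOn.sum fun c => SmoothFieldOn.smul ?_ ((𝔉.smooth_F c).mono hVU)
  refine ContMDiffOn.add (SmoothFnOn.mvfderiv_apply hV ((hε c).apply hσV) hX) ?_
  intro x hx
  refine ContMDiffWithinAt.sum fun b _ => ?_
  refine ContMDiffWithinAt.mul ((hε b).apply hσV x hx) (ContMDiffWithinAt.sum fun a _ => ?_)
  exact ((𝔉.smooth_Γ hU a b c).mono hVU x hx).mul ((hε a).apply hX x hx)

/-- The metric of `TN = H ⊕ W`, sum of the metrics of `H` and `W`, in the frame. -/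
noncomputable def tot (x : N) (u v : TangentSpace (𝓡 7) x) : ℝ := ∑ c, 𝔉.ε c x u * 𝔉.ε c x v

theorem tot_comm (x : N) (u v : TangentSpace (𝓡 7) x) : 𝔉.tot x u v = 𝔉.tot x v u := by
  simp only [tot, mul_comm]

theorem tot_of_mem_H {x : N} (hx : x ∈ U) (v : TangentSpace (𝓡 7) x) (Z : Q.H x) :
    𝔉.tot x v Z = g.inner x (W.projH x v) Z := by
  rw [tot, Fintype.sum_sum_type]
  simp only [𝔉.ε_inr_of_mem hx _ Z.2, mul_zero, Finset.sum_const_zero, add_zero, ε_inl, projH_coe]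
  conv_rhs => rw [𝔉.eq_sum_E hx Z]
  rw [map_sum]
  refine Finset.sum_congr rfl fun i _ => ?_
  rw [map_smul, smul_eq_mul, mul_comm]

theorem tot_of_mem_W {x : N} (v : TangentSpace (𝓡 7) x) (S : W.W x) :
    𝔉.tot x v S = 𝔉.θ.vert x v S := by
  rw [tot, Fintype.sum_sum_type]
  simp only [𝔉.ε_inl_of_mem _ S.2, mul_zero, Finset.sum_const_zero, zero_add, ε_inr]
  rfl

theorem connForm_skew (x : N) (b c : Fin 4 ⊕ Fin 3) (v : TangentSpace (𝓡 7) x) :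
    𝔉.connForm x b c v = - 𝔉.connForm x c b v := by
  rw [connForm_apply, connForm_apply, ← Finset.sum_neg_distrib]
  refine Finset.sum_congr rfl fun a _ => ?_
  have := (𝔉.isAdaptedCoeff_Γ x).skew a b c
  rw [eq_neg_of_add_eq_zero_left this]
  ring

theorem connForm_mixed (x : N) {b c : Fin 4 ⊕ Fin 3} (h : b.isLeft ≠ c.isLeft)
    (v : TangentSpace (𝓡 7) x) : 𝔉.connForm x b c v = 0 := by
  rw [connForm_apply]
  refine Finset.sum_eq_zero fun a _ => ?_
  rw [(𝔉.isAdaptedCoeff_Γ x).mixed a b c h, zero_mul]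

/-- The connection of the frame is metric, because its connection forms are skew-symmetric. -/
theorem mvfderiv_tot (hU : IsOpen U) {x : N} (hx : x ∈ U) {σ τ : ∀ x : N, TangentSpace (𝓡 7) x}
    (hσ : DiffFieldAt σ x) (hτ : DiffFieldAt τ x) (v : TangentSpace (𝓡 7) x) :
    mvfderiv (𝓡 7) (fun y => 𝔉.tot y (σ y) (τ y)) x v =
      𝔉.tot x (𝔉.conn σ x v) (τ x) + 𝔉.tot x (σ x) (𝔉.conn τ x v) := by
  have h1 := mvfderiv_sum_mul Finset.univ (fun c => 𝔉.mdifferentiableAt_ε hU hx c hσ)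
    (fun c => 𝔉.mdifferentiableAt_ε hU hx c hτ) v
  refine h1.trans ?_
  simp only [tot, 𝔉.ε_conn hx, add_mul, mul_add, Finset.sum_add_distrib]
  have h2 : ∑ c, (∑ b, 𝔉.ε b x (σ x) * 𝔉.connForm x b c v) * 𝔉.ε c x (τ x) +
      ∑ c, 𝔉.ε c x (σ x) * ∑ b, 𝔉.ε b x (τ x) * 𝔉.connForm x b c v = 0 := by
    simp only [Finset.sum_mul, Finset.mul_sum]
    rw [Finset.sum_comm, ← Finset.sum_add_distrib]
    refine Finset.sum_eq_zero fun c _ => ?_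
    rw [← Finset.sum_add_distrib]
    refine Finset.sum_eq_zero fun b _ => ?_
    rw [𝔉.connForm_skew x c b]
    ring
  have h3 : ∀ c, 𝔉.ε c x (τ x) * mvfderiv (𝓡 7) (fun y => 𝔉.ε c y (σ y)) x v =
    mvfderiv (𝓡 7) (fun y => 𝔉.ε c y (σ y)) x v * 𝔉.ε c x (τ x) := fun c => mul_comm _ _
  simp only [h3]
  linarith

end AdaptedFrame

end Connection

/-! ### Existence of adapted connections -/

section Adapted

open scoped Topology Bundle
open VectorField

variable {N : Type*} [TopologicalSpace N] [ChartedSpace E7 N] [IsManifold (𝓡 7) ∞ N]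
  {Q : QCStructure N} {g : CompatibleMetric Q} {W : Complement Q} {U : Set N}

/-- The conditions defining an adapted connection, except smoothness. They already determine the
connection, which is used to prove the smoothness. -/
structure IsPreadapted (g : CompatibleMetric Q) (W : Complement Q)
    (cov : CovariantDerivative (𝓡 7) E7 (fun x : N => TangentSpace (𝓡 7) x)) : Prop where
  preserves_H : ∀ (Y : ∀ x : N, Q.H x) (x : N),
    DiffFieldAt (fun y => (Y y : TangentSpace (𝓡 7) y)) x →
    ∀ v, cov (fun y => (Y y : TangentSpace (𝓡 7) y)) x v ∈ Q.H x
  preserves_W : ∀ (R : ∀ x : N, W.W x) (x : N),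
    DiffFieldAt (fun y => (R y : TangentSpace (𝓡 7) y)) x →
    ∀ v, cov (fun y => (R y : TangentSpace (𝓡 7) y)) x v ∈ W.W x
  metric_H : ∀ (Y Z : ∀ x : N, Q.H x) (x : N),
    DiffFieldAt (fun y => (Y y : TangentSpace (𝓡 7) y)) x →
    DiffFieldAt (fun y => (Z y : TangentSpace (𝓡 7) y)) x →
    ∀ v, mvfderiv (𝓡 7) (fun y => g.inner y (Y y) (Z y)) x v
      = g.inner x (W.projH x (cov (fun y => (Y y : TangentSpace (𝓡 7) y)) x v)) (Z x)
        + g.inner x (Y x) (W.projH x (cov (fun y => (Z y : TangentSpace (𝓡 7) y)) x v))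
  metric_W : ∀ (U : Set N) (θ : AdmissibleFrame g U), IsOpen U →
    ∀ (R S : ∀ x : N, W.W x), ∀ x ∈ U,
    DiffFieldAt (fun y => (R y : TangentSpace (𝓡 7) y)) x →
    DiffFieldAt (fun y => (S y : TangentSpace (𝓡 7) y)) x →
    ∀ v, mvfderiv (𝓡 7) (fun y => θ.vert y (R y) (S y)) x v
      = θ.vert x (cov (fun y => (R y : TangentSpace (𝓡 7) y)) x v) (S x)
        + θ.vert x (R x) (cov (fun y => (S y : TangentSpace (𝓡 7) y)) x v)
  torsion_H : ∀ (x : N) (X Y : Q.H x), W.projH x (cov.torsion x X Y) = 0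
  torsion_W : ∀ (x : N) (R S : W.W x), W.projW x (cov.torsion x R S) = 0
  torsion_HW : ∀ (U : Set N) (θ : AdmissibleFrame g U), IsOpen U → ∀ x ∈ U,
    ∀ (X : Q.H x) (R S : W.W x),
    θ.vert x (W.projW x (cov.torsion x X R)) S = θ.vert x R (W.projW x (cov.torsion x X S))
  torsion_WH : ∀ (x : N) (R : W.W x) (X Y : Q.H x),
    g.inner x (W.projH x (cov.torsion x R X)) Y = g.inner x X (W.projH x (cov.torsion x R Y))

theorem AdmissibleFrame.vert_comm (θ : AdmissibleFrame g U) (x : N) (v w : TangentSpace (𝓡 7) x) :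
    θ.vert x v w = θ.vert x w v := by
  simp only [vert, mul_comm]

/-- The metric `∑ η_i²` does not depend on the admissible frame. -/
theorem AdmissibleFrame.vert_eq {U' : Set N} (θ : AdmissibleFrame g U) (hU : IsOpen U)
    (θ' : AdmissibleFrame g U') (hU' : IsOpen U') {x : N} (hx : x ∈ U) (hx' : x ∈ U')
    (v w : TangentSpace (𝓡 7) x) : θ'.vert x v w = θ.vert x v w := by
  obtain ⟨u, hu⟩ := θ.exists_isDualAt hU hx
  obtain ⟨f, A, ψ, -, hA, -, hη, -, -, hf⟩ := θ.exists_change hU θ' hU' hx hx' hu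
  obtain ⟨rfl, -⟩ := hf rfl
  have h := sum_mul_left hA
  simp only [vert, hη, one_mul]
  calc ∑ i, (∑ k, A i k * θ.η k x v) * ∑ l, A i l * θ.η l x w
      = ∑ k, ∑ l, (∑ i, A i k * A i l) * (θ.η k x v * θ.η l x w) := by
        simp only [Finset.sum_mul, Finset.mul_sum]
        rw [Finset.sum_comm]
        refine (Finset.sum_congr rfl fun l _ => Finset.sum_comm).trans ?_
        rw [Finset.sum_comm]
        refine Finset.sum_congr rfl fun k _ => Finset.sum_congr rfl fun l _ =>
          Finset.sum_congr rfl fun i _ => ?_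
        ring
    _ = _ := by simp [h]

/-- The Leibniz rule for a finite sum of multiples of vector fields. -/
theorem covariantDerivative_sum_smul {κ : Type*}
    (cov : CovariantDerivative (𝓡 7) E7 (fun x : N => TangentSpace (𝓡 7) x)) (s : Finset κ)
    {f : κ → N → ℝ} {F : κ → ∀ x : N, TangentSpace (𝓡 7) x} {x : N}
    (hf : ∀ i, MDifferentiableAt (𝓡 7) 𝓘(ℝ, ℝ) (f i) x) (hF : ∀ i, DiffFieldAt (F i) x) :
    DiffFieldAt (fun y => ∑ i ∈ s, f i y • F i y) x ∧
      cov (fun y => ∑ i ∈ s, f i y • F i y) x =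
        ∑ i ∈ s, (f i x • cov (F i) x + (mvfderiv (𝓡 7) (f i) x).smulRight (F i x)) := by
  classical
  induction s using Finset.induction_on with
  | empty =>
    simp only [Finset.sum_empty]
    exact ⟨Bundle.mdifferentiableAt_zeroSection .., cov.isCovariantDerivativeOnUniv.zero⟩
  | insert a s ha ih =>
    have h1 : DiffFieldAt (f a • F a) x := MDifferentiableAt.smul_section (hf a) (hF a)
    have h2 : (fun y => ∑ i ∈ insert a s, f i y • F i y) =
        f a • F a + fun y => ∑ i ∈ s, f i y • F i y := by
      ext1 y
      rw [Finset.sum_insert ha]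
      rfl
    rw [h2]
    refine ⟨mdifferentiableAt_add_section h1 ih.1, ?_⟩
    rw [cov.isCovariantDerivativeOnUniv.add h1 ih.1,
      cov.isCovariantDerivativeOnUniv.leibniz (hF a) (hf a), Finset.sum_insert ha]
    exact congrArg (_ + ·) ih.2

namespace AdaptedFrame

variable (𝔉 : AdaptedFrame g W U)

theorem vert_R {x : N} (hx : x ∈ U) (v : TangentSpace (𝓡 7) x) (k : Fin 3) :
    𝔉.θ.vert x v (𝔉.R k x) = 𝔉.θ.η k x v := by
  have h := fun j => 𝔉.dual.2 x hx k j
  simp only at h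
  simp [AdmissibleFrame.vert, h]

theorem diffFieldAt_F (hU : IsOpen U) {x : N} (hx : x ∈ U) (a : Fin 4 ⊕ Fin 3) :
    DiffFieldAt (𝔉.F a) x := (𝔉.smooth_F a).diffFieldAt hU hx

theorem ε_torsion_F (cov : CovariantDerivative (𝓡 7) E7 (fun x : N => TangentSpace (𝓡 7) x))
    (hU : IsOpen U) {x : N} (hx : x ∈ U) (a b c : Fin 4 ⊕ Fin 3) :
    𝔉.ε c x (cov.torsion x (𝔉.F a x) (𝔉.F b x)) =
      𝔉.ε c x (cov (𝔉.F b) x (𝔉.F a x)) - 𝔉.ε c x (cov (𝔉.F a) x (𝔉.F b x)) - 𝔉.C x a b c := by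
  rw [cov.torsion_apply (𝔉.diffFieldAt_F hU hx a) (𝔉.diffFieldAt_F hU hx b), map_sub, map_sub]
  rfl

/-- The coefficients of an adapted connection solve the linear system `IsAdaptedCoeff`. -/
theorem isAdaptedCoeff_of_isPreadapted
    {cov : CovariantDerivative (𝓡 7) E7 (fun x : N => TangentSpace (𝓡 7) x)}
    (h : IsPreadapted g W cov) (hU : IsOpen U) {x : N} (hx : x ∈ U) :
    IsAdaptedCoeff Sum.isLeft (𝔉.C x)
      (fun a b c => 𝔉.ε c x (cov (𝔉.F b) x (𝔉.F a x))) := by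
  have hE : ∀ i, DiffFieldAt (fun y => (𝔉.E i y : TangentSpace (𝓡 7) y)) x := fun i =>
    𝔉.diffFieldAt_F hU hx (Sum.inl i)
  have hR : ∀ j, DiffFieldAt (fun y => (𝔉.R j y : TangentSpace (𝓡 7) y)) x := fun j =>
    𝔉.diffFieldAt_F hU hx (Sum.inr j)
  have hmixed : ∀ (b c : Fin 4 ⊕ Fin 3) (v : TangentSpace (𝓡 7) x), b.isLeft ≠ c.isLeft →
      𝔉.ε c x (cov (𝔉.F b) x v) = 0 := by
    rintro (i | i) (j | j) v hbc
    · exact absurd rfl hbc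
    · exact 𝔉.ε_inr_of_mem hx j (h.preserves_H (𝔉.E i) x (hE i) v)
    · exact 𝔉.ε_inl_of_mem j (h.preserves_W (𝔉.R i) x (hR i) v)
    · exact absurd rfl hbc
  have hτ := 𝔉.ε_torsion_F cov hU hx
  refine ⟨fun a b c hbc => hmixed b c _ hbc, fun a b c => ?_, fun a b c hab hbc => ?_,
    fun a b c hab hbc => ?_⟩
  · by_cases hbc : b.isLeft = c.isLeft
    · rcases b with i | i <;> rcases c with j | j <;> simp only [Sum.isLeft_inl, Sum.isLeft_inr,
        Bool.true_eq_false, Bool.false_eq_true] at hbc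
      · have h1 := h.metric_H (𝔉.E i) (𝔉.E j) x (hE i) (hE j) (𝔉.F a x)
        rw [mvfderiv_eq_zero_of_eventually_const (c := if i = j then 1 else 0)
          (Filter.mem_of_superset (hU.mem_nhds hx) fun y hy => 𝔉.orthonormal y hy i j),
          g.symm x (𝔉.E i x)] at h1
        exact h1.symm
      · have h1 := h.metric_W U 𝔉.θ hU (𝔉.R i) (𝔉.R j) x hx (hR i) (hR j) (𝔉.F a x)
        rw [mvfderiv_eq_zero_of_eventually_const (c := if i = j then 1 else 0)
          (Filter.mem_of_superset (hU.mem_nhds hx) fun y hy =>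
            (𝔉.vert_R hy _ j).trans (𝔉.dual.2 y hy i j)), 𝔉.θ.vert_comm x (𝔉.R i x), 𝔉.vert_R hx,
            𝔉.vert_R hx] at h1
        exact h1.symm
    · rw [hmixed b c _ hbc, hmixed c b _ (Ne.symm hbc), add_zero]
  · have h1 : 𝔉.ε c x (cov.torsion x (𝔉.F a x) (𝔉.F b x)) = 0 := by
      rcases a with i | i <;> rcases b with j | j <;> rcases c with k | k <;>
        simp only [Sum.isLeft_inl, Sum.isLeft_inr, Bool.true_eq_false, Bool.false_eq_true]
          at hab hbc
      · rw [ε_inl]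
        have := h.torsion_H x (𝔉.E i x) (𝔉.E j x)
        exact (congrArg (fun z => g.inner x z (𝔉.E k x)) this).trans (by simp)
      · have := h.torsion_W x (𝔉.R i x) (𝔉.R j x)
        rw [ε_inr, ← W.η_projW 𝔉.θ hx]
        exact (congrArg (fun z : W.W x => 𝔉.θ.η k x (z : TangentSpace (𝓡 7) x)) this).trans
          (by simp)
    rw [hτ] at h1
    exact sub_eq_zero.1 h1
  · have h0 : 𝔉.ε c x (cov (𝔉.F a) x (𝔉.F b x)) = 0 :=
      hmixed a c _ (fun e => hab (e.trans hbc.symm))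
    have h0' : 𝔉.ε b x (cov (𝔉.F a) x (𝔉.F c x)) = 0 := hmixed a b _ hab
    have h1 : 𝔉.ε c x (cov.torsion x (𝔉.F a x) (𝔉.F b x)) =
        𝔉.ε b x (cov.torsion x (𝔉.F a x) (𝔉.F c x)) := by
      rcases a with i | i <;> rcases b with j | j <;> rcases c with k | k <;>
        simp only [Sum.isLeft_inl, Sum.isLeft_inr, Bool.true_eq_false, Bool.false_eq_true,
          not_true_eq_false, ne_eq] at hab hbc
      · have := h.torsion_HW U 𝔉.θ hU x hx (𝔉.E i x) (𝔉.R j x) (𝔉.R k x)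
        rw [𝔉.vert_R hx, 𝔉.θ.vert_comm x (𝔉.R j x), 𝔉.vert_R hx, W.η_projW 𝔉.θ hx,
          W.η_projW 𝔉.θ hx] at this
        exact this
      · have := h.torsion_WH x (𝔉.R i x) (𝔉.E j x) (𝔉.E k x)
        rw [g.symm x (𝔉.E j x)] at this
        exact this
    rw [hτ, hτ, h0, h0', sub_zero, sub_zero] at h1
    exact h1

/-- An adapted connection is given by `conn` in every adapted frame. -/
theorem eq_conn_of_isPreadapted
    {cov : CovariantDerivative (𝓡 7) E7 (fun x : N => TangentSpace (𝓡 7) x)}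
    (h : IsPreadapted g W cov) (hU : IsOpen U) {x : N} (hx : x ∈ U)
    {σ : ∀ x : N, TangentSpace (𝓡 7) x} (hσ : DiffFieldAt σ x) :
    cov σ x = 𝔉.conn σ x := by
  have hG := 𝔉.isAdaptedCoeff_of_isPreadapted h hU hx
  obtain ⟨h1, h2⟩ := covariantDerivative_sum_smul cov Finset.univ
    (fun b => 𝔉.mdifferentiableAt_ε hU hx b hσ) (𝔉.diffFieldAt_F hU hx)
  have h3 : cov σ x = cov (fun y => ∑ b, 𝔉.ε b y (σ y) • 𝔉.F b y) x :=
    cov.isCovariantDerivativeOnUniv.congr_of_eventuallyEq hσ h1 Filter.univ_mem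
      (Filter.mem_of_superset (hU.mem_nhds hx) fun y hy => 𝔉.eq_sum hU hy (σ y))
  rw [h3, h2]
  ext1 v
  refine 𝔉.ext_ε hU hx fun c => ?_
  have h4 : ∀ b, 𝔉.ε c x (cov (𝔉.F b) x v) = 𝔉.connForm x b c v := fun b => by
    conv_lhs => rw [𝔉.eq_sum hU hx v]
    rw [map_sum, map_sum, connForm_apply]
    refine Finset.sum_congr rfl fun a _ => ?_
    rw [map_smul, map_smul, smul_eq_mul, mul_comm]
    congr 1
    exact hG.eq_adaptedCoeff a b c
  rw [𝔉.ε_conn hx, sum_apply, map_sum]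
  have h5 : ∀ b, 𝔉.ε c x (((𝔉.ε b x (σ x)) • cov (𝔉.F b) x +
      (mvfderiv (𝓡 7) (fun y => 𝔉.ε b y (σ y)) x).smulRight (𝔉.F b x)) v) =
      𝔉.ε b x (σ x) * 𝔉.connForm x b c v +
        mvfderiv (𝓡 7) (fun y => 𝔉.ε b y (σ y)) x v * if b = c then 1 else 0 := fun b => by
    rw [add_apply, map_add, smul_apply, map_smul, h4, ContinuousLinearMap.smulRight_apply, map_smul,
      𝔉.ε_F hx, smul_eq_mul, smul_eq_mul]
  simp only [h5, Finset.sum_add_distrib, mul_ite, mul_one, mul_zero, Finset.sum_ite_eq',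
    Finset.mem_univ, if_true]
  rw [add_comm]

/-- The components of the torsion of the connection `conn` in the frame. -/
theorem ε_torsion {cov : CovariantDerivative (𝓡 7) E7 (fun x : N => TangentSpace (𝓡 7) x)}
    (hU : IsOpen U) {x : N} (hx : x ∈ U) (hcov : ∀ σ, cov σ x = 𝔉.conn σ x)
    (c : Fin 4 ⊕ Fin 3) (u v : TangentSpace (𝓡 7) x) :
    𝔉.ε c x (cov.torsion x u v) = ∑ a, ∑ b, 𝔉.ε a x u * 𝔉.ε b x v *
      (𝔉.Γ x a b c - 𝔉.Γ x b a c - 𝔉.C x a b c) := by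
  have h1 : ∀ a b, 𝔉.ε c x (cov (𝔉.F b) x (𝔉.F a x)) = 𝔉.Γ x a b c := fun a b => by
    rw [hcov, 𝔉.ε_conn hx, mvfderiv_eq_zero_of_eventually_const (c := if b = c then 1 else 0)
      (Filter.mem_of_superset (hU.mem_nhds hx) fun y hy => 𝔉.ε_F hy c b)]
    simp only [connForm_apply, 𝔉.ε_F hx, ite_mul, mul_ite, mul_one, one_mul, zero_mul, mul_zero,
      Finset.sum_ite_eq, Finset.mem_univ, if_true, zero_apply, zero_add]
  conv_lhs => rw [𝔉.eq_sum hU hx u, 𝔉.eq_sum hU hx v]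
  simp only [map_sum, sum_apply, map_smul, smul_apply, smul_eq_mul, Finset.mul_sum]
  rw [Finset.sum_comm]
  refine Finset.sum_congr rfl fun a _ => Finset.sum_congr rfl fun b _ => ?_
  rw [𝔉.ε_torsion_F cov hU hx, h1, h1]
  ring

end AdaptedFrame

/-- A connection given at every point by an adapted frame has all the properties of an adapted
connection but smoothness. -/
theorem isPreadapted_of_conn
    {cov : CovariantDerivative (𝓡 7) E7 (fun x : N => TangentSpace (𝓡 7) x)}
    (hcov : ∀ x, ∃ (U : Set N) (𝔉 : AdaptedFrame g W U), IsOpen U ∧ x ∈ U ∧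
      ∀ σ, cov σ x = 𝔉.conn σ x) : IsPreadapted g W cov where
  preserves_H Y x _ v := by
    obtain ⟨U, 𝔉, hU, hx, h⟩ := hcov x
    rw [𝔉.θ.mem_H_iff hU hx]
    intro j
    rw [← 𝔉.ε_inr, h, 𝔉.ε_conn hx, mvfderiv_eq_zero_of_eventually_const (c := 0)
      (Filter.mem_of_superset (hU.mem_nhds hx) fun y hy => 𝔉.ε_inr_of_mem hy j (Y y).2),
      zero_apply, zero_add, Fintype.sum_sum_type]
    simp only [𝔉.ε_inr_of_mem hx _ (Y x).2, zero_mul, Finset.sum_const_zero, add_zero]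
    refine Finset.sum_eq_zero fun i _ => ?_
    rw [𝔉.connForm_mixed x (by simp), mul_zero]
  preserves_W R x _ v := by
    obtain ⟨U, 𝔉, hU, hx, h⟩ := hcov x
    have h1 : ∀ i, 𝔉.ε (Sum.inl i) x (cov (fun y => (R y : TangentSpace (𝓡 7) y)) x v) = 0 := by
      intro i
      rw [h, 𝔉.ε_conn hx, mvfderiv_eq_zero_of_eventually_const (c := 0)
        (Filter.Eventually.of_forall fun y => 𝔉.ε_inl_of_mem i (R y).2),
        zero_apply, zero_add, Fintype.sum_sum_type]
      simp only [𝔉.ε_inl_of_mem _ (R x).2, zero_mul, Finset.sum_const_zero, zero_add]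
      refine Finset.sum_eq_zero fun j _ => ?_
      rw [𝔉.connForm_mixed x (by simp), mul_zero]
    rw [𝔉.eq_sum hU hx (cov (fun y => (R y : TangentSpace (𝓡 7) y)) x v), Fintype.sum_sum_type]
    simp only [h1, zero_smul, Finset.sum_const_zero, zero_add]
    exact Submodule.sum_mem _ fun j _ => Submodule.smul_mem _ _ (𝔉.R j x).2
  metric_H Y Z x hY hZ v := by
    obtain ⟨U, 𝔉, hU, hx, h⟩ := hcov x
    have h1 := 𝔉.mvfderiv_tot hU hx hY hZ v
    rw [𝔉.tot_of_mem_H hx, 𝔉.tot_comm x (Y x), 𝔉.tot_of_mem_H hx, g.symm x _ (Y x), ← h, ← h] at h1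
    rw [← h1]
    refine congrArg (fun φ => φ v) (mvfderiv_congr (Filter.mem_of_superset (hU.mem_nhds hx)
      fun y hy => ?_))
    change _ = 𝔉.tot y (Y y) (Z y)
    rw [𝔉.tot_of_mem_H hy, AdaptedFrame.projH_coe]
  metric_W U' θ' hU' R S x hx' hR hS v := by
    obtain ⟨U, 𝔉, hU, hx, h⟩ := hcov x
    have h1 := 𝔉.mvfderiv_tot hU hx hR hS v
    rw [𝔉.tot_of_mem_W, 𝔉.tot_comm x (R x), 𝔉.tot_of_mem_W, 𝔉.θ.vert_comm x _ (R x), ← h, ← h] at h1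
    rw [𝔉.θ.vert_eq hU θ' hU' hx hx', 𝔉.θ.vert_eq hU θ' hU' hx hx', ← h1]
    refine congrArg (fun φ => φ v) (mvfderiv_congr (Filter.mem_of_superset
      ((hU.inter hU').mem_nhds ⟨hx, hx'⟩) fun y hy => ?_))
    change _ = 𝔉.tot y (R y) (S y)
    rw [𝔉.tot_of_mem_W, 𝔉.θ.vert_eq hU θ' hU' hy.1 hy.2]
  torsion_H x X Y := by
    obtain ⟨U, 𝔉, hU, hx, h⟩ := hcov x
    have h1 : ∀ i, g.inner x (W.projH x (cov.torsion x X Y)) (𝔉.E i x) = 0 := fun i => by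
      rw [← 𝔉.ε_inl, 𝔉.ε_torsion hU hx h]
      refine Finset.sum_eq_zero fun a _ => Finset.sum_eq_zero fun b _ => ?_
      rcases a with a | a
      · rcases b with b | b
        · rw [(𝔉.isAdaptedCoeff_Γ x).torsion _ _ _ (by simp) (by simp), sub_self, mul_zero]
        · rw [𝔉.ε_inr_of_mem hx b Y.2, mul_zero, zero_mul]
      · rw [𝔉.ε_inr_of_mem hx a X.2, zero_mul, zero_mul]
    rw [𝔉.eq_sum_E hx (W.projH x (cov.torsion x X Y))]
    simp [h1]
  torsion_W x R S := by
    obtain ⟨U, 𝔉, hU, hx, h⟩ := hcov x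
    rw [𝔉.projW_eq_sum hU hx]
    refine Finset.sum_eq_zero fun j _ => ?_
    rw [← 𝔉.ε_inr, 𝔉.ε_torsion hU hx h]
    convert zero_smul ℝ _ using 2
    refine Finset.sum_eq_zero fun a _ => Finset.sum_eq_zero fun b _ => ?_
    rcases a with a | a
    · rw [𝔉.ε_inl_of_mem a R.2, zero_mul, zero_mul]
    · rcases b with b | b
      · rw [𝔉.ε_inl_of_mem b S.2, mul_zero, zero_mul]
      · rw [(𝔉.isAdaptedCoeff_Γ x).torsion _ _ _ (by simp) (by simp), sub_self, mul_zero]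
  torsion_HW U' θ' hU' x hx' X R S := by
    obtain ⟨U, 𝔉, hU, hx, h⟩ := hcov x
    have h1 : ∀ v : TangentSpace (𝓡 7) x, ∀ S : W.W x,
        θ'.vert x (W.projW x v) S = 𝔉.tot x v S := fun v S => by
      rw [𝔉.θ.vert_eq hU θ' hU' hx hx', 𝔉.tot_of_mem_W]
      simp only [AdmissibleFrame.vert, W.η_projW 𝔉.θ hx]
    have h2 : θ'.vert x R (W.projW x (cov.torsion x X S)) =
        θ'.vert x (W.projW x (cov.torsion x X S)) R := by
      simp only [AdmissibleFrame.vert, mul_comm]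
    rw [h2, h1, h1]
    simp only [AdaptedFrame.tot, 𝔉.ε_torsion hU hx h, Finset.sum_mul]
    rw [Finset.sum_comm]
    conv_rhs => rw [Finset.sum_comm]
    refine Finset.sum_congr rfl fun a _ => ?_
    rw [Finset.sum_comm]
    refine Finset.sum_congr rfl fun b _ => Finset.sum_congr rfl fun c _ => ?_
    rcases a with a | a
    · rcases b with b | b
      · rw [𝔉.ε_inl_of_mem b R.2]; ring
      · rcases c with c | c
        · rw [𝔉.ε_inl_of_mem c S.2]; ring
        · have e1 := (𝔉.isAdaptedCoeff_Γ x).symm (Sum.inl a) (Sum.inr b) (Sum.inr c) (by simp)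
            (by simp)
          have e2 := (𝔉.isAdaptedCoeff_Γ x).mixed (Sum.inr b) (Sum.inl a) (Sum.inr c) (by simp)
          have e3 := (𝔉.isAdaptedCoeff_Γ x).mixed (Sum.inr c) (Sum.inl a) (Sum.inr b) (by simp)
          rw [e2, e3, sub_zero, sub_zero, e1]
          ring
    · rw [𝔉.ε_inr_of_mem hx a X.2]; ring
  torsion_WH x R X Y := by
    obtain ⟨U, 𝔉, hU, hx, h⟩ := hcov x
    rw [g.symm x X, ← 𝔉.tot_of_mem_H hx, ← 𝔉.tot_of_mem_H hx]
    simp only [AdaptedFrame.tot, 𝔉.ε_torsion hU hx h, Finset.sum_mul]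
    rw [Finset.sum_comm]
    conv_rhs => rw [Finset.sum_comm]
    refine Finset.sum_congr rfl fun a _ => ?_
    rw [Finset.sum_comm]
    refine Finset.sum_congr rfl fun b _ => Finset.sum_congr rfl fun c _ => ?_
    rcases a with a | a
    · rw [𝔉.ε_inl_of_mem a R.2]; ring
    · rcases b with b | b
      · rcases c with c | c
        · have e1 := (𝔉.isAdaptedCoeff_Γ x).symm (Sum.inr a) (Sum.inl b) (Sum.inl c) (by simp)
            (by simp)
          have e2 := (𝔉.isAdaptedCoeff_Γ x).mixed (Sum.inl b) (Sum.inr a) (Sum.inl c) (by simp)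
          have e3 := (𝔉.isAdaptedCoeff_Γ x).mixed (Sum.inl c) (Sum.inr a) (Sum.inl b) (by simp)
          rw [e2, e3, sub_zero, sub_zero, e1]
          ring
        · rw [𝔉.ε_inr_of_mem hx c Y.2]; ring
      · rw [𝔉.ε_inr_of_mem hx b X.2]; ring

/-- Every complement has an adapted connection. It is given at each point by an adapted frame around
this point; it is smooth because, by uniqueness, each frame gives it on the whole domain of the
frame. -/
theorem exists_isAdapted (g : CompatibleMetric Q) (W : Complement Q) :
    ∃ cov : CovariantDerivative (𝓡 7) E7 (fun x : N => TangentSpace (𝓡 7) x),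
      IsAdapted g W cov := by
  choose U 𝔉 hU hx using exists_adaptedFrame g W
  let cov : CovariantDerivative (𝓡 7) E7 (fun x : N => TangentSpace (𝓡 7) x) :=
    { toFun := fun σ x => (𝔉 x).conn σ x
      isCovariantDerivativeOnUniv :=
        { add := fun {σ τ x} hσ hτ _ => (𝔉 x).conn_add (hU x) (hx x) hσ hτ
          leibniz := fun {σ f x} hσ hf _ => (𝔉 x).conn_leibniz (hU x) (hx x) hσ hf } }
  have h : IsPreadapted g W cov :=
    isPreadapted_of_conn fun x => ⟨U x, 𝔉 x, hU x, hx x, fun σ => rfl⟩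
  refine ⟨cov, ⟨⟨⟨fun {σ} hσ => ?_⟩⟩, h.preserves_H, h.preserves_W, h.metric_H, h.metric_W,
    h.torsion_H, h.torsion_W, h.torsion_HW, h.torsion_WH⟩⟩
  intro x₀ _
  have hσ' : SmoothFieldOn Set.univ σ := hσ.of_le (by simp)
  have h1 := (𝔉 x₀).smooth_conn (hU x₀) (hσ'.mono (Set.subset_univ (U x₀)))
  have h2 := h1.contMDiffAt ((hU x₀).mem_nhds (hx x₀))
  refine ContMDiffAt.contMDiffWithinAt (h2.congr_of_eventuallyEq ?_)
  refine Filter.mem_of_superset ((hU x₀).mem_nhds (hx x₀)) fun y hy => ?_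
  have h3 := (𝔉 x₀).eq_conn_of_isPreadapted h (hU x₀) hy
    (hσ'.diffFieldAt isOpen_univ (Set.mem_univ y))
  exact congrArg (Bundle.TotalSpace.mk' (E7 →L[ℝ] E7)
    (E := fun x : N => TangentSpace (𝓡 7) x →L[ℝ] TangentSpace (𝓡 7) x) y) h3

end Adapted

/-! ### The vertical torsion -/

section VerticalTorsion

open scoped Topology Bundle
open VectorField

variable {N : Type*} [TopologicalSpace N] [ChartedSpace E7 N] [IsManifold (𝓡 7) ∞ N]
  {Q : QCStructure N} {g : CompatibleMetric Q} {W : Complement Q} {U : Set N}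

/-- The vertical torsion is `-1/2` times `i_{R_i} dη_j|_H + i_{R_j} dη_i|_H`: since the connection
is metric, the components `η_j(∇_X R_i)` are skew-symmetric, and drop out when the symmetric tensor
`η_j(T_{X,R_i}) = η_j(∇_X R_i) - dη_j(R_i, X)` is symmetrized. -/
theorem IsVerticalTorsion.eq_vertForm {T : ∀ x : N, Q.H x →ₗ[ℝ] W.W x →ₗ[ℝ] W.W x}
    (hT : IsVerticalTorsion g W T) (θ : AdmissibleFrame g U) (hU : IsOpen U) {x : N} (hx : x ∈ U)
    {u : Fin 3 → W.W x} (hu : θ.IsDualAt x (fun i => u i)) (X : Q.H x) (i j : Fin 3) :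
    θ.η j x (T x X (u i) : TangentSpace (𝓡 7) x) =
      -(1 / 2) * θ.vertForm x (fun i => u i) i j X := by
  obtain ⟨cov, hcov, hTcov⟩ := hT
  obtain ⟨V, hVU, hV, hxV, R, hR⟩ := W.exists_isDualFrame θ hU hx
  have huR : ∀ i, u i = R i x := fun i => by
    have := W.eq_sum θ hU hx (u := fun i => R i x) (hR.2 x hxV) (u i)
    rw [this]
    simp [fun j => hu i j]
  have hRd : ∀ i, DiffFieldAt (fun y => (R i y : TangentSpace (𝓡 7) y)) x := fun i =>
    (hR.1 i).diffFieldAt hV hxV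
  obtain ⟨O, Z, hO, hxO, hZ, hZx⟩ := Q.isDistribution.exists_extension x X
  have hZd := hZ.diffFieldAt hO hxO
  have hdual : ∀ y ∈ V, ∀ i j, θ.η j y (R i y) = if i = j then 1 else 0 := hR.2
  have hvert : ∀ y ∈ V, ∀ (v : TangentSpace (𝓡 7) y) (k : Fin 3), θ.vert y v (R k y) = θ.η k y v :=
    fun y hy v k => by simp [AdmissibleFrame.vert, fun j => hdual y hy k j]
  let G : Fin 3 → Fin 3 → ℝ := fun i j =>
    θ.η j x (cov (fun y => (R i y : TangentSpace (𝓡 7) y)) x X)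
  -- `R` is orthonormal, so metric compatibility makes the connection coefficients skew-symmetric
  have hskew : ∀ i j, G i j + G j i = 0 := fun i j => by
    have h1 := hcov.metric_W U θ hU (R i) (R j) x hx (hRd i) (hRd j) X
    rw [mvfderiv_eq_zero_of_eventually_const (c := if i = j then 1 else 0)
      (Filter.mem_of_superset (hV.mem_nhds hxV) fun y hy => (hvert y hy _ j).trans
        (hdual y hy i j)), hvert x hxV, θ.vert_comm x (R i x), hvert x hxV] at h1
    exact h1.symm
  -- the term `η_j(∇_R X)` of the torsion vanishes, because the connection preserves `H`
  have htor : ∀ i j, θ.η j x (cov.torsion x X (R i x)) =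
      G i j - extD (θ.η j) x (R i x : TangentSpace (𝓡 7) x) (X : TangentSpace (𝓡 7) x) := by
    intro i j
    have h1 := cov.torsion_apply hZd (hRd i)
    have h2 := θ.vanish j x hx _ (hcov.preserves_H Z x hZd (R i x))
    have h3 := extD_eq_neg_bracket hV ((θ.smooth j).mono hVU) hxV hZd (hRd i)
      (a := 0) (b := if i = j then 1 else 0)
      (Filter.mem_of_superset (hV.mem_nhds hxV) fun y hy => θ.vanish j y (hVU hy) _ (Z y).2)
      (Filter.mem_of_superset (hV.mem_nhds hxV) fun y hy => hdual y hy i j)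
    have h4 := congrArg (θ.η j x) h1
    rw [map_sub, map_sub, h2, sub_zero] at h4
    rw [extD_swap] at h3
    rw [hZx] at h3 h4
    rw [h4]
    simp only [G]
    linarith
  have hsymm : ∀ i j, θ.η j x (cov.torsion x X (R i x)) = θ.η i x (cov.torsion x X (R j x)) := by
    intro i j
    have h1 := hcov.torsion_HW U θ hU x hx X (R i x) (R j x)
    rwa [hvert x hxV, θ.vert_comm x (R i x), hvert x hxV, W.η_projW θ hx, W.η_projW θ hx] at h1
  rw [hTcov, W.η_projW θ hx, AdmissibleFrame.vertForm_apply, huR, huR]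
  have h1 := htor i j
  have h2 := htor j i
  have h3 := hskew i j
  have h4 := hsymm i j
  linarith

theorem IsVerticalTorsion.unique {T T' : ∀ x : N, Q.H x →ₗ[ℝ] W.W x →ₗ[ℝ] W.W x}
    (hT : IsVerticalTorsion g W T) (hT' : IsVerticalTorsion g W T') : T = T' := by
  funext x
  obtain ⟨U, E, θ, hU, hx, -⟩ := g.exists_admissibleFrame x
  obtain ⟨u, hu⟩ := W.exists_isDualAt θ hU hx
  refine LinearMap.ext fun X => LinearMap.ext fun S => ?_
  have h : ∀ i, T x X (u i) = T' x X (u i) := fun i => by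
    rw [W.eq_sum θ hU hx hu (T x X (u i)), W.eq_sum θ hU hx hu (T' x X (u i))]
    simp only [hT.eq_vertForm θ hU hx hu, hT'.eq_vertForm θ hU hx hu]
  rw [W.eq_sum θ hU hx hu S, map_sum, map_sum]
  simp only [map_smul, h]

theorem exists_isVerticalTorsion (g : CompatibleMetric Q) (W : Complement Q) :
    ∃ T, IsVerticalTorsion g W T := by
  obtain ⟨cov, hcov⟩ := exists_isAdapted g W
  exact ⟨fun x => LinearMap.mk₂ ℝ
    (fun (X : Q.H x) (R : W.W x) => W.projW x (cov.torsion x X R))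
    (fun X Y R => by simp) (fun c X R => by simp) (fun X R S => by simp) (fun c X R => by simp),
    cov, hcov, fun x X R => rfl⟩

theorem IsVerticalTorsion.torsionComponents_eq {T : ∀ x : N, Q.H x →ₗ[ℝ] W.W x →ₗ[ℝ] W.W x}
    (hT : IsVerticalTorsion g W T) (θ : AdmissibleFrame g U) (hU : IsOpen U) {x : N} (hx : x ∈ U)
    {u : Fin 3 → W.W x} (hu : θ.IsDualAt x (fun i => u i)) :
    torsionComponents θ T x u = (-(1 / 2) : ℝ) • θ.vertForm x (fun i => u i) := by
  ext i j X
  exact hT.eq_vertForm θ hU hx hu X i j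

/-- The torsion of `W` is a section of `S^{5,1}` exactly if `W` is normalized, the torsion being
`-1/2` times the covectors in the definition of `IsNormalized`. -/
theorem isReducing_iff : IsReducing g W ↔ IsNormalized g W := by
  have key : ∀ {T}, IsVerticalTorsion g W T → (TorsionInS51 g T ↔ IsNormalized g W) := by
    intro T hT
    refine forall_congr' fun U => forall_congr' fun θ => forall_congr' fun hU =>
      forall_congr' fun x => forall_congr' fun hx => forall_congr' fun u =>
      forall_congr' fun hu => ?_
    rw [hT.torsionComponents_eq θ hU hx hu]
    exact Submodule.smul_mem_iff _ (by norm_num)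
  constructor
  · rintro ⟨T, hT, hS⟩
    exact (key hT).1 hS
  · intro h
    obtain ⟨T, hT⟩ := exists_isVerticalTorsion g W
    exact ⟨T, hT, (key hT).2 h⟩

theorem IsVerticalTorsion.torsionS51PartVanishes_iff
    {T : ∀ x : N, Q.H x →ₗ[ℝ] W.W x →ₗ[ℝ] W.W x} (hT : IsVerticalTorsion g W T) :
    TorsionS51PartVanishes g T ↔ ∀ x, Q.ObstructionVanishesAt x := by
  have key : ∀ {U : Set N} (θ : AdmissibleFrame g U) (_ : IsOpen U) {x : N} (_ : x ∈ U)
      {u : Fin 3 → W.W x} (_ : θ.IsDualAt x (fun i => u i)),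
      IsS51Part (fun i => θ.I i x) (torsionComponents θ T x u) 0 ↔ Q.ObstructionVanishesAt x := by
    intro U θ hU x hx u hu
    rw [isS51Part_zero_iff (θ.quaternionic x hx), hT.torsionComponents_eq θ hU hx hu,
      θ.obstructionVanishesAt_iff hU hx hu]
    constructor
    · rintro ⟨r, hr⟩
      refine ⟨(-2 : ℝ) • r, ?_⟩
      rw [symAct_smul, ← hr, smul_smul]
      norm_num
    · rintro ⟨r, hr⟩
      exact ⟨(-(1 / 2) : ℝ) • r, by rw [symAct_smul, hr]⟩
  constructor
  · intro h x
    obtain ⟨U, E, θ, hU, hx, -⟩ := g.exists_admissibleFrame x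
    obtain ⟨u, hu⟩ := W.exists_isDualAt θ hU hx
    exact (key θ hU hx hu).1 (h U θ hU x hx u hu)
  · intro h U θ hU x hx u hu
    exact (key θ hU hx hu).2 (h x)

/-- For the normalized complement, the vertical torsion is its own `S^{5,1}` part. -/
theorem IsVerticalTorsion.eq_zero_iff {T : ∀ x : N, Q.H x →ₗ[ℝ] W.W x →ₗ[ℝ] W.W x}
    (hT : IsVerticalTorsion g W T) (hW : IsNormalized g W) :
    (∀ x, T x = 0) ↔ ∀ x, Q.ObstructionVanishesAt x := by
  refine forall_congr' fun x => ?_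
  obtain ⟨U, E, θ, hU, hx, -⟩ := g.exists_admissibleFrame x
  obtain ⟨u, hu⟩ := W.exists_isDualAt θ hU hx
  have hb := hW U θ hU x hx u hu
  rw [θ.obstructionVanishesAt_iff hU hx hu]
  constructor
  · intro h
    refine ⟨0, ?_⟩
    ext i j X
    have := hT.eq_vertForm θ hU hx hu X i j
    rw [h] at this
    simp only [LinearMap.zero_apply, Submodule.coe_zero, map_zero] at this
    simp only [symAct, Pi.zero_apply, map_zero, add_zero, LinearMap.zero_apply]
    linarith
  · rintro ⟨r, hr⟩
    rw [hr] at hb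
    have hr0 := eq_zero_of_symAct_mem_S51 (θ.quaternionic x hx) hb
    refine LinearMap.ext fun X => LinearMap.ext fun S => ?_
    have h : ∀ i, T x X (u i) = 0 := fun i => by
      rw [W.eq_sum θ hU hx hu (T x X (u i))]
      simp only [hT.eq_vertForm θ hU hx hu, hr, hr0]
      simp [symAct]
    rw [W.eq_sum θ hU hx hu S, map_sum]
    simp [h]

end VerticalTorsion

end QC

theorem proposition2 {N : Type*} [TopologicalSpace N] [T2Space N] [ChartedSpace QC.E7 N]
    [IsManifold (𝓡 7) ∞ N] (Q : QC.QCStructure N) :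
    (∀ g g' : QC.CompatibleMetric Q, QC.Integrable g ↔ QC.Integrable g') ∧
    ∀ g : QC.CompatibleMetric Q,
      (∀ W : QC.Complement Q, ∃! T, QC.IsVerticalTorsion g W T) ∧
      (∃! W : QC.Complement Q, QC.IsReducing g W) ∧
      List.TFAE [
        QC.Integrable g,
        ∀ (W : QC.Complement Q) (T : ∀ x : N, Q.H x →ₗ[ℝ] W.W x →ₗ[ℝ] W.W x),
          QC.IsReducing g W → QC.IsVerticalTorsion g W T → ∀ x : N, T x = 0,
        ∀ (W : QC.Complement Q) (T : ∀ x : N, Q.H x →ₗ[ℝ] W.W x →ₗ[ℝ] W.W x),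
          QC.IsVerticalTorsion g W T → QC.TorsionS51PartVanishes g T,
        QC.FramesS51PartVanishes g] := by
  refine ⟨fun g g' => (QC.integrable_iff g).trans (QC.integrable_iff g').symm, fun g => ?_⟩
  obtain ⟨W₀, hW₀⟩ := g.exists_isNormalized
  obtain ⟨T₀, hT₀⟩ := QC.exists_isVerticalTorsion g W₀
  refine ⟨fun W => ?_, ⟨W₀, QC.isReducing_iff.2 hW₀, fun W hW =>
    (QC.isReducing_iff.1 hW).unique hW₀⟩, ?_⟩
  · obtain ⟨T, hT⟩ := QC.exists_isVerticalTorsion g W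
    exact ⟨T, hT, fun T' hT' => hT'.unique hT⟩
  · tfae_have 1 ↔ 4 := (QC.integrable_iff g).trans (QC.framesS51PartVanishes_iff g).symm
    tfae_have 2 ↔ 4 := by
      rw [QC.framesS51PartVanishes_iff g]
      exact ⟨fun h => (hT₀.eq_zero_iff hW₀).1 (h W₀ T₀ (QC.isReducing_iff.2 hW₀) hT₀),
        fun h W T hW hT => (hT.eq_zero_iff (QC.isReducing_iff.1 hW)).2 h⟩
    tfae_have 3 ↔ 4 := by
      rw [QC.framesS51PartVanishes_iff g]
      exact ⟨fun h => hT₀.torsionS51PartVanishes_iff.1 (h W₀ T₀ hT₀),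
        fun h W T hT => hT.torsionS51PartVanishes_iff.2 h⟩
    tfae_finish
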